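/- All graphs are finite and simple; all algebras are complex unital $*$-algebras. A graph is *2-connected* if it is connected and the removal of any one vertex does not disconnect it ($K_1$ and $K_2$ are 2-connected); a *block* of $G$ is a maximal 2-connected subgraph; a *block graph* is a graph all of whose blocks are complete. A *cut vertex* is a vertex whose removal increases the number of connected components; by convention the vertex of $K_1$ is also a cut vertex. $Z(G)$ is the set of vertices of minimum eccentricity. A *quantum permutation group* is a $*$-algebra $A$ generated by the coefficients of a magic unitary $U=(u_{ij})_{i,j\in I}$ with $I$ finite nonempty ($u_{ij}=u_{ij}^2=u_{ij}^*$, distinct entries in one row or one column have product $0$, rows and columns sum to $1$), with a unital $*$-morphism $\Delta:A\to A\otimes A$ such that $\Delta(u_{ij})=\sum_k u_{ik}\otimes u_{kj}$. Isomorphisms are $*$-isomorphisms that intertwine the comultiplications. For a graph $G$, $\mathrm{Qu}(G)$ is given by the universal $*$-algebra generated by the coefficients of a magic unitary $U=(u_{xy})_{x,y\in V(G)}$ that commutes with the adjacency matrix of $G$; $\mathrm{Fix}_{\mathrm{Qu}(G)}(r)$ is given by the same universal algebra with the further relations $u_{xy}=0$ whenever exactly one of $x,y$ equals $r$. $S_n^+$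 is $\mathrm{Qu}$ of the edgeless graph on $n$ vertices ($S_0^+$ is trivial, with algebra $\mathbb C$). The free product $\ast$ is the free product of unital $*$-algebras with the comultiplication that extends those of the factors. The free wreath product $A\wr_* S_d^+$ is the universal $*$-algebra generated by $d$ copies $\nu_1(A),\dots,\nu_d(A)$ of $A$ and a magic unitary $(s_{ij})_{1\le i,j\le d}$ such that $s_{ij}$ commutes with $\nu_i(A)$, with $\Delta(s_{ij})=\sum_k s_{ik}\otimes s_{kj}$ and $\Delta(\nu_i(a))=\sum_k (s_{ik}\otimes 1)(\nu_i\otimes\nu_k)(\Delta_A(a))$. For a connected graph $G$ and a set $Q\subseteq V(G)$ that consists of a cut vertex or is the vertex set of a block, $\Psi(G,Q)$ is the following graph with marked vertices ("roots"). If $Q=\{r\}$ with $r$ a cut vertex, it is the disjoint union of the graphs $G[C\cup\{r\}]$, where $C$ runs over the connected components of $G\setminus r$, and the copies of $r$ are marked. Otherwise it is $G$ with all edges inside $Q$ removed, and $Q$ is marked. **Theorem.** (1) Let $G$ be a connected block graph. Then $Z(G)$ either consists of a cut vertex or is the vertex set of a block, and one can write $$\Psi(G,Z(G))\cong z.(K_1,V(K_1))\oplus\bigoplus_{i=1}^k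 a_i.(G_i,r_i),$$ with $z,k\ge 0$, $a_i\ge 1$ and pairwise non-isomorphic connected rooted block graphs $(G_i,r_i)$ on at least two vertices (so $z$ is the number of isolated vertices of $\Psi(G,Z(G))$). For every such decomposition, $$\mathrm{Qu}(G)\cong S_z^+\ast\mathop{\ast}_{i=1}^k\bigl(\mathrm{Fix}_{\mathrm{Qu}(G_i)}(r_i)\wr_* S_{a_i}^+\bigr),\qquad \mathrm{Aut}(G)\cong S_z\times\prod_{i=1}^k\bigl(\mathrm{Fix}_{\mathrm{Aut}(G_i)}(r_i)\wr S_{a_i}\bigr),$$ as quantum groups and as groups, respectively. (2) Up to isomorphism, the automorphism groups of block graphs are exactly the groups in $\mathrm{Jor}(1)$, the closure of the trivial group under direct products and wreath products with the symmetric groups $S_d$, $d\ge 1$. (3) Up to isomorphism, the quantum automorphism groups of block graphs are exactly the quantum permutation groups in $\mathrm{Jor}^+(\mathbb C)$, the closure of the trivial one (with algebra $\mathbb C$) under free products and free wreath products with the quantum permutation groups $S_d^+$, $d\ge 1$. -/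

import Mathlib

open scoped TensorProduct

noncomputable section

namespace QBlock

/-! ### Unital `*`-algebras given by generators and relations

All algebras are complex unital `*`-algebras (no norm), as everywhere below. -/

/-- Formal `*`-polynomials in the generators `X`. -/
inductive StarTerm (X : Type) : Type
  | gen (x : X) : StarTerm X
  | scalar (c : ℂ) : StarTerm X
  | add (s t : StarTerm X) : StarTerm X
  | mul (s t : StarTerm X) : StarTerm X
  | star (s : StarTerm X) : StarTerm X

/-- The value of a formal `*`-polynomial in a unital `*`-algebra. -/
def StarTerm.eval {X B : Type} [Ring B] [StarRing B] [Algebra ℂ B] (f : X → B) :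
    StarTerm X → B
  | gen x => f x
  | scalar c => algebraMap ℂ B c
  | add s t => s.eval f + t.eval f
  | mul s t => s.eval f * t.eval f
  | star s => Star.star (s.eval f)

/-- A set of relations on generators `X`: for every unital `*`-algebra `B`, the families
`f : X → B` that satisfy the relations. -/
def Relations (X : Type) : Type 1 :=
  ∀ (B : Type) [Ring B] [StarRing B] [Algebra ℂ B] [StarModule ℂ B], (X → B) → Prop

/-- Two formal `*`-polynomials are identified when the relations force them to be equal,
that is, when they take the same value on every family satisfying the relations. -/
def relSetoid {X : Type} (P : Relations X) : Setoid (StarTerm X) where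
  r s t := ∀ (B : Type) [Ring B] [StarRing B] [Algebra ℂ B] [StarModule ℂ B] (f : X → B),
    P B f → s.eval f = t.eval f
  iseqv :=
    { refl := by intro s B _ _ _ _ f _; rfl
      symm := by intro s t h B _ _ _ _ f hf; exact (h B f hf).symm
      trans := by intro s t u h h' B _ _ _ _ f hf; exact (h B f hf).trans (h' B f hf) }

/-- The universal unital `*`-algebra generated by `X` subject to the relations `P`. -/
def Univ {X : Type} (P : Relations X) : Type := Quotient (relSetoid P)

namespace Univ

variable {X : Type} {P : Relations X}

/-- The generators. -/
def of (P : Relations X) (x : X) : Univ P := Quotient.mk (relSetoid P) (.gen x)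

/-- Evaluation at a family satisfying the relations (see `Univ.lift`). -/
def ev {B : Type} [Ring B] [StarRing B] [Algebra ℂ B] [StarModule ℂ B] (f : X → B)
    (hf : P B f) : Univ P → B :=
  Quotient.lift (fun s => s.eval f) (fun _ _ h => h B f hf)

theorem ext_ev {a b : Univ P}
    (h : ∀ (B : Type) [Ring B] [StarRing B] [Algebra ℂ B] [StarModule ℂ B] (f : X → B)
      (hf : P B f), ev f hf a = ev f hf b) : a = b := by
  induction a using Quotient.inductionOn
  induction b using Quotient.inductionOn
  exact Quotient.sound (fun B _ _ _ _ f hf => h B f hf)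

instance : Add (Univ P) :=
  ⟨Quotient.map₂ .add (fun _ _ h _ _ h' => by
    intro B _ _ _ _ f hf
    simp only [StarTerm.eval, h B f hf, h' B f hf])⟩

instance : Mul (Univ P) :=
  ⟨Quotient.map₂ .mul (fun _ _ h _ _ h' => by
    intro B _ _ _ _ f hf
    simp only [StarTerm.eval, h B f hf, h' B f hf])⟩

instance : Star (Univ P) :=
  ⟨Quotient.map .star (fun _ _ h => by
    intro B _ _ _ _ f hf
    simp only [StarTerm.eval, h B f hf])⟩

/-- The scalars. -/
def ofScalar (P : Relations X) (c : ℂ) : Univ P := Quotient.mk (relSetoid P) (.scalar c)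

instance : Zero (Univ P) := ⟨ofScalar P 0⟩
instance : One (Univ P) := ⟨ofScalar P 1⟩
instance : Neg (Univ P) := ⟨fun a => ofScalar P (-1) * a⟩

section
variable {B : Type} [Ring B] [StarRing B] [Algebra ℂ B] [StarModule ℂ B] (f : X → B)
    (hf : P B f)

theorem ev_of (x : X) : ev f hf (of P x) = f x := rfl

theorem ev_ofScalar (c : ℂ) : ev f hf (ofScalar P c) = algebraMap ℂ B c := rfl

theorem ev_add (a b : Univ P) : ev f hf (a + b) = ev f hf a + ev f hf b := by
  induction a using Quotient.inductionOn
  induction b using Quotient.inductionOn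
  rfl

theorem ev_mul (a b : Univ P) : ev f hf (a * b) = ev f hf a * ev f hf b := by
  induction a using Quotient.inductionOn
  induction b using Quotient.inductionOn
  rfl

theorem ev_star (a : Univ P) : ev f hf (star a) = star (ev f hf a) := by
  induction a using Quotient.inductionOn
  rfl

theorem ev_zero : ev f hf 0 = 0 := (ev_ofScalar f hf 0).trans (map_zero _)

theorem ev_one : ev f hf 1 = 1 := (ev_ofScalar f hf 1).trans (map_one _)

theorem ev_neg (a : Univ P) : ev f hf (-a) = -ev f hf a :=
  (ev_mul f hf (ofScalar P (-1)) a).trans (by rw [ev_ofScalar]; simp)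

end

instance : Ring (Univ P) :=
  Ring.ofMinimalAxioms
    (fun a b c => ext_ev (fun B _ _ _ _ f hf => by simp only [ev_add, add_assoc]))
    (fun a => ext_ev (fun B _ _ _ _ f hf => by simp only [ev_add, ev_zero, zero_add]))
    (fun a => ext_ev (fun B _ _ _ _ f hf => by
      simp only [ev_add, ev_neg, ev_zero, neg_add_cancel]))
    (fun a b c => ext_ev (fun B _ _ _ _ f hf => by simp only [ev_mul, mul_assoc]))
    (fun a => ext_ev (fun B _ _ _ _ f hf => by simp only [ev_mul, ev_one, one_mul]))
    (fun a => ext_ev (fun B _ _ _ _ f hf => by simp only [ev_mul, ev_one, mul_one]))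
    (fun a b c => ext_ev (fun B _ _ _ _ f hf => by simp only [ev_mul, ev_add, mul_add]))
    (fun a b c => ext_ev (fun B _ _ _ _ f hf => by simp only [ev_mul, ev_add, add_mul]))

instance : Algebra ℂ (Univ P) :=
  RingHom.toAlgebra'
    { toFun := ofScalar P
      map_one' := rfl
      map_zero' := rfl
      map_mul' := fun c d => ext_ev (fun B _ _ _ _ f hf => by
        simp only [ev_mul, ev_ofScalar, map_mul])
      map_add' := fun c d => ext_ev (fun B _ _ _ _ f hf => by
        simp only [ev_add, ev_ofScalar, map_add]) }
    (fun c a => ext_ev (fun B _ _ _ _ f hf => by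
      simp only [RingHom.coe_mk, MonoidHom.coe_mk, OneHom.coe_mk, ev_mul, ev_ofScalar]
      exact Algebra.commutes c _))

theorem ev_algebraMap {B : Type} [Ring B] [StarRing B] [Algebra ℂ B] [StarModule ℂ B]
    (f : X → B) (hf : P B f) (c : ℂ) :
    ev f hf (algebraMap ℂ (Univ P) c) = algebraMap ℂ B c := rfl

instance : StarRing (Univ P) where
  star_involutive a := ext_ev (fun B _ _ _ _ f hf => by simp only [ev_star, star_star])
  star_mul a b := ext_ev (fun B _ _ _ _ f hf => by simp only [ev_star, ev_mul, star_mul])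
  star_add a b := ext_ev (fun B _ _ _ _ f hf => by simp only [ev_star, ev_add, star_add])

instance : StarModule ℂ (Univ P) where
  star_smul c a := ext_ev (fun B _ _ _ _ f hf => by
    simp only [Algebra.smul_def, ev_star, ev_mul, ev_algebraMap, star_mul]
    rw [← algebraMap_star_comm, Algebra.commutes])

/-- The universal property: a family satisfying the relations extends to a `*`-morphism. -/
def lift {B : Type} [Ring B] [StarRing B] [Algebra ℂ B] [StarModule ℂ B] (f : X → B)
    (hf : P B f) : Univ P →⋆ₐ[ℂ] B where
  toFun := ev f hf
  map_one' := ev_one f hf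
  map_zero' := ev_zero f hf
  map_mul' := ev_mul f hf
  map_add' := ev_add f hf
  commutes' := ev_algebraMap f hf
  map_star' := ev_star f hf

theorem lift_of {B : Type} [Ring B] [StarRing B] [Algebra ℂ B] [StarModule ℂ B] (f : X → B)
    (hf : P B f) (x : X) : lift f hf (of P x) = f x := rfl

theorem ext_lift {a b : Univ P}
    (h : ∀ (B : Type) [Ring B] [StarRing B] [Algebra ℂ B] [StarModule ℂ B] (f : X → B)
      (hf : P B f), lift f hf a = lift f hf b) : a = b :=
  ext_ev h

/-- The generators generate. -/
theorem mem_of_subset (S : StarSubalgebra ℂ (Univ P)) (hS : ∀ x, of P x ∈ S) (a : Univ P) :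
    a ∈ S := by
  induction a using Quotient.inductionOn with
  | _ s =>
    induction s with
    | gen x => exact hS x
    | scalar c => exact algebraMap_mem S c
    | add s t hs ht => exact add_mem hs ht
    | mul s t hs ht => exact mul_mem hs ht
    | star s hs => exact star_mem hs

end Univ

/-! ### Magic unitaries and quantum permutation groups -/

/-- A magic unitary with coefficients in a unital `*`-algebra. -/
structure IsMagic {I A : Type} [Fintype I] [Ring A] [StarRing A] (U : I → I → A) : Prop where
  idem : ∀ i j, U i j * U i j = U i j
  star_eq : ∀ i j, star (U i j) = U i j
  row_orth : ∀ i j k, j ≠ k → U i j * U i k = 0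
  col_orth : ∀ i j k, i ≠ k → U i j * U k j = 0
  row_sum : ∀ i, ∑ j, U i j = 1
  col_sum : ∀ j, ∑ i, U i j = 1

/-- The matrix `(∑ k, U i k ⊗ U k j)`. -/
def coprod {I A : Type} [Fintype I] [Ring A] [Algebra ℂ A] (U : I → I → A) :
    I → I → A ⊗[ℂ] A :=
  fun i j => ∑ k, U i k ⊗ₜ[ℂ] U k j

theorem coprod_apply {I A : Type} [Fintype I] [Ring A] [Algebra ℂ A] (U : I → I → A) (i j : I) :
    coprod U i j = ∑ k, U i k ⊗ₜ[ℂ] U k j := rfl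

/-- `U` is a fundamental representation for the comultiplication `Δ` on `A`: a magic unitary
whose coefficients generate `A` and such that `Δ (U i j) = ∑ k, U i k ⊗ U k j`. -/
structure IsFundamental {I A : Type} [Fintype I] [Ring A] [StarRing A] [Algebra ℂ A]
    [StarModule ℂ A] (Δ : A →⋆ₐ[ℂ] A ⊗[ℂ] A) (U : I → I → A) : Prop where
  magic : IsMagic U
  generates : StarAlgebra.adjoin ℂ (Set.range fun p : I × I => U p.1 p.2) = ⊤
  comul_eq : ∀ i j, Δ (U i j) = coprod U i j

/-- A quantum permutation group: a unital `*`-algebra with a comultiplication, which admits a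
fundamental representation indexed by a nonempty finite set. -/
structure QPG : Type 1 where
  carrier : Type
  [ring : Ring carrier]
  [starRing : StarRing carrier]
  [algebra : Algebra ℂ carrier]
  [starModule : StarModule ℂ carrier]
  comul : carrier →⋆ₐ[ℂ] carrier ⊗[ℂ] carrier
  exists_fundamental : ∃ (I : Type) (_ : Fintype I) (_ : Nonempty I) (U : I → I → carrier),
    IsFundamental comul U

attribute [instance] QPG.ring QPG.starRing QPG.algebra QPG.starModule

/-- The tensor product of two `*`-morphisms. -/
def tmap {A B C D : Type} [Ring A] [StarRing A] [Algebra ℂ A] [StarModule ℂ A]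
    [Ring B] [StarRing B] [Algebra ℂ B] [StarModule ℂ B]
    [Ring C] [StarRing C] [Algebra ℂ C] [StarModule ℂ C]
    [Ring D] [StarRing D] [Algebra ℂ D] [StarModule ℂ D]
    (f : A →⋆ₐ[ℂ] C) (g : B →⋆ₐ[ℂ] D) : A ⊗[ℂ] B →⋆ₐ[ℂ] C ⊗[ℂ] D where
  toAlgHom := Algebra.TensorProduct.map f.toAlgHom g.toAlgHom
  map_star' x := by
    induction x using TensorProduct.induction_on with
    | zero => simp
    | tmul a b => simp [map_star]
    | add x y hx hy =>
      simp only [star_add] at *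
      simp_all

/-- Two quantum permutation groups are isomorphic: there is a `*`-isomorphism that intertwines
the comultiplications. -/
def QPG.Iso (Q R : QPG) : Prop :=
  ∃ e : Q.carrier ≃⋆ₐ[ℂ] R.carrier,
    ∀ a, R.comul (e a) = tmap (e : Q.carrier →⋆ₐ[ℂ] R.carrier) e (Q.comul a)

/-! ### Facts on magic unitaries used in the constructions below -/

section Magic

set_option linter.unusedSectionVars false

variable {I A B : Type} [Fintype I] [Ring A] [StarRing A] [Algebra ℂ A] [StarModule ℂ A]
  [Ring B] [StarRing B] [Algebra ℂ B] [StarModule ℂ B]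

theorem IsMagic.map {U : I → I → A} (h : IsMagic U) (f : A →⋆ₐ[ℂ] B) :
    IsMagic (fun i j => f (U i j)) where
  idem i j := by rw [← map_mul, h.idem]
  star_eq i j := by rw [← map_star, h.star_eq]
  row_orth i j k hjk := by rw [← map_mul, h.row_orth i j k hjk, map_zero]
  col_orth i j k hik := by rw [← map_mul, h.col_orth i j k hik, map_zero]
  row_sum i := by rw [← map_sum, h.row_sum, map_one]
  col_sum j := by rw [← map_sum, h.col_sum, map_one]

theorem IsMagic.coprod {U : I → I → A} (h : IsMagic U) : IsMagic (coprod U) := by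
  classical
  have hr : ∀ i j k, U i j * U i k = if j = k then U i j else 0 := by
    intro i j k
    split_ifs with hjk
    · rw [← hjk, h.idem]
    · exact h.row_orth i j k hjk
  have hc : ∀ i j k, U i j * U k j = if i = k then U i j else 0 := by
    intro i j k
    split_ifs with hjk
    · rw [← hjk, h.idem]
    · exact h.col_orth i j k hjk
  refine ⟨fun i j => ?_, fun i j => ?_, fun i j k hjk => ?_, fun i j k hik => ?_,
    fun i => ?_, fun j => ?_⟩
  · simp [QBlock.coprod, Finset.sum_mul, Finset.mul_sum, hr, TensorProduct.ite_tmul]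
  · simp [QBlock.coprod, h.star_eq]
  · simp [QBlock.coprod, Finset.sum_mul, Finset.mul_sum, hr, TensorProduct.ite_tmul, hjk]
  · simp [QBlock.coprod, Finset.sum_mul, Finset.mul_sum, hc, TensorProduct.tmul_ite, hik]
  · simp only [QBlock.coprod]
    rw [Finset.sum_comm]
    simp_rw [← TensorProduct.tmul_sum, h.row_sum, ← TensorProduct.sum_tmul, h.row_sum]
    rfl
  · simp only [QBlock.coprod]
    rw [Finset.sum_comm]
    simp_rw [← TensorProduct.sum_tmul, h.col_sum, ← TensorProduct.tmul_sum, h.col_sum]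
    rfl

theorem tmap_coprod (f : A →⋆ₐ[ℂ] B) (U : I → I → A) (i j : I) :
    tmap f f (coprod U i j) = coprod (fun i j => f (U i j)) i j := by
  simp only [coprod, map_sum]
  rfl

theorem tmap_tmul {C D : Type} [Ring C] [StarRing C] [Algebra ℂ C] [StarModule ℂ C]
    [Ring D] [StarRing D] [Algebra ℂ D] [StarModule ℂ D]
    (f : A →⋆ₐ[ℂ] C) (g : B →⋆ₐ[ℂ] D) (a : A) (b : B) :
    tmap f g (a ⊗ₜ[ℂ] b) = f a ⊗ₜ[ℂ] g b := rfl

/-- The block-diagonal matrix `diag(1, U)`. -/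
def addOne (U : I → I → A) : Option I → Option I → A
  | none, none => 1
  | none, some _ => 0
  | some _, none => 0
  | some i, some j => U i j

/-- A fundamental representation that is allowed to have size zero becomes one of positive
size when a block `1` is added. -/
theorem IsFundamental.addOne {Δ : A →⋆ₐ[ℂ] A ⊗[ℂ] A} {U : I → I → A}
    (h : IsFundamental Δ U) : IsFundamental Δ (addOne U) := by
  refine ⟨⟨?_, ?_, ?_, ?_, ?_, ?_⟩, ?_, ?_⟩
  · rintro (_ | i) (_ | j) <;> simp [QBlock.addOne, h.magic.idem]
  · rintro (_ | i) (_ | j) <;> simp [QBlock.addOne, h.magic.star_eq]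
  · rintro (_ | i) (_ | j) (_ | k) hjk <;>
      simp_all [QBlock.addOne, h.magic.row_orth]
  · rintro (_ | i) (_ | j) (_ | k) hjk <;>
      simp_all [QBlock.addOne, h.magic.col_orth]
  · rintro (_ | i) <;> simp [QBlock.addOne, h.magic.row_sum]
  · rintro (_ | i) <;> simp [QBlock.addOne, h.magic.col_sum]
  · rw [eq_top_iff, ← h.generates]
    refine StarAlgebra.adjoin_mono ?_
    rintro _ ⟨p, rfl⟩
    exact ⟨(some p.1, some p.2), rfl⟩
  · rintro (_ | i) (_ | j)
    · simp [QBlock.addOne, coprod, Algebra.TensorProduct.one_def]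
    · simp [QBlock.addOne, coprod]
    · simp [QBlock.addOne, coprod]
    · simp [QBlock.addOne, coprod, h.comul_eq]

theorem IsFundamental.exists {Δ : A →⋆ₐ[ℂ] A ⊗[ℂ] A} {U : I → I → A}
    (h : IsFundamental Δ U) :
    ∃ (I : Type) (_ : Fintype I) (_ : Nonempty I) (U : I → I → A), IsFundamental Δ U :=
  ⟨Option I, inferInstance, inferInstance, _, h.addOne⟩

end Magic

/-! ### Quantum automorphism groups of graphs -/

open Classical in
/-- `U` is a magic unitary that commutes with the adjacency matrix of `G` and stabilises the
set of vertices `R`. -/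
structure IsAdapted {V A : Type} [Fintype V] [Ring A] [StarRing A] (G : SimpleGraph V)
    (R : Set V) (U : V → V → A) : Prop where
  magic : IsMagic U
  comm : Matrix.of U * G.adjMatrix A = G.adjMatrix A * Matrix.of U
  stab : ∀ x y, (x ∈ R ∧ y ∉ R) ∨ (x ∉ R ∧ y ∈ R) → U x y = 0

theorem IsAdapted.coprod {V A : Type} [Fintype V] [Ring A] [StarRing A] [Algebra ℂ A]
    [StarModule ℂ A] {G : SimpleGraph V} {R : Set V} {U : V → V → A} (h : IsAdapted G R U) :
    IsAdapted G R (coprod U) := by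
  classical
  have hc : ∀ x y, ∑ z, (if G.Adj z y then U x z else 0) =
      ∑ z, (if G.Adj x z then U z y else 0) := by
    intro x y
    have := congrFun (congrFun h.comm x) y
    simp only [Matrix.mul_apply, SimpleGraph.adjMatrix_apply, Matrix.of_apply, mul_ite, mul_one,
      mul_zero, ite_mul, one_mul, zero_mul] at this
    convert this
  refine ⟨h.magic.coprod, ?_, ?_⟩
  · ext x y
    simp only [Matrix.mul_apply, SimpleGraph.adjMatrix_apply, Matrix.of_apply, mul_ite, mul_one,
      mul_zero, ite_mul, one_mul, zero_mul, QBlock.coprod]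
    have e1 : ∀ z, (if G.Adj z y then ∑ k, U x k ⊗ₜ[ℂ] U k z else 0) =
        ∑ k, U x k ⊗ₜ[ℂ] (if G.Adj z y then U k z else 0) := by
      intro z; split_ifs <;> simp
    have e2 : ∀ z, (if G.Adj x z then ∑ k, U z k ⊗ₜ[ℂ] U k y else 0) =
        ∑ k, (if G.Adj x z then U z k else 0) ⊗ₜ[ℂ] U k y := by
      intro z; split_ifs <;> simp
    have key : ∑ z, (if G.Adj z y then ∑ k, U x k ⊗ₜ[ℂ] U k z else 0) =
        ∑ z, (if G.Adj x z then ∑ k, U z k ⊗ₜ[ℂ] U k y else 0) := by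
      have e3 : ∀ k, ∑ z, U x k ⊗ₜ[ℂ] (if G.Adj z y then U k z else 0) =
          ∑ z, if G.Adj k z then U x k ⊗ₜ[ℂ] U z y else 0 := by
        intro k
        rw [← TensorProduct.tmul_sum, hc, TensorProduct.tmul_sum]
        exact Finset.sum_congr rfl fun z _ => by split_ifs <;> simp
      have e4 : ∀ k, ∑ z, (if G.Adj x z then U z k else 0) ⊗ₜ[ℂ] U k y =
          ∑ z, if G.Adj z k then U x z ⊗ₜ[ℂ] U k y else 0 := by
        intro k
        rw [← TensorProduct.sum_tmul, ← hc, TensorProduct.sum_tmul]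
        exact Finset.sum_congr rfl fun z _ => by split_ifs <;> simp
      rw [Finset.sum_congr rfl fun z _ => e1 z, Finset.sum_congr rfl fun z _ => e2 z,
        Finset.sum_comm, Finset.sum_congr rfl fun k _ => e3 k, Finset.sum_comm, eq_comm,
        Finset.sum_comm, Finset.sum_congr rfl fun k _ => e4 k]
    convert key
  · intro x y hxy
    refine Finset.sum_eq_zero fun z _ => ?_
    by_cases hz : z ∈ R
    · rcases hxy with ⟨_, hy⟩ | ⟨hx, _⟩
      · rw [h.stab z y (Or.inl ⟨hz, hy⟩), TensorProduct.tmul_zero]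
      · rw [h.stab x z (Or.inr ⟨hx, hz⟩), TensorProduct.zero_tmul]
    · rcases hxy with ⟨hx, _⟩ | ⟨_, hy⟩
      · rw [h.stab x z (Or.inl ⟨hx, hz⟩), TensorProduct.zero_tmul]
      · rw [h.stab z y (Or.inr ⟨hz, hy⟩), TensorProduct.tmul_zero]

section QuStab

variable {V : Type} [Fintype V]

/-- The relations on `V × V` saying that the generators form a matrix adapted to `(G, R)`. -/
def stabRel (G : SimpleGraph V) (R : Set V) : Relations (V × V) :=
  fun _ _ _ _ _ f => IsAdapted G R (fun x y => f (x, y))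

theorem isAdapted_of (G : SimpleGraph V) (R : Set V) :
    IsAdapted G R (fun x y => Univ.of (stabRel G R) (x, y)) := by
  classical
  refine ⟨⟨?_, ?_, ?_, ?_, ?_, ?_⟩, ?_, ?_⟩
  · exact fun i j => Univ.ext_lift fun B _ _ _ _ f hf => by
      rw [map_mul, Univ.lift_of]; exact hf.magic.idem i j
  · exact fun i j => Univ.ext_lift fun B _ _ _ _ f hf => by
      rw [map_star, Univ.lift_of]; exact hf.magic.star_eq i j
  · exact fun i j k h => Univ.ext_lift fun B _ _ _ _ f hf => by
      rw [map_mul, map_zero]; exact hf.magic.row_orth i j k h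
  · exact fun i j k h => Univ.ext_lift fun B _ _ _ _ f hf => by
      rw [map_mul, map_zero]; exact hf.magic.col_orth i j k h
  · exact fun i => Univ.ext_lift fun B _ _ _ _ f hf => by
      rw [map_sum, map_one]; exact hf.magic.row_sum i
  · exact fun i => Univ.ext_lift fun B _ _ _ _ f hf => by
      rw [map_sum, map_one]; exact hf.magic.col_sum i
  · ext x y
    refine Univ.ext_lift fun B _ _ _ _ f hf => ?_
    have := congrFun (congrFun hf.comm x) y
    simp only [Matrix.mul_apply, map_sum, map_mul, Matrix.of_apply, Univ.lift_of,
      SimpleGraph.adjMatrix_apply, apply_ite (Univ.lift f hf), map_one, map_zero] at this ⊢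
    exact this
  · exact fun x y h => Univ.ext_lift fun B _ _ _ _ f hf => by
      rw [map_zero]; exact hf.stab x y h

/-- The stabiliser of `R` in the quantum automorphism group of `G`, given by its universal
`*`-algebra and the comultiplication `u x y ↦ ∑ z, u x z ⊗ u z y`. -/
def quStab (G : SimpleGraph V) (R : Set V) : QPG where
  carrier := Univ (stabRel G R)
  comul := Univ.lift
    (fun p => coprod (fun x y => Univ.of (stabRel G R) (x, y)) p.1 p.2)
    (isAdapted_of G R).coprod
  exists_fundamental := IsFundamental.exists
    (U := fun x y => Univ.of (stabRel G R) (x, y))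
    { magic := (isAdapted_of G R).magic
      generates := by
        rw [eq_top_iff]
        exact fun a _ => Univ.mem_of_subset _
          (fun p => StarAlgebra.subset_adjoin ℂ _ (Set.mem_range.2 ⟨p, rfl⟩)) a
      comul_eq := fun i j => Univ.lift_of _ _ _ }

/-- The quantum automorphism group of `G` (no set of vertices has to be stabilised). -/
def qu (G : SimpleGraph V) : QPG := quStab G ∅

/-- The stabiliser of a vertex in the quantum automorphism group of `G`. -/
def quFix (G : SimpleGraph V) (r : V) : QPG := quStab G {r}

end QuStab

/-- The quantum permutation group `S_n^+`. -/
def SPlus (n : ℕ) : QPG := qu (⊥ : SimpleGraph (Fin n))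

/-! ### Free products -/

section FreeProduct

variable {ι : Type} (Q : ι → QPG)

/-- The relations of the free product: the generators carry `*`-morphisms from every factor. -/
def freeRel : Relations (Σ i, (Q i).carrier) :=
  fun B _ _ _ _ f => ∃ g : ∀ i, (Q i).carrier →⋆ₐ[ℂ] B, ∀ i a, f ⟨i, a⟩ = g i a

/-- The inclusion of a factor in the free product. -/
def freeIncl (i : ι) : (Q i).carrier →⋆ₐ[ℂ] Univ (freeRel Q) where
  toFun a := Univ.of (freeRel Q) ⟨i, a⟩
  map_one' := Univ.ext_lift fun B _ _ _ _ f hf => by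
    obtain ⟨g, hg⟩ := id hf
    rw [map_one, Univ.lift_of, hg, map_one]
  map_zero' := Univ.ext_lift fun B _ _ _ _ f hf => by
    obtain ⟨g, hg⟩ := id hf
    rw [map_zero, Univ.lift_of, hg, map_zero]
  map_mul' a b := Univ.ext_lift fun B _ _ _ _ f hf => by
    obtain ⟨g, hg⟩ := id hf
    simp only [map_mul, Univ.lift_of, hg]
  map_add' a b := Univ.ext_lift fun B _ _ _ _ f hf => by
    obtain ⟨g, hg⟩ := id hf
    simp only [map_add, Univ.lift_of, hg]
  commutes' c := Univ.ext_lift fun B _ _ _ _ f hf => by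
    obtain ⟨g, hg⟩ := id hf
    rw [Univ.lift_of, hg, AlgHomClass.commutes, AlgHomClass.commutes]
  map_star' a := Univ.ext_lift fun B _ _ _ _ f hf => by
    obtain ⟨g, hg⟩ := id hf
    simp only [map_star, Univ.lift_of, hg]

/-- The comultiplication of the free product restricts to those of the factors. -/
def freeComul : Univ (freeRel Q) →⋆ₐ[ℂ] Univ (freeRel Q) ⊗[ℂ] Univ (freeRel Q) :=
  Univ.lift (fun p => tmap (freeIncl Q p.1) (freeIncl Q p.1) ((Q p.1).comul p.2))
    ⟨fun i => (tmap (freeIncl Q i) (freeIncl Q i)).comp (Q i).comul, fun _ _ => rfl⟩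

theorem freeComul_incl (i : ι) (a : (Q i).carrier) :
    freeComul Q (freeIncl Q i a) = tmap (freeIncl Q i) (freeIncl Q i) ((Q i).comul a) := rfl

theorem isFundamental_blockDiagonal [Fintype ι] [DecidableEq ι] {J : ι → Type}
    [∀ i, Fintype (J i)]
    (U : ∀ i, J i → J i → (Q i).carrier) (hU : ∀ i, IsFundamental (Q i).comul (U i)) :
    IsFundamental (freeComul Q)
      (fun p q =>
        Matrix.blockDiagonal' (fun i => Matrix.of fun x y => freeIncl Q i (U i x y)) p q) := by
  have hW : ∀ i, IsMagic (fun x y => freeIncl Q i (U i x y)) := fun i => (hU i).magic.map _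
  refine ⟨⟨?_, ?_, ?_, ?_, ?_, ?_⟩, ?_, ?_⟩
  · rintro ⟨i, x⟩ ⟨j, y⟩
    by_cases h : i = j
    · subst h
      simpa using (hW i).idem x y
    · simp [Matrix.blockDiagonal'_apply_ne _ _ _ h]
  · rintro ⟨i, x⟩ ⟨j, y⟩
    by_cases h : i = j
    · subst h
      simpa using (hW i).star_eq x y
    · simp [Matrix.blockDiagonal'_apply_ne _ _ _ h]
  · rintro ⟨i, x⟩ ⟨j, y⟩ ⟨k, z⟩ hne
    by_cases h : i = j
    · by_cases h' : i = k
      · subst h; subst h'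
        simpa using (hW i).row_orth x y z (fun e => hne (by rw [e]))
      · simp [Matrix.blockDiagonal'_apply_ne _ _ _ h']
    · simp [Matrix.blockDiagonal'_apply_ne _ _ _ h]
  · rintro ⟨i, x⟩ ⟨j, y⟩ ⟨k, z⟩ hne
    by_cases h : i = j
    · by_cases h' : k = j
      · subst h; subst h'
        simpa using (hW _).col_orth x y z (fun e => hne (by rw [e]))
      · simp [Matrix.blockDiagonal'_apply_ne _ _ _ h']
    · simp [Matrix.blockDiagonal'_apply_ne _ _ _ h]
  · rintro ⟨i, x⟩
    rw [Fintype.sum_sigma, Finset.sum_eq_single i]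
    · simpa using (hW i).row_sum x
    · intro j _ hj
      exact Finset.sum_eq_zero fun y _ => Matrix.blockDiagonal'_apply_ne _ _ _ hj.symm
    · simp
  · rintro ⟨i, x⟩
    rw [Fintype.sum_sigma, Finset.sum_eq_single i]
    · simpa using (hW i).col_sum x
    · intro j _ hj
      exact Finset.sum_eq_zero fun y _ => Matrix.blockDiagonal'_apply_ne _ _ _ hj
    · simp
  · rw [eq_top_iff]
    refine fun a _ => Univ.mem_of_subset _ (fun p => ?_) a
    obtain ⟨i, b⟩ := p
    change freeIncl Q i b ∈ _
    have hb : b ∈ (StarAlgebra.adjoin ℂ (Set.range fun p : (Σ i, J i) × (Σ i, J i) =>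
        Matrix.blockDiagonal' (fun i => Matrix.of fun x y => freeIncl Q i (U i x y))
          p.1 p.2)).comap (freeIncl Q i) := by
      refine (show (⊤ : StarSubalgebra ℂ (Q i).carrier) ≤ _ from ?_) trivial
      rw [← (hU i).generates]
      refine StarAlgebra.adjoin_le ?_
      rintro _ ⟨⟨x, y⟩, rfl⟩
      refine StarAlgebra.subset_adjoin ℂ _ (Set.mem_range.2 ⟨(⟨i, x⟩, ⟨i, y⟩), ?_⟩)
      exact Matrix.blockDiagonal'_apply_eq _ _ _ _
    exact hb
  · rintro ⟨i, x⟩ ⟨j, y⟩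
    by_cases h : i = j
    · subst h
      rw [Matrix.blockDiagonal'_apply_eq, Matrix.of_apply, freeComul_incl, (hU i).comul_eq,
        tmap_coprod, coprod_apply, coprod_apply, Fintype.sum_sigma, Finset.sum_eq_single i]
      · simp
      · intro j _ hj
        exact Finset.sum_eq_zero fun y _ => by
          rw [Matrix.blockDiagonal'_apply_ne _ _ _ hj.symm, TensorProduct.zero_tmul]
      · simp
    · rw [Matrix.blockDiagonal'_apply_ne _ _ _ h, map_zero, coprod_apply]
      refine (Finset.sum_eq_zero ?_).symm
      rintro ⟨k, z⟩ _
      by_cases hk : i = k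
      · subst hk
        rw [Matrix.blockDiagonal'_apply_ne _ z y h, TensorProduct.tmul_zero]
      · rw [Matrix.blockDiagonal'_apply_ne _ x z hk, TensorProduct.zero_tmul]

/-- The free product of a finite family of quantum permutation groups. -/
def freeProd [Fintype ι] : QPG where
  carrier := Univ (freeRel Q)
  comul := freeComul Q
  exists_fundamental := by
    classical
    choose J hJ _ U hU using fun i => (Q i).exists_fundamental
    exact (isFundamental_blockDiagonal Q U hU).exists

/-- The free product of two quantum permutation groups. -/
def freeProd₂ (Q R : QPG) : QPG := freeProd fun b : Bool => cond b Q R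

end FreeProduct

/-! ### Free wreath products -/

section FreeWreath

variable (Q : QPG) (d : ℕ)

/-- The relations of the free wreath product with `S_d^+`: the generators `inl (i, a)` carry `d`
copies `ν i` of the algebra of `Q`, the generators `inr (i, j)` form a magic unitary `s`, and
`s i j` commutes with the image of `ν i`. -/
def wreathRel : Relations ((Fin d × Q.carrier) ⊕ (Fin d × Fin d)) :=
  fun B _ _ _ _ f => ∃ ν : Fin d → Q.carrier →⋆ₐ[ℂ] B,
    (∀ i a, f (Sum.inl (i, a)) = ν i a) ∧ IsMagic (fun i j => f (Sum.inr (i, j))) ∧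
      ∀ i j a, Commute (ν i a) (f (Sum.inr (i, j)))

/-- The algebra of the free wreath product. -/
abbrev WreathAlg : Type := Univ (wreathRel Q d)

/-- The `i`-th copy of the algebra of `Q` in the free wreath product. -/
def wreathIncl (i : Fin d) : Q.carrier →⋆ₐ[ℂ] WreathAlg Q d where
  toFun a := Univ.of (wreathRel Q d) (Sum.inl (i, a))
  map_one' := Univ.ext_lift fun B _ _ _ _ f hf => by
    obtain ⟨g, hg, -⟩ := id hf
    rw [map_one, Univ.lift_of, hg, map_one]
  map_zero' := Univ.ext_lift fun B _ _ _ _ f hf => by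
    obtain ⟨g, hg, -⟩ := id hf
    rw [map_zero, Univ.lift_of, hg, map_zero]
  map_mul' a b := Univ.ext_lift fun B _ _ _ _ f hf => by
    obtain ⟨g, hg, -⟩ := id hf
    simp only [map_mul, Univ.lift_of, hg]
  map_add' a b := Univ.ext_lift fun B _ _ _ _ f hf => by
    obtain ⟨g, hg, -⟩ := id hf
    simp only [map_add, Univ.lift_of, hg]
  commutes' c := Univ.ext_lift fun B _ _ _ _ f hf => by
    obtain ⟨g, hg, -⟩ := id hf
    rw [Univ.lift_of, hg, AlgHomClass.commutes, AlgHomClass.commutes]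
  map_star' a := Univ.ext_lift fun B _ _ _ _ f hf => by
    obtain ⟨g, hg, -⟩ := id hf
    simp only [map_star, Univ.lift_of, hg]

/-- The magic unitary of `S_d^+` in the free wreath product. -/
def wreathPerm (i j : Fin d) : WreathAlg Q d := Univ.of (wreathRel Q d) (Sum.inr (i, j))

theorem isMagic_wreathPerm : IsMagic (wreathPerm Q d) := by
  refine ⟨?_, ?_, ?_, ?_, ?_, ?_⟩
  · exact fun i j => Univ.ext_lift fun B _ _ _ _ f hf => by
      rw [map_mul]; exact hf.choose_spec.2.1.idem i j
  · exact fun i j => Univ.ext_lift fun B _ _ _ _ f hf => by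
      rw [map_star]; exact hf.choose_spec.2.1.star_eq i j
  · exact fun i j k h => Univ.ext_lift fun B _ _ _ _ f hf => by
      rw [map_mul, map_zero]; exact hf.choose_spec.2.1.row_orth i j k h
  · exact fun i j k h => Univ.ext_lift fun B _ _ _ _ f hf => by
      rw [map_mul, map_zero]; exact hf.choose_spec.2.1.col_orth i j k h
  · exact fun i => Univ.ext_lift fun B _ _ _ _ f hf => by
      rw [map_sum, map_one]; exact hf.choose_spec.2.1.row_sum i
  · exact fun i => Univ.ext_lift fun B _ _ _ _ f hf => by
      rw [map_sum, map_one]; exact hf.choose_spec.2.1.col_sum i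

theorem commute_wreath (i j : Fin d) (a : Q.carrier) :
    Commute (wreathIncl Q d i a) (wreathPerm Q d i j) :=
  Univ.ext_lift fun B _ _ _ _ f hf => by
    obtain ⟨g, hg, -, hc⟩ := id hf
    rw [map_mul, map_mul]
    change f (Sum.inl (i, a)) * f (Sum.inr (i, j)) = f (Sum.inr (i, j)) * f (Sum.inl (i, a))
    rw [hg]
    exact hc i j a

theorem commute_left (i k l : Fin d) (x : Q.carrier ⊗[ℂ] Q.carrier) :
    Commute (wreathPerm Q d i l ⊗ₜ[ℂ] (1 : WreathAlg Q d))
      (tmap (wreathIncl Q d i) (wreathIncl Q d k) x) := by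
  induction x using TensorProduct.induction_on with
  | zero => rw [map_zero]; exact Commute.zero_right _
  | tmul a b =>
    rw [tmap_tmul, Commute, SemiconjBy, Algebra.TensorProduct.tmul_mul_tmul,
      Algebra.TensorProduct.tmul_mul_tmul, one_mul, mul_one, (commute_wreath Q d i l a).eq]
  | add x y hx hy => rw [map_add]; exact hx.add_right hy

theorem commute_right (i k l : Fin d) (x : Q.carrier ⊗[ℂ] Q.carrier) :
    Commute ((1 : WreathAlg Q d) ⊗ₜ[ℂ] wreathPerm Q d k l)
      (tmap (wreathIncl Q d i) (wreathIncl Q d k) x) := by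
  induction x using TensorProduct.induction_on with
  | zero => rw [map_zero]; exact Commute.zero_right _
  | tmul a b =>
    rw [tmap_tmul, Commute, SemiconjBy, Algebra.TensorProduct.tmul_mul_tmul,
      Algebra.TensorProduct.tmul_mul_tmul, one_mul, mul_one, (commute_wreath Q d k l b).eq]
  | add x y hx hy => rw [map_add]; exact hx.add_right hy

theorem perm_one_mul (i k l : Fin d) :
    (wreathPerm Q d i k ⊗ₜ[ℂ] (1 : WreathAlg Q d)) * (wreathPerm Q d i l ⊗ₜ[ℂ] 1) =
      if k = l then wreathPerm Q d i k ⊗ₜ[ℂ] 1 else 0 := by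
  rw [Algebra.TensorProduct.tmul_mul_tmul, one_mul]
  split_ifs with h
  · rw [← h, (isMagic_wreathPerm Q d).idem]
  · rw [(isMagic_wreathPerm Q d).row_orth i k l h, TensorProduct.zero_tmul]

theorem perm_one_sum (i : Fin d) :
    ∑ k, wreathPerm Q d i k ⊗ₜ[ℂ] (1 : WreathAlg Q d) = 1 := by
  rw [← TensorProduct.sum_tmul, (isMagic_wreathPerm Q d).row_sum]
  rfl

/-- The comultiplication of the free wreath product on the `i`-th copy of the algebra of `Q`:
`ν i a ↦ ∑ k, (s i k ⊗ 1) (ν i ⊗ ν k) (Δ a)`. -/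
def wreathComulIncl (i : Fin d) : Q.carrier →⋆ₐ[ℂ] WreathAlg Q d ⊗[ℂ] WreathAlg Q d where
  toFun a := ∑ k, (wreathPerm Q d i k ⊗ₜ[ℂ] 1) *
    tmap (wreathIncl Q d i) (wreathIncl Q d k) (Q.comul a)
  map_one' := by simp only [map_one, mul_one, perm_one_sum]
  map_zero' := by simp only [map_zero, mul_zero, Finset.sum_const_zero]
  map_add' a b := by simp only [map_add, mul_add, Finset.sum_add_distrib]
  map_mul' a b := by
    rw [Finset.sum_mul_sum]
    refine Finset.sum_congr rfl fun k _ => ?_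
    have h : ∀ l, (wreathPerm Q d i k ⊗ₜ[ℂ] 1) *
        tmap (wreathIncl Q d i) (wreathIncl Q d k) (Q.comul a) *
        ((wreathPerm Q d i l ⊗ₜ[ℂ] 1) *
          tmap (wreathIncl Q d i) (wreathIncl Q d l) (Q.comul b)) =
        if k = l then (wreathPerm Q d i k ⊗ₜ[ℂ] 1) *
          tmap (wreathIncl Q d i) (wreathIncl Q d k) (Q.comul a) *
          tmap (wreathIncl Q d i) (wreathIncl Q d l) (Q.comul b) else 0 := by
      intro l
      rw [mul_assoc, ← mul_assoc (tmap _ _ _), ← (commute_left Q d i k l _).eq, ← mul_assoc,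
        ← mul_assoc, perm_one_mul]
      split_ifs <;> simp
    simp only [h, map_mul, mul_assoc, Finset.sum_ite_eq, Finset.mem_univ, if_true]
  commutes' c := by
    simp only [AlgHomClass.commutes, ← Finset.sum_mul, perm_one_sum, one_mul]
  map_star' a := by
    rw [star_sum]
    refine Finset.sum_congr rfl fun k _ => ?_
    rw [star_mul, TensorProduct.star_tmul, star_one, (isMagic_wreathPerm Q d).star_eq, map_star,
      map_star, ← map_star (tmap _ _), (commute_left Q d i k k _).eq]

theorem wreathComulIncl_apply (i : Fin d) (a : Q.carrier) :
    wreathComulIncl Q d i a = ∑ k, (wreathPerm Q d i k ⊗ₜ[ℂ] 1) *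
      tmap (wreathIncl Q d i) (wreathIncl Q d k) (Q.comul a) := rfl

/-- The comultiplication of the free wreath product. -/
def wreathComul : WreathAlg Q d →⋆ₐ[ℂ] WreathAlg Q d ⊗[ℂ] WreathAlg Q d :=
  Univ.lift
    (fun p => match p with
      | Sum.inl (i, a) => wreathComulIncl Q d i a
      | Sum.inr (i, j) => coprod (wreathPerm Q d) i j)
    ⟨wreathComulIncl Q d, fun _ _ => rfl, (isMagic_wreathPerm Q d).coprod, fun i j a => by
      have h1 : coprod (wreathPerm Q d) i j =
          ∑ l, (wreathPerm Q d i l ⊗ₜ[ℂ] 1) * (1 ⊗ₜ[ℂ] wreathPerm Q d l j) := by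
        simp [coprod]
      change Commute (wreathComulIncl Q d i a) (coprod (wreathPerm Q d) i j)
      rw [Commute, SemiconjBy, h1, wreathComulIncl_apply, Finset.sum_mul_sum, Finset.sum_mul_sum]
      have e1 : ∀ k l, (wreathPerm Q d i k ⊗ₜ[ℂ] 1) *
          tmap (wreathIncl Q d i) (wreathIncl Q d k) (Q.comul a) *
          ((wreathPerm Q d i l ⊗ₜ[ℂ] 1) * (1 ⊗ₜ[ℂ] wreathPerm Q d l j)) =
          if k = l then (wreathPerm Q d i k ⊗ₜ[ℂ] 1) *
            tmap (wreathIncl Q d i) (wreathIncl Q d k) (Q.comul a) *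
            (1 ⊗ₜ[ℂ] wreathPerm Q d k j) else 0 := by
        intro k l
        rw [mul_assoc, ← mul_assoc (tmap _ _ _), ← (commute_left Q d i k l _).eq, ← mul_assoc,
          ← mul_assoc, perm_one_mul]
        split_ifs with h
        · rw [h]
        · simp
      have e2 : ∀ l k, (wreathPerm Q d i l ⊗ₜ[ℂ] 1) * (1 ⊗ₜ[ℂ] wreathPerm Q d l j) *
          ((wreathPerm Q d i k ⊗ₜ[ℂ] 1) *
          tmap (wreathIncl Q d i) (wreathIncl Q d k) (Q.comul a)) =
          if l = k then (wreathPerm Q d i l ⊗ₜ[ℂ] 1) *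
            tmap (wreathIncl Q d i) (wreathIncl Q d l) (Q.comul a) *
            (1 ⊗ₜ[ℂ] wreathPerm Q d l j) else 0 := by
        intro l k
        have hcc : ((1 : WreathAlg Q d) ⊗ₜ[ℂ] wreathPerm Q d l j) *
            (wreathPerm Q d i k ⊗ₜ[ℂ] 1) =
            (wreathPerm Q d i k ⊗ₜ[ℂ] 1) * (1 ⊗ₜ[ℂ] wreathPerm Q d l j) := by simp
        rw [mul_assoc, ← mul_assoc (1 ⊗ₜ[ℂ] _), hcc, mul_assoc, ← mul_assoc, perm_one_mul]
        split_ifs with h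
        · rw [← h, (commute_right Q d i l j _).eq, mul_assoc]
        · simp
      simp only [e1, e2, Finset.sum_ite_eq, Finset.mem_univ, if_true]⟩

theorem wreathComul_incl (i : Fin d) (a : Q.carrier) :
    wreathComul Q d (wreathIncl Q d i a) = ∑ k, (wreathPerm Q d i k ⊗ₜ[ℂ] 1) *
      tmap (wreathIncl Q d i) (wreathIncl Q d k) (Q.comul a) := rfl

theorem wreathComul_perm (i j : Fin d) :
    wreathComul Q d (wreathPerm Q d i j) = coprod (wreathPerm Q d) i j := rfl

theorem isFundamental_wreath {J : Type} [Fintype J] [Nonempty J] (U : J → J → Q.carrier)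
    (hU : IsFundamental Q.comul U) :
    IsFundamental (wreathComul Q d)
      (fun p q : Fin d × J => wreathPerm Q d p.1 q.1 * wreathIncl Q d p.1 (U p.2 q.2)) := by
  have hs := isMagic_wreathPerm Q d
  have hν : ∀ i, IsMagic (fun x y => wreathIncl Q d i (U x y)) := fun i => hU.magic.map _
  have hc := fun i j a => (commute_wreath Q d i j a).eq
  have hmul : ∀ i j k a b, wreathPerm Q d i j * wreathIncl Q d i a *
      (wreathPerm Q d i k * wreathIncl Q d i b) =
      wreathPerm Q d i j * wreathPerm Q d i k * (wreathIncl Q d i a * wreathIncl Q d i b) := by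
    intro i j k a b
    rw [mul_assoc, ← mul_assoc (wreathIncl Q d i a), hc, mul_assoc, mul_assoc]
  refine ⟨⟨?_, ?_, ?_, ?_, ?_, ?_⟩, ?_, ?_⟩
  · rintro ⟨i, x⟩ ⟨j, y⟩
    simp only [hmul, hs.idem, (hν i).idem]
  · rintro ⟨i, x⟩ ⟨j, y⟩
    simp only [star_mul, hs.star_eq, (hν i).star_eq, hc]
  · rintro ⟨i, x⟩ ⟨j, y⟩ ⟨k, z⟩ hne
    simp only [hmul]
    by_cases h : j = k
    · rw [(hν i).row_orth x y z (fun e => hne (by rw [h, e])), mul_zero]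
    · rw [hs.row_orth i j k h, zero_mul]
  · rintro ⟨i, x⟩ ⟨j, y⟩ ⟨k, z⟩ hne
    simp only
    by_cases h : i = k
    · subst h
      rw [hmul, (hν i).col_orth x y z (fun e => hne (by rw [e])), mul_zero]
    · rw [← hc, mul_assoc, ← mul_assoc (wreathPerm Q d i j), hs.col_orth i j k h, zero_mul,
        mul_zero]
  · rintro ⟨i, x⟩
    simp only [Fintype.sum_prod_type, ← Finset.mul_sum, (hν i).row_sum, mul_one, hs.row_sum]
  · rintro ⟨j, y⟩
    simp only [Fintype.sum_prod_type, ← Finset.mul_sum, (hν _).col_sum, mul_one, hs.col_sum]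
  · rw [eq_top_iff]
    set S := StarAlgebra.adjoin ℂ (Set.range fun p : (Fin d × J) × (Fin d × J) =>
      wreathPerm Q d p.1.1 p.2.1 * wreathIncl Q d p.1.1 (U p.1.2 p.2.2)) with hS
    have hmem : ∀ i j x y, wreathPerm Q d i j * wreathIncl Q d i (U x y) ∈ S := fun i j x y =>
      StarAlgebra.subset_adjoin ℂ _ (Set.mem_range.2 ⟨((i, x), (j, y)), rfl⟩)
    refine fun a _ => Univ.mem_of_subset S (fun p => ?_) a
    rcases p with ⟨i, b⟩ | ⟨i, j⟩
    · change wreathIncl Q d i b ∈ S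
      have hb : b ∈ S.comap (wreathIncl Q d i) := by
        refine (show (⊤ : StarSubalgebra ℂ Q.carrier) ≤ _ from ?_) trivial
        rw [← hU.generates]
        refine StarAlgebra.adjoin_le ?_
        rintro _ ⟨⟨x, y⟩, rfl⟩
        change wreathIncl Q d i (U x y) ∈ S
        have := sum_mem (S := S) (t := Finset.univ) fun j _ => hmem i j x y
        rwa [← Finset.sum_mul, hs.row_sum, one_mul] at this
      exact hb
    · change wreathPerm Q d i j ∈ S
      obtain ⟨x⟩ := ‹Nonempty J›
      have := sum_mem (S := S) (t := Finset.univ) fun y _ => hmem i j x y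
      rwa [← Finset.mul_sum, (hν i).row_sum, mul_one] at this
  · rintro ⟨i, x⟩ ⟨j, y⟩
    simp only [map_mul, wreathComul_incl, wreathComul_perm, hU.comul_eq]
    rw [coprod_apply, coprod_apply (U := fun p q : Fin d × J => _), Finset.sum_mul_sum,
      Fintype.sum_prod_type]
    refine Finset.sum_congr rfl fun k _ => ?_
    rw [Finset.sum_eq_single k]
    · simp only [coprod, map_sum, tmap_tmul, Finset.mul_sum,
        Algebra.TensorProduct.tmul_mul_tmul, one_mul, ← mul_assoc, hs.idem]
    · intro l _ hl
      rw [← mul_assoc, Algebra.TensorProduct.tmul_mul_tmul, hs.row_orth i k l hl.symm,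
        TensorProduct.zero_tmul, zero_mul]
    · simp

/-- The free wreath product of `Q` with the quantum permutation group `S_d^+`; it is trivial for
`d = 0`. -/
def freeWreath : QPG where
  carrier := WreathAlg Q d
  comul := wreathComul Q d
  exists_fundamental := by
    obtain ⟨J, _, _, U, hU⟩ := Q.exists_fundamental
    exact (isFundamental_wreath Q d U hU).exists

end FreeWreath

/-! ### Jordan closures -/

/-- The trivial quantum permutation group, with algebra `ℂ`. -/
def trivialQPG : QPG where
  carrier := ℂ
  comul :=
    { Algebra.ofId ℂ (ℂ ⊗[ℂ] ℂ) with
      map_star' := fun c => algebraMap_star_comm (A := ℂ ⊗[ℂ] ℂ) c }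
  exists_fundamental := IsFundamental.exists (I := Empty) (U := fun i => i.elim)
    { magic := ⟨fun i => i.elim, fun i => i.elim, fun i => i.elim, fun i => i.elim,
        fun i => i.elim, fun i => i.elim⟩
      generates := eq_top_iff.2 fun c _ => algebraMap_mem _ c
      comul_eq := fun i => i.elim }

/-- The closure of a family of quantum permutation groups, up to isomorphism, under free products
and free wreath products with the quantum permutation groups `S_d^+`. -/
inductive JorPlus (F : QPG → Prop) : QPG → Prop
  | base (Q : QPG) : F Q → JorPlus F Q
  | iso (Q R : QPG) : Q.Iso R → JorPlus F Q → JorPlus F R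
  | freeProd (Q R : QPG) : JorPlus F Q → JorPlus F R → JorPlus F (freeProd₂ Q R)
  | freeWreath (Q : QPG) (d : ℕ) : 1 ≤ d → JorPlus F Q → JorPlus F (freeWreath Q d)

/-- The wreath product `Γ ≀ S_d`, that is, `Γ^d ⋊ S_d`, where `S_d` permutes the coordinates. -/
abbrev PermWreath (Γ : Type) [Group Γ] (d : ℕ) : Type :=
  (Fin d → Γ) ⋊[mulAutArrow] Equiv.Perm (Fin d)

/-- The closure of a family of groups, up to isomorphism, under direct products and wreath
products with the symmetric groups `S_d`. -/
inductive Jor (E : ∀ (Γ : Type) [Group Γ], Prop) : ∀ (Γ : Type) [Group Γ], Prop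
  | base (Γ : Type) [Group Γ] : E Γ → Jor E Γ
  | iso (Γ Λ : Type) [Group Γ] [Group Λ] : Γ ≃* Λ → Jor E Γ → Jor E Λ
  | prod (Γ Λ : Type) [Group Γ] [Group Λ] : Jor E Γ → Jor E Λ → Jor E (Γ × Λ)
  | wreath (Γ : Type) [Group Γ] (d : ℕ) : 1 ≤ d → Jor E Γ → Jor E (PermWreath Γ d)

/-! ### Block graphs and the operation `Ψ` -/

section Graph

variable {V : Type}

/-- `G` is 2-connected: it is connected, and no vertex disconnects it (graphs with one or two
vertices are allowed; the graph without vertices counts as undisconnected). -/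
def TwoConnected {W : Type} (G : SimpleGraph W) : Prop :=
  G.Connected ∧ ∀ v, (G.induce {v}ᶜ).Preconnected

/-- `S` is the vertex set of a block, that is, of a maximal 2-connected subgraph (such a subgraph
is induced). -/
def IsBlock (G : SimpleGraph V) (S : Set V) : Prop :=
  Maximal (fun T : Set V => TwoConnected (G.induce T)) S

/-- A block graph: all blocks are complete graphs. -/
def IsBlockGraph (G : SimpleGraph V) : Prop :=
  ∀ S : Set V, IsBlock G S → G.IsClique S

/-- A cut vertex of a finite graph: its removal increases the number of connected components. By
convention the vertex of a graph with one vertex is a cut vertex. -/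
def IsCutVertex (G : SimpleGraph V) (v : V) : Prop :=
  Subsingleton V ∨
    Nat.card G.ConnectedComponent < Nat.card (G.induce {v}ᶜ).ConnectedComponent

/-- A graph with a set of marked vertices (below, all graphs are finite). -/
structure MarkedGraph : Type 1 where
  V : Type
  graph : SimpleGraph V
  marks : Set V

/-- Isomorphism of marked graphs. -/
def MarkedGraph.Iso (M N : MarkedGraph) : Prop :=
  ∃ φ : M.graph ≃g N.graph, ∀ x, φ x ∈ N.marks ↔ x ∈ M.marks

/-- `Ψ(G, {r})` for a vertex `r`: the disjoint union, over the connected components `C` of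
`G ∖ r`, of the subgraphs of `G` induced on `C ∪ {r}`; the copies of `r` are marked. The vertices
are the pairs `(C, v)` with `v ∈ C ∪ {r}`. -/
def psiCut (G : SimpleGraph V) (r : V) : MarkedGraph where
  V := {p : (G.induce {r}ᶜ).ConnectedComponent × V //
    ∀ h : p.2 ≠ r, (G.induce {r}ᶜ).connectedComponentMk ⟨p.2, h⟩ = p.1}
  graph :=
    { Adj := fun p q => p.1.1 = q.1.1 ∧ G.Adj p.1.2 q.1.2
      symm := ⟨fun _ _ h => ⟨h.1.symm, h.2.symm⟩⟩
      loopless := ⟨fun _ h => G.loopless.irrefl _ h.2⟩ }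
  marks := {p | p.1.2 = r}

/-- `Ψ(G, Q)` for a block `Q`: the edges inside `Q` are removed and `Q` is marked. -/
def psiBlock (G : SimpleGraph V) (Q : Set V) : MarkedGraph where
  V := V
  graph :=
    { Adj := fun u v => G.Adj u v ∧ ¬(u ∈ Q ∧ v ∈ Q)
      symm := ⟨fun _ _ h => ⟨h.1.symm, fun h' => h.2 h'.symm⟩⟩
      loopless := ⟨fun _ h => G.loopless.irrefl _ h.1⟩ }
  marks := Q

open Classical in
/-- The operation `Ψ(G, Q)` for a set `Q` that is a cut vertex or a block of `G`. -/
def psi (G : SimpleGraph V) (Q : Set V) : MarkedGraph :=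
  if h : ∃ r, IsCutVertex G r ∧ Q = {r} then psiCut G h.choose else psiBlock G Q

end Graph

/-- A finite graph with one root. -/
structure RootedGraph : Type 1 where
  V : Type
  [fintype : Fintype V]
  graph : SimpleGraph V
  root : V

attribute [instance] RootedGraph.fintype

/-- The marked graph `z.(K_1, V(K_1)) ⊕ ⨁ i, a i.(H i, root)`: the disjoint union of `z` marked
isolated vertices and of `a i` copies of each `H i`, in which the roots are marked. -/
def rootedSum (z : ℕ) {k : ℕ} (a : Fin k → ℕ) (H : Fin k → RootedGraph) : MarkedGraph where
  V := Fin z ⊕ (Σ i : Fin k, Fin (a i) × (H i).V)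
  graph :=
    { Adj := fun p q => ∃ (i : Fin k) (m : Fin (a i)) (x y : (H i).V),
        p = Sum.inr ⟨i, m, x⟩ ∧ q = Sum.inr ⟨i, m, y⟩ ∧ (H i).graph.Adj x y
      symm := ⟨fun _ _ ⟨i, m, x, y, hp, hq, h⟩ => ⟨i, m, y, x, hq, hp, h.symm⟩⟩
      loopless := ⟨fun p ⟨i, m, x, y, hp, hq, h⟩ => by
        have hxy : x = y := by simpa using hp.symm.trans hq
        exact (H i).graph.loopless.irrefl x (hxy ▸ h)⟩ }
  marks := {p | ∀ (i : Fin k) (m : Fin (a i)) (x : (H i).V),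
    p = Sum.inr ⟨i, m, x⟩ → x = (H i).root}

/-- `M = z.(K_1, V(K_1)) ⊕ ⨁ i, a i.(H i, root)` up to isomorphism, where the `H i` are connected
rooted block graphs with at least two vertices, pairwise non-isomorphic as rooted graphs, and
`a i ≥ 1`. In particular `z` is the number of isolated vertices of `M`. -/
structure IsDecomposition (M : MarkedGraph) (z : ℕ) {k : ℕ} (a : Fin k → ℕ)
    (H : Fin k → RootedGraph) : Prop where
  iso : M.Iso (rootedSum z a H)
  pos : ∀ i, 1 ≤ a i
  nontrivial : ∀ i, Nontrivial (H i).V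
  connected : ∀ i, (H i).graph.Connected
  isBlockGraph : ∀ i, IsBlockGraph (H i).graph
  not_iso : ∀ i j, i ≠ j →
    ¬∃ φ : (H i).graph ≃g (H j).graph, φ (H i).root = (H j).root

/-- The automorphism group of a graph. -/
abbrev GraphAut {V : Type} (G : SimpleGraph V) : Type := G ≃g G

/-- The stabiliser of a vertex in the automorphism group. -/
abbrev autFix {V : Type} (G : SimpleGraph V) (r : V) : Subgroup (GraphAut G) :=
  MulAction.stabilizer (GraphAut G) r

end QBlock
end

open QBlock

open scoped TensorProduct

noncomputable section

namespace QBlock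

set_option linter.unusedSectionVars false

/-! ### Morphisms between quantum permutation groups -/

section Morphisms

variable {A B C D : Type} [Ring A] [StarRing A] [Algebra ℂ A] [StarModule ℂ A]
  [Ring B] [StarRing B] [Algebra ℂ B] [StarModule ℂ B]
  [Ring C] [StarRing C] [Algebra ℂ C] [StarModule ℂ C]
  [Ring D] [StarRing D] [Algebra ℂ D] [StarModule ℂ D]

/-! Everything rests on a reformulation of commutation with the adjacency matrix: a magic unitary
`U` commutes with it if and only if `U x y * U x' y' = 0` whenever exactly one of the pairs `x, x'`
and `y, y'` is an edge (`isAdapted_iff`). A coefficient `U x y ≠ 0` thus plays the role of "some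
symmetry relates `x` and `y`". The rows and columns of `U` sum to 1, so a nonzero product can be
refined at any further vertex. This transports walks, and therefore reachability, distances,
eccentricities and centers, from rows to columns.

Consequently `qu G` already stabilises the union of the centers of the components. For a connected
block graph the center is a block or a cut vertex. In the first case the edges inside the center may
be erased, since adjacency in a clique is mere distinctness. In the second case the fixed vertex may
be deleted and its neighbours marked (`quStab_iso_cone`), after which one apex is put back for each
component (`quStab_iso_multiCone`). Both routes end at the quantum stabiliser of the marks of Ψ(G,
Z(G)).

For a sum of rooted graphs two facts remain. A coefficient cannot be nonzero between copies of
non-isomorphic rooted block graphs: in a colouring by orbits of `U`, vertices of equal colour have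
the same numbers of children and of siblings of each colour, because cardinalities are preserved by
magic unitaries (`IsMagic.card_eq`), and these numbers determine a rooted block graph
(`IsLevel.exists_iso`). Among copies of one graph `H i`, the coefficients between roots form a magic
unitary permuting the copies, the sums over the target copies form magic unitaries acting inside
each copy, and every coefficient is a product of two commuting elements of these kinds. This is the
presentation of the free wreath product.

Rooted block graphs are handled through their level functions (`IsLevel`), which pass easily to
cones, cuts and disjoint unions. Membership in `JorPlus` follows by induction on the number of
unmarked vertices: decompose a forest, cut each tree at its root, delete the root and mark the
clique of its neighbours. A possibly disconnected block graph enters this scheme through a level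
function that vanishes exactly on the centers of its components.

Conversely, root stabilisers of trees are closed under free products and free wreath products. A
stem can be attached to a tree without changing its stabiliser, which makes two trees
non-isomorphic. A root stabiliser becomes a full quantum automorphism group when a path of the same
depth is attached on the other side of a new root, since this root is then the only central vertex.

The statements on groups follow from those on quantum groups by taking characters with the
convolution product: over ℂ magic unitaries are permutation matrices, free products become direct
products, and free wreath products become wreath products. -/

theorem Univ.hom_ext {X : Type} {P : Relations X} {f g : Univ P →⋆ₐ[ℂ] B}
    (h : ∀ x, f (Univ.of P x) = g (Univ.of P x)) : f = g :=
  StarAlgHom.ext fun a => Univ.mem_of_subset (StarAlgHom.equalizer f g) h a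

theorem IsFundamental.hom_ext {I : Type} [Fintype I] {Δ : A →⋆ₐ[ℂ] A ⊗[ℂ] A} {U : I → I → A}
    (hU : IsFundamental Δ U) {f g : A →⋆ₐ[ℂ] B} (h : ∀ i j, f (U i j) = g (U i j)) : f = g :=
  StarAlgHom.ext_of_adjoin_eq_top hU.generates (by rintro _ ⟨p, rfl⟩; exact h p.1 p.2)

theorem IsFundamental.reindex {I J : Type} [Fintype I] [Fintype J] {Δ : A →⋆ₐ[ℂ] A ⊗[ℂ] A}
    {U : I → I → A} (hU : IsFundamental Δ U) (e : J ≃ I) :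
    IsFundamental Δ (fun i j => U (e i) (e j)) := by
  refine ⟨⟨fun i j => hU.magic.idem _ _, fun i j => hU.magic.star_eq _ _,
    fun i j k h => hU.magic.row_orth _ _ _ (e.injective.ne h),
    fun i j k h => hU.magic.col_orth _ _ _ (e.injective.ne h), fun i => ?_, fun j => ?_⟩, ?_, ?_⟩
  · rw [e.sum_comp (fun j => U (e i) j)]; exact hU.magic.row_sum _
  · rw [e.sum_comp (fun i => U i (e j))]; exact hU.magic.col_sum _
  · rw [eq_top_iff, ← hU.generates]
    refine StarAlgebra.adjoin_mono ?_
    rintro _ ⟨p, rfl⟩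
    exact ⟨(e.symm p.1, e.symm p.2), by simp⟩
  · intro i j
    rw [hU.comul_eq, coprod_apply, coprod_apply, e.sum_comp (fun k => U (e i) k ⊗ₜ[ℂ] U k (e j))]

theorem tmap_comp (f : B →⋆ₐ[ℂ] C) (g : A →⋆ₐ[ℂ] B) (x : A ⊗[ℂ] A) :
    tmap (f.comp g) (f.comp g) x = tmap f f (tmap g g x) := by
  induction x using TensorProduct.induction_on with
  | zero => simp
  | tmul a b => rfl
  | add x y hx hy => simp only [map_add, hx, hy]

theorem tmap_id (x : A ⊗[ℂ] A) :
    tmap (StarAlgHom.id ℂ A) (StarAlgHom.id ℂ A) x = x := by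
  induction x using TensorProduct.induction_on with
  | zero => simp
  | tmul a b => rfl
  | add x y hx hy => simp only [map_add, hx, hy]

end Morphisms

/-- Mutually inverse `*`-morphisms, one of which intertwines the comultiplications, give an
isomorphism. -/
theorem QPG.iso_of_inverse {Q R : QPG} (f : Q.carrier →⋆ₐ[ℂ] R.carrier)
    (g : R.carrier →⋆ₐ[ℂ] Q.carrier) (hgf : ∀ a, g (f a) = a) (hfg : ∀ b, f (g b) = b)
    (hf : ∀ a, R.comul (f a) = tmap f f (Q.comul a)) : Q.Iso R :=
  ⟨StarAlgEquiv.ofStarAlgHom f g (StarAlgHom.ext hgf) (StarAlgHom.ext hfg), hf⟩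

theorem QPG.Iso.exists_inverse {Q R : QPG} (h : Q.Iso R) :
    ∃ (f : Q.carrier →⋆ₐ[ℂ] R.carrier) (g : R.carrier →⋆ₐ[ℂ] Q.carrier),
      (∀ a, g (f a) = a) ∧ (∀ b, f (g b) = b) ∧
      (∀ a, R.comul (f a) = tmap f f (Q.comul a)) ∧
      ∀ b, Q.comul (g b) = tmap g g (R.comul b) := by
  obtain ⟨e, he⟩ := h
  set f : Q.carrier →⋆ₐ[ℂ] R.carrier := (e : Q.carrier →⋆ₐ[ℂ] R.carrier)
  set g : R.carrier →⋆ₐ[ℂ] Q.carrier := (e.symm : R.carrier →⋆ₐ[ℂ] Q.carrier)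
  have hgf : g.comp f = StarAlgHom.id ℂ _ := StarAlgHom.ext fun a => e.symm_apply_apply a
  refine ⟨f, g, e.symm_apply_apply, e.apply_symm_apply, he, fun b => ?_⟩
  obtain ⟨a, rfl⟩ : ∃ a, f a = b := ⟨g b, e.apply_symm_apply b⟩
  have h1 : R.comul (f a) = tmap f f (Q.comul a) := he a
  rw [h1, ← tmap_comp, hgf, tmap_id]
  exact congrArg Q.comul (e.symm_apply_apply a)

theorem QPG.Iso.refl (Q : QPG) : Q.Iso Q :=
  QPG.iso_of_inverse (StarAlgHom.id ℂ _) (StarAlgHom.id ℂ _) (fun _ => rfl) (fun _ => rfl)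
    fun a => (tmap_id (Q.comul a)).symm

theorem QPG.Iso.symm {Q R : QPG} (h : Q.Iso R) : R.Iso Q := by
  obtain ⟨f, g, hgf, hfg, -, hg⟩ := h.exists_inverse
  exact QPG.iso_of_inverse g f hfg hgf hg

theorem QPG.Iso.trans {Q R S : QPG} (h : Q.Iso R) (h' : R.Iso S) : Q.Iso S := by
  obtain ⟨f, g, hgf, hfg, hf, -⟩ := h.exists_inverse
  obtain ⟨f', g', hgf', hfg', hf', -⟩ := h'.exists_inverse
  refine QPG.iso_of_inverse (f'.comp f) (g.comp g') (fun a => ?_) (fun a => ?_) fun a => ?_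
  · exact (congrArg g (hgf' _)).trans (hgf a)
  · exact (congrArg f' (hfg _)).trans (hfg' a)
  · rw [tmap_comp, ← hf, ← hf']; rfl

/-- Two mutually inverse morphisms, given on fundamental representations. -/
theorem QPG.iso_of_fundamental {Q R : QPG} {I J : Type} [Fintype I] [Fintype J]
    {U : I → I → Q.carrier} {W : J → J → R.carrier} (hU : IsFundamental Q.comul U)
    (hW : IsFundamental R.comul W) (f : Q.carrier →⋆ₐ[ℂ] R.carrier)
    (g : R.carrier →⋆ₐ[ℂ] Q.carrier) (hgf : ∀ i j, g (f (U i j)) = U i j)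
    (hfg : ∀ i j, f (g (W i j)) = W i j)
    (hf : ∀ i j, R.comul (f (U i j)) = coprod (fun i j => f (U i j)) i j) : Q.Iso R := by
  have h1 : g.comp f = StarAlgHom.id ℂ _ := hU.hom_ext hgf
  have h2 : f.comp g = StarAlgHom.id ℂ _ := hW.hom_ext hfg
  have h3 : R.comul.comp f = (tmap f f).comp Q.comul := hU.hom_ext fun i j => by
    rw [StarAlgHom.comp_apply, StarAlgHom.comp_apply, hf, hU.comul_eq, tmap_coprod]
  exact QPG.iso_of_inverse f g (fun a => DFunLike.congr_fun h1 a)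
    (fun a => DFunLike.congr_fun h2 a) fun a => DFunLike.congr_fun h3 a

/-! ### Magic unitaries -/

section Magic

variable {I A : Type} [Fintype I] [Ring A] [StarRing A] {U : I → I → A}

/-- Multiplying `a` by the row sum 1 leaves some nonzero summand. This replaces "let `j` be the
image of `i`" of the classical argument, and the column version replaces preimages. -/
theorem IsMagic.exists_mul_row (h : IsMagic U) {a : A} (ha : a ≠ 0) (i : I) :
    ∃ j, a * U i j ≠ 0 := by
  by_contra! hc
  apply ha
  rw [← mul_one a, ← h.row_sum i, Finset.mul_sum]
  exact Finset.sum_eq_zero fun j _ => hc j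

theorem IsMagic.exists_mul_col (h : IsMagic U) {a : A} (ha : a ≠ 0) (j : I) :
    ∃ i, a * U i j ≠ 0 := by
  by_contra! hc
  apply ha
  rw [← mul_one a, ← h.col_sum j, Finset.mul_sum]
  exact Finset.sum_eq_zero fun i _ => hc i

/-- The row sum 1 is inserted between the factors, which yields one image of `i` compatible with
both `a` and `b`. -/
theorem IsMagic.exists_mul_row_mul (h : IsMagic U) {a b : A} (hab : a * b ≠ 0) (i : I) :
    ∃ j, a * U i j ≠ 0 ∧ U i j * b ≠ 0 := by
  by_contra! hc
  apply hab
  rw [← mul_one a, ← h.row_sum i, Finset.mul_sum, Finset.sum_mul]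
  refine Finset.sum_eq_zero fun j _ => ?_
  by_cases h0 : a * U i j = 0
  · rw [h0, zero_mul]
  · rw [mul_assoc, hc j h0, mul_zero]

theorem IsMagic.mul_ne_zero_comm (h : IsMagic U) {i j k l : I} (hne : U i j * U k l ≠ 0) :
    U k l * U i j ≠ 0 := by
  intro h0
  apply hne
  rw [← h.star_eq i j, ← h.star_eq k l, ← star_mul, h0, star_zero]

theorem IsMagic.transpose (h : IsMagic U) : IsMagic fun i j => U j i where
  idem i j := h.idem j i
  star_eq i j := h.star_eq j i
  row_orth i j k hjk := h.col_orth j i k hjk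
  col_orth i j k hik := h.row_orth j i k hik
  row_sum i := h.col_sum i
  col_sum j := h.row_sum j

/-- A magic unitary commutes with `G.adjMatrix` if and only if it preserves adjacency. -/
theorem isAdapted_iff {G : SimpleGraph I} {R : Set I} :
    IsAdapted G R U ↔ IsMagic U ∧
      (∀ x x' y y', ¬(G.Adj x x' ↔ G.Adj y y') → U x y * U x' y' = 0) ∧
      ∀ x y, ¬(x ∈ R ↔ y ∈ R) → U x y = 0 := by
  classical
  have hstab : (∀ x y, (x ∈ R ∧ y ∉ R) ∨ (x ∉ R ∧ y ∈ R) → U x y = 0) ↔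
      ∀ x y, ¬(x ∈ R ↔ y ∈ R) → U x y = 0 := by
    refine forall₂_congr fun x y => imp_congr_left ?_
    tauto
  have hr : IsMagic U → ∀ i j k, U i j * U i k = if j = k then U i j else 0 := by
    intro h i j k
    split_ifs with hjk
    · rw [← hjk, h.idem]
    · exact h.row_orth i j k hjk
  have hc : IsMagic U → ∀ i j k, U i j * U k j = if i = k then U i j else 0 := by
    intro h i j k
    split_ifs with hjk
    · rw [← hjk, h.idem]
    · exact h.col_orth i j k hjk
  have hcomm : Matrix.of U * G.adjMatrix A = G.adjMatrix A * Matrix.of U ↔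
      ∀ x y, ∑ z, (if G.Adj z y then U x z else 0) = ∑ z, (if G.Adj x z then U z y else 0) := by
    rw [← Matrix.ext_iff]
    simp only [Matrix.mul_apply, SimpleGraph.adjMatrix_apply, Matrix.of_apply, mul_ite, mul_one,
      mul_zero, ite_mul, one_mul, zero_mul]
  have key : IsMagic U → ((∀ x y, ∑ z, (if G.Adj z y then U x z else 0) =
      ∑ z, (if G.Adj x z then U z y else 0)) ↔
      ∀ x x' y y', ¬(G.Adj x x' ↔ G.Adj y y') → U x y * U x' y' = 0) := by
    intro h
    constructor
    · intro hA x x' y y' hne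
      -- Sandwiching the `(x, y')` entry of the relation between these two coefficients leaves one
      -- term on each side: orthogonality in row `x` forces `z = y` on the left, orthogonality in
      -- column `y'` forces `z = x'` on the right.
      have h1 := congrArg (fun t => U x y * t * U x' y') (hA x y')
      have e1 : ∀ z, U x y * (if G.Adj z y' then U x z else 0) * U x' y' =
          if y = z then (if G.Adj y y' then U x y * U x' y' else 0) else 0 := by
        intro z
        split_ifs with ha hb hb hb <;> simp_all
      have e2 : ∀ z, U x y * (if G.Adj x z then U z y' else 0) * U x' y' =
          if z = x' then (if G.Adj x x' then U x y * U x' y' else 0) else 0 := by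
        intro z
        split_ifs with ha hb hb hb <;> simp_all [mul_assoc]
      simp only [Finset.mul_sum, Finset.sum_mul, e1, e2, Finset.sum_ite_eq, Finset.sum_ite_eq',
        Finset.mem_univ, if_true] at h1
      by_cases a : G.Adj x x' <;> by_cases b : G.Adj y y' <;> simp_all
    · intro hU x y
      -- Inserting the sum of column `y` on the left and of row `x` on the right turns both sides
      -- into sums of the same products `U x z * U w y`, restricted by `G.Adj z y` or by `G.Adj x
      -- w`. By hypothesis these restrictions differ only where the product vanishes.
      have h1 : ∀ z, (if G.Adj z y then U x z else 0) =
          ∑ w, if G.Adj z y then U x z * U w y else 0 := by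
        intro z
        split_ifs
        · rw [← Finset.mul_sum, h.col_sum, mul_one]
        · simp
      have h2 : ∀ w, (if G.Adj x w then U w y else 0) =
          ∑ z, if G.Adj x w then U x z * U w y else 0 := by
        intro w
        split_ifs
        · rw [← Finset.sum_mul, h.row_sum, one_mul]
        · simp
      simp only [h1, h2]
      rw [Finset.sum_comm]
      refine Finset.sum_congr rfl fun w _ => Finset.sum_congr rfl fun z _ => ?_
      have := hU x w z y
      by_cases a : G.Adj x w <;> by_cases b : G.Adj z y <;> simp_all
  constructor
  · intro h
    refine ⟨h.magic, (key h.magic).1 (hcomm.1 ?_), hstab.1 h.stab⟩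
    convert h.comm
  · rintro ⟨h1, h2, h3⟩
    refine ⟨h1, ?_, hstab.2 h3⟩
    convert hcomm.2 ((key h1).2 h2)

theorem IsAdapted.adj_iff {G : SimpleGraph I} {R : Set I} (h : IsAdapted G R U) {x x' y y' : I}
    (hne : U x y * U x' y' ≠ 0) : G.Adj x x' ↔ G.Adj y y' := by
  by_contra hc
  exact hne ((isAdapted_iff.1 h).2.1 x x' y y' hc)

theorem IsAdapted.mem_iff {G : SimpleGraph I} {R : Set I} (h : IsAdapted G R U) {x y : I}
    (hne : U x y ≠ 0) : x ∈ R ↔ y ∈ R := by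
  by_contra hc
  exact hne ((isAdapted_iff.1 h).2.2 x y hc)

theorem IsAdapted.transpose {G : SimpleGraph I} {R : Set I} (h : IsAdapted G R U) :
    IsAdapted G R fun x y => U y x := by
  rw [isAdapted_iff] at h ⊢
  exact ⟨h.1.transpose, fun x x' y y' hne => h.2.1 y y' x x' fun hc => hne hc.symm,
    fun x y hne => h.2.2 y x fun hc => hne hc.symm⟩

theorem IsMagic.eq_left (h : IsMagic U) {x y x' y' : I} (hne : U x y * U x' y' ≠ 0) :
    x = x' ↔ y = y' := by
  constructor
  · rintro rfl
    by_contra hc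
    exact hne (h.row_orth _ _ _ hc)
  · rintro rfl
    by_contra hc
    exact hne (h.col_orth _ _ _ hc)

/-- Walks are transported along products of two coefficients. -/
theorem IsAdapted.exists_walk {G : SimpleGraph I} {R : Set I} (h : IsAdapted G R U) {x x' : I}
    (p : G.Walk x x') : ∀ {y y' : I}, U x y * U x' y' ≠ 0 →
      ∃ q : G.Walk y y', q.length = p.length := by
  induction p with
  | nil =>
    intro y y' hne
    obtain rfl := (h.magic.eq_left hne).1 rfl
    exact ⟨.nil, rfl⟩
  | @cons u v w huv p ih =>
    intro y y' hne
    -- The image `z` of `v` is compatible with both ends: `h1` gives the first edge, `h2` feeds the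
    -- induction.
    obtain ⟨z, h1, h2⟩ := h.magic.exists_mul_row_mul hne v
    obtain ⟨q, hq⟩ := ih h2
    exact ⟨.cons ((h.adj_iff h1).1 huv) q, by simp [hq]⟩

theorem IsAdapted.reachable_iff {G : SimpleGraph I} {R : Set I} (h : IsAdapted G R U)
    {x x' y y' : I} (hne : U x y * U x' y' ≠ 0) : G.Reachable x x' ↔ G.Reachable y y' :=
  ⟨fun ⟨p⟩ => (h.exists_walk p hne).elim fun q _ => ⟨q⟩,
    fun ⟨p⟩ => (h.transpose.exists_walk p hne).elim fun q _ => ⟨q⟩⟩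

theorem IsAdapted.dist_eq {G : SimpleGraph I} {R : Set I} (h : IsAdapted G R U)
    {x x' y y' : I} (hne : U x y * U x' y' ≠ 0) : G.dist x x' = G.dist y y' := by
  by_cases hx : G.Reachable x x'
  · obtain ⟨p, hp⟩ := hx.exists_walk_length_eq_dist
    obtain ⟨p', hp'⟩ := ((h.reachable_iff hne).1 hx).exists_walk_length_eq_dist
    obtain ⟨q, hq⟩ := h.exists_walk p hne
    obtain ⟨q', hq'⟩ := h.transpose.exists_walk p' hne
    apply le_antisymm
    · rw [← hp', ← hq']; exact SimpleGraph.dist_le q'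
    · rw [← hp, ← hq]; exact SimpleGraph.dist_le q
  · rw [SimpleGraph.dist_eq_zero_of_not_reachable hx,
      SimpleGraph.dist_eq_zero_of_not_reachable fun hy => hx ((h.reachable_iff hne).2 hy)]

/-- The number of vertices in a given invariant relation to a vertex is invariant. -/
theorem IsMagic.card_eq [Algebra ℂ A] (h : IsMagic U) {S T : I → Prop} [DecidablePred S]
    [DecidablePred T] {x y : I} (hxy : U x y ≠ 0)
    (hST : ∀ x' y', U x y * U x' y' ≠ 0 → (S x' ↔ T y')) :
    (Finset.univ.filter S).card = (Finset.univ.filter T).card := by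
  have h1 : ∀ x', (if S x' then U x y else 0) = ∑ y', if T y' then U x y * U x' y' else 0 := by
    intro x'
    split_ifs with hS
    · conv_lhs => rw [← mul_one (U x y), ← h.row_sum x', Finset.mul_sum]
      refine Finset.sum_congr rfl fun y' _ => ?_
      split_ifs with hT
      · rfl
      · by_contra h0; exact hT ((hST x' y' h0).1 hS)
    · refine (Finset.sum_eq_zero fun y' _ => ?_).symm
      split_ifs with hT
      · by_contra h0; exact hS ((hST x' y' h0).2 hT)
      · rfl
  -- Double counting of the products `U x y * U x' y'` with `T y'`, which by `hST` are the nonzero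
  -- ones with `S x'`. Summing over `y'` first gives `U x y` once for each `x'` in `S`, summing over
  -- `x'` first gives it once for each `y'` in `T`. Over ℂ a nonzero element can be cancelled.
  have h2 : ((Finset.univ.filter S).card : ℂ) • U x y =
      ((Finset.univ.filter T).card : ℂ) • U x y := by
    rw [Nat.cast_smul_eq_nsmul, Nat.cast_smul_eq_nsmul, ← Finset.sum_const, ← Finset.sum_const,
      Finset.sum_filter, Finset.sum_filter, Finset.sum_congr rfl fun x' _ => h1 x',
      Finset.sum_comm]
    refine Finset.sum_congr rfl fun y' _ => ?_
    split_ifs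
    · rw [← Finset.mul_sum, h.col_sum, mul_one]
    · simp
  rw [← sub_eq_zero, ← sub_smul, smul_eq_zero] at h2
  have := sub_eq_zero.1 (h2.resolve_right hxy)
  exact_mod_cast this

end Magic

/-! ### Isomorphisms from quantum stabilisers -/

section QuStab

variable {V : Type} [Fintype V] {G : SimpleGraph V} {R : Set V}

theorem isFundamental_of (G : SimpleGraph V) (R : Set V) :
    IsFundamental (quStab G R).comul (fun x y => Univ.of (stabRel G R) (x, y)) where
  magic := (isAdapted_of G R).magic
  generates := by
    rw [eq_top_iff]
    exact fun a _ => Univ.mem_of_subset _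
      (fun p => StarAlgebra.subset_adjoin ℂ _ (Set.mem_range.2 ⟨p, rfl⟩)) a
  comul_eq := fun _ _ => rfl

/-- The morphism given by an adapted matrix. -/
def adaptedLift {B : Type} [Ring B] [StarRing B] [Algebra ℂ B] [StarModule ℂ B]
    {U : V → V → B} (hU : IsAdapted G R U) : Univ (stabRel G R) →⋆ₐ[ℂ] B :=
  Univ.lift (fun p => U p.1 p.2) hU

/-- The recognition principle used for all the identifications below: the universal property
provides one morphism, and an inverse needs to be checked only on coefficients, since these generate
both algebras. -/
theorem quStab_iso {Q : QPG} {U : V → V → Q.carrier} (hU : IsAdapted G R U)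
    (hF : IsFundamental Q.comul U) (g : Q.carrier →⋆ₐ[ℂ] Univ (stabRel G R))
    (hg : ∀ x y, g (U x y) = Univ.of (stabRel G R) (x, y)) : (quStab G R).Iso Q :=
  QPG.iso_of_fundamental (Q := quStab G R) (isFundamental_of G R) hF (adaptedLift hU) g
    (fun i j => hg i j) (fun i j => congrArg (adaptedLift hU) (hg i j)) fun i j => hF.comul_eq i j

theorem quStab_iso_of_iff {G' : SimpleGraph V} {R' : Set V}
    (h : ∀ (B : Type) [Ring B] [StarRing B] [Algebra ℂ B] [StarModule ℂ B] (U : V → V → B),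
      IsAdapted G R U ↔ IsAdapted G' R' U) : (quStab G R).Iso (quStab G' R') :=
  quStab_iso (Q := quStab G' R') ((h _ _).2 (isAdapted_of G' R')) (isFundamental_of G' R')
    (adaptedLift ((h _ _).1 (isAdapted_of G R))) fun _ _ => rfl

theorem IsAdapted.reindex {W A : Type} [Fintype W] [Ring A] [StarRing A] {G' : SimpleGraph W}
    {R' : Set W} {U : W → W → A} (h : IsAdapted G' R' U) (φ : G ≃g G')
    (hφ : ∀ x, φ x ∈ R' ↔ x ∈ R) : IsAdapted G R fun x y => U (φ x) (φ y) := by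
  rw [isAdapted_iff] at h ⊢
  refine ⟨⟨fun i j => h.1.idem _ _, fun i j => h.1.star_eq _ _,
    fun i j k hh => h.1.row_orth _ _ _ (φ.injective.ne hh),
    fun i j k hh => h.1.col_orth _ _ _ (φ.injective.ne hh), fun i => ?_, fun j => ?_⟩, ?_, ?_⟩
  · rw [← h.1.row_sum (φ i)]; exact φ.toEquiv.sum_comp (fun j => U (φ i) j)
  · rw [← h.1.col_sum (φ j)]; exact φ.toEquiv.sum_comp (fun i => U i (φ j))
  · intro x x' y y' hne
    refine h.2.1 _ _ _ _ ?_
    rwa [φ.map_adj_iff, φ.map_adj_iff]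
  · intro x y hne
    refine h.2.2 _ _ ?_
    rwa [hφ, hφ]

/-- Isomorphic marked graphs have isomorphic quantum stabilisers. -/
theorem quStab_congr {W : Type} [Fintype W] {G' : SimpleGraph W} {R' : Set W} (φ : G ≃g G')
    (hφ : ∀ x, φ x ∈ R' ↔ x ∈ R) : (quStab G R).Iso (quStab G' R') := by
  have hψ : ∀ x, φ.symm x ∈ R ↔ x ∈ R' := fun x => by rw [← hφ, φ.apply_symm_apply]
  refine quStab_iso (Q := quStab G' R') ((isAdapted_of G' R').reindex φ hφ)
    ((isFundamental_of G' R').reindex φ.toEquiv)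
    (adaptedLift ((isAdapted_of G R).reindex φ.symm hψ)) fun x y => ?_
  change Univ.of (stabRel G R) (φ.symm (φ x), φ.symm (φ y)) = _
  rw [φ.symm_apply_apply, φ.symm_apply_apply]

/-- Removing the edges inside a clique that is stabilised. -/
theorem quStab_iso_psiBlock (hR : G.IsClique R) :
    (quStab G R).Iso (@quStab V _ (psiBlock G R).graph R) := by
  refine quStab_iso_of_iff fun B _ _ _ _ U => ?_
  have hadj : ∀ u v, (psiBlock G R).graph.Adj u v ↔ G.Adj u v ∧ ¬(u ∈ R ∧ v ∈ R) :=
    fun u v => Iff.rfl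
  constructor
  · intro h
    refine isAdapted_iff.2 ⟨h.magic, fun x x' y y' hne => ?_, (isAdapted_iff.1 h).2.2⟩
    by_contra h0
    refine hne ?_
    change G.Adj x x' ∧ ¬(x ∈ R ∧ x' ∈ R) ↔ G.Adj y y' ∧ ¬(y ∈ R ∧ y' ∈ R)
    rw [h.adj_iff h0, h.mem_iff (left_ne_zero_of_mul h0), h.mem_iff (right_ne_zero_of_mul h0)]
  · intro h
    refine isAdapted_iff.2 ⟨h.magic, fun x x' y y' hne => ?_, (isAdapted_iff.1 h).2.2⟩
    by_contra h0
    refine hne ?_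
    have h1 : G.Adj x x' ∧ ¬(x ∈ R ∧ x' ∈ R) ↔ G.Adj y y' ∧ ¬(y ∈ R ∧ y' ∈ R) := h.adj_iff h0
    have h2 := h.mem_iff (left_ne_zero_of_mul h0)
    have h3 := h.mem_iff (right_ne_zero_of_mul h0)
    have h4 := h.magic.eq_left h0
    -- Inside the clique `R` adjacency means distinctness, and every magic unitary preserves
    -- distinctness.
    by_cases hx : x ∈ R ∧ x' ∈ R
    · have hy : y ∈ R ∧ y' ∈ R := ⟨h2.1 hx.1, h3.1 hx.2⟩
      constructor
      · intro ha; exact hR hy.1 hy.2 fun e => ha.ne (h4.2 e)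
      · intro ha; exact hR hx.1 hx.2 fun e => ha.ne (h4.1 e)
    · have hy : ¬(y ∈ R ∧ y' ∈ R) := fun hy => hx ⟨h2.2 hy.1, h3.2 hy.2⟩
      tauto

/-- The graph obtained from `G` by adding one vertex, which is joined to the vertices in `R`. -/
def cone {V : Type} (G : SimpleGraph V) (R : Set V) : SimpleGraph (Option V) where
  Adj u v := match u, v with
    | none, none => False
    | none, some y => y ∈ R
    | some x, none => x ∈ R
    | some x, some y => G.Adj x y
  symm := ⟨by rintro (_ | x) (_ | y) <;> simp [G.adj_comm]⟩
  loopless := ⟨by rintro (_ | x) <;> simp⟩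

/-- The stabiliser of the apex of a cone. -/
theorem quStab_iso_cone (G : SimpleGraph V) (R : Set V) :
    (quStab G R).Iso (quFix (cone G R) none) := by
  have h0 := isAdapted_of G R
  have h1 := isAdapted_of (cone G R) {none}
  have hF := (isFundamental_of G R).addOne
  have hz : ∀ x, Univ.of (stabRel (cone G R) {none}) (none, some x) = 0 := fun x =>
    (isAdapted_iff.1 h1).2.2 _ _ (by simp)
  have hz' : ∀ x, Univ.of (stabRel (cone G R) {none}) (some x, none) = 0 := fun x =>
    (isAdapted_iff.1 h1).2.2 _ _ (by simp)
  have hn : Univ.of (stabRel (cone G R) {none}) (none, none) = 1 := by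
    have := h1.magic.row_sum none
    rwa [Fintype.sum_option, Finset.sum_eq_zero fun x _ => hz x, add_zero] at this
  have ha : IsAdapted (cone G R) {none} (addOne fun x y => Univ.of (stabRel G R) (x, y)) := by
    refine isAdapted_iff.2 ⟨hF.magic, ?_, ?_⟩
    · have hm := fun x y => (isAdapted_iff.1 h0).2.2 x y
      rintro (_ | x) (_ | x') (_ | y) (_ | y') hne <;>
        simp only [addOne, cone, mul_zero, zero_mul, one_mul, mul_one, not_true_eq_false] at hne ⊢
      · exact hm _ _ hne
      · exact hm _ _ hne
      · exact (isAdapted_iff.1 h0).2.1 _ _ _ _ hne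
    · rintro (_ | x) (_ | y) hne <;> simp_all [addOne]
  have hb : IsAdapted G R fun x y => Univ.of (stabRel (cone G R) {none}) (some x, some y) := by
    refine isAdapted_iff.2 ⟨⟨fun i j => h1.magic.idem _ _, fun i j => h1.magic.star_eq _ _,
      fun i j k hh => h1.magic.row_orth _ _ _ (by simpa using hh),
      fun i j k hh => h1.magic.col_orth _ _ _ (by simpa using hh), fun i => ?_, fun j => ?_⟩,
      fun x x' y y' hne => ?_, fun x y hne => ?_⟩
    · have := h1.magic.row_sum (some i)
      rwa [Fintype.sum_option, hz', zero_add] at this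
    · have := h1.magic.col_sum (some j)
      rwa [Fintype.sum_option, hz, zero_add] at this
    · exact (isAdapted_iff.1 h1).2.1 (some x) (some x') (some y) (some y') hne
    -- The coefficient at the apex is 1, and adjacency to the apex is membership in `R`;
    -- preservation of edges therefore forces preservation of `R`.
    · rw [← mul_one (Univ.of _ _), ← hn]
      exact (isAdapted_iff.1 h1).2.1 (some x) none (some y) none hne
  refine QPG.Iso.symm (quStab_iso (Q := quStab G R) ha hF (adaptedLift hb) ?_)
  rintro (_ | x) (_ | y)
  · exact (map_one _).trans hn.symm
  · exact (map_zero _).trans (hz y).symm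
  · exact (map_zero _).trans (hz' x).symm
  · rfl

end QuStab

/-! ### Universal properties of free products and free wreath products -/

section Lifts

variable {B : Type} [Ring B] [StarRing B] [Algebra ℂ B] [StarModule ℂ B]

/-- The universal property of the free product. -/
def freeLift {ι : Type} (Q : ι → QPG) (g : ∀ i, (Q i).carrier →⋆ₐ[ℂ] B) :
    Univ (freeRel Q) →⋆ₐ[ℂ] B :=
  Univ.lift (fun p => g p.1 p.2) ⟨g, fun _ _ => rfl⟩

theorem freeLift_incl {ι : Type} (Q : ι → QPG) (g : ∀ i, (Q i).carrier →⋆ₐ[ℂ] B) (i : ι)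
    (a : (Q i).carrier) : freeLift Q g (freeIncl Q i a) = g i a := rfl

theorem freeProd_hom_ext {ι : Type} (Q : ι → QPG) {f g : Univ (freeRel Q) →⋆ₐ[ℂ] B}
    (h : ∀ i a, f (freeIncl Q i a) = g (freeIncl Q i a)) : f = g :=
  Univ.hom_ext fun p => h p.1 p.2

/-- The left factor of a free product of two quantum permutation groups. -/
def inclL (Q R : QPG) : Q.carrier →⋆ₐ[ℂ] (freeProd₂ Q R).carrier :=
  freeIncl (fun b : Bool => cond b Q R) true

/-- The right factor of a free product of two quantum permutation groups. -/
def inclR (Q R : QPG) : R.carrier →⋆ₐ[ℂ] (freeProd₂ Q R).carrier :=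
  freeIncl (fun b : Bool => cond b Q R) false

/-- The universal property of the free product of two quantum permutation groups. -/
def freeLift₂ {Q R : QPG} (f : Q.carrier →⋆ₐ[ℂ] B) (g : R.carrier →⋆ₐ[ℂ] B) :
    (freeProd₂ Q R).carrier →⋆ₐ[ℂ] B :=
  freeLift (fun b : Bool => cond b Q R) fun b => match b with
    | true => f
    | false => g

theorem freeLift₂_inclL {Q R : QPG} (f : Q.carrier →⋆ₐ[ℂ] B) (g : R.carrier →⋆ₐ[ℂ] B)
    (a : Q.carrier) : freeLift₂ f g (inclL Q R a) = f a := rfl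

theorem freeLift₂_inclR {Q R : QPG} (f : Q.carrier →⋆ₐ[ℂ] B) (g : R.carrier →⋆ₐ[ℂ] B)
    (a : R.carrier) : freeLift₂ f g (inclR Q R a) = g a := rfl

theorem freeProd₂_hom_ext {Q R : QPG} {f g : (freeProd₂ Q R).carrier →⋆ₐ[ℂ] B}
    (h : ∀ a, f (inclL Q R a) = g (inclL Q R a)) (h' : ∀ a, f (inclR Q R a) = g (inclR Q R a)) :
    f = g :=
  freeProd_hom_ext (fun b : Bool => cond b Q R) fun b => match b with
    | true => h
    | false => h'

/-- The universal property of the free wreath product. -/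
def wreathLift (Q : QPG) (d : ℕ) (ν : Fin d → Q.carrier →⋆ₐ[ℂ] B) (s : Fin d → Fin d → B)
    (hs : IsMagic s) (hc : ∀ i j a, Commute (ν i a) (s i j)) : WreathAlg Q d →⋆ₐ[ℂ] B :=
  Univ.lift (fun p => match p with
    | Sum.inl (i, a) => ν i a
    | Sum.inr (i, j) => s i j) ⟨ν, fun _ _ => rfl, hs, hc⟩

theorem wreath_hom_ext (Q : QPG) (d : ℕ) {f g : WreathAlg Q d →⋆ₐ[ℂ] B}
    (h : ∀ i a, f (wreathIncl Q d i a) = g (wreathIncl Q d i a))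
    (h' : ∀ i j, f (wreathPerm Q d i j) = g (wreathPerm Q d i j)) : f = g :=
  Univ.hom_ext fun p => match p with
    | Sum.inl (i, a) => h i a
    | Sum.inr (i, j) => h' i j

end Lifts

/-- The block-diagonal matrix of fundamental representations of two factors. -/
def blockSum {Q R : QPG} {I J : Type} (U : I → I → Q.carrier) (W : J → J → R.carrier) :
    I ⊕ J → I ⊕ J → (freeProd₂ Q R).carrier
  | .inl i, .inl j => inclL Q R (U i j)
  | .inr i, .inr j => inclR Q R (W i j)
  | .inl _, .inr _ => 0
  | .inr _, .inl _ => 0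

instance fintypeCond {I J : Type} [hI : Fintype I] [hJ : Fintype J] :
    ∀ b : Bool, Fintype (cond b I J)
  | true => hI
  | false => hJ

/-- Two matrices as a family indexed by `Bool`. -/
def condMatrix {Q R : QPG} {I J : Type} (U : I → I → Q.carrier) (W : J → J → R.carrier) :
    ∀ b : Bool, cond b I J → cond b I J → (cond b Q R).carrier
  | true => U
  | false => W

/-- A sum of two types as a sigma type over `Bool`. -/
def sumEquivCond (I J : Type) : I ⊕ J ≃ Σ b : Bool, cond b I J where
  toFun p := match p with
    | .inl i => ⟨true, i⟩
    | .inr j => ⟨false, j⟩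
  invFun p := match p with
    | ⟨true, i⟩ => .inl i
    | ⟨false, j⟩ => .inr j
  left_inv := by rintro (i | j) <;> rfl
  right_inv := by rintro ⟨_ | _, i⟩ <;> rfl

theorem isFundamental_blockSum {Q R : QPG} {I J : Type} [Fintype I] [Fintype J]
    {U : I → I → Q.carrier} {W : J → J → R.carrier} (hU : IsFundamental Q.comul U)
    (hW : IsFundamental R.comul W) : IsFundamental (freeProd₂ Q R).comul (blockSum U W) := by
  have hX : ∀ b : Bool, IsFundamental (cond b Q R).comul (condMatrix U W b)
    | true => hU
    | false => hW
  have := (isFundamental_blockDiagonal (fun b => cond b Q R) (condMatrix U W) hX).reindex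
    (sumEquivCond I J)
  have h2 : blockSum U W = fun i j => Matrix.blockDiagonal' (fun b => Matrix.of fun x y =>
      freeIncl (fun b => cond b Q R) b (condMatrix U W b x y)) (sumEquivCond I J i)
        (sumEquivCond I J j) := by
    ext (i | i) (j | j)
    · exact (Matrix.blockDiagonal'_apply_eq (fun b : Bool => Matrix.of fun x y =>
        freeIncl (fun b => cond b Q R) b (condMatrix U W b x y)) true i j).symm
    · exact (Matrix.blockDiagonal'_apply_ne (fun b : Bool => Matrix.of fun x y =>
        freeIncl (fun b => cond b Q R) b (condMatrix U W b x y)) (k := true) (k' := false)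
        i j (by simp)).symm
    · exact (Matrix.blockDiagonal'_apply_ne (fun b : Bool => Matrix.of fun x y =>
        freeIncl (fun b => cond b Q R) b (condMatrix U W b x y)) (k := false) (k' := true)
        i j (by simp)).symm
    · exact (Matrix.blockDiagonal'_apply_eq (fun b : Bool => Matrix.of fun x y =>
        freeIncl (fun b => cond b Q R) b (condMatrix U W b x y)) false i j).symm
  rw [h2]
  exact this

/-- The centralizer of a self-adjoint element is a `*`-subalgebra, so it is enough to look at
generators. -/
theorem Univ.commute_of_gen {X B : Type} {P : Relations X} [Ring B] [StarRing B] [Algebra ℂ B]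
    [StarModule ℂ B] (f : Univ P →⋆ₐ[ℂ] B) {b : B} (hb : star b = b)
    (h : ∀ x, Commute (f (Univ.of P x)) b) (a : Univ P) : Commute (f a) b := by
  have := Univ.mem_of_subset ((StarSubalgebra.centralizer ℂ {b}).comap f) (fun x => by
    change f (Univ.of P x) ∈ StarSubalgebra.centralizer ℂ {b}
    rw [StarSubalgebra.mem_centralizer_iff]
    rintro _ rfl
    rw [hb]
    exact ⟨(h x).symm.eq, (h x).symm.eq⟩) a
  have h2 : f a ∈ StarSubalgebra.centralizer ℂ {b} := this
  rw [StarSubalgebra.mem_centralizer_iff] at h2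
  exact (h2 b rfl).1.symm

theorem wreath_mul_same (Q : QPG) (d : ℕ) (m n n' : Fin d) (u u' : Q.carrier) :
    wreathPerm Q d m n * wreathIncl Q d m u * (wreathPerm Q d m n' * wreathIncl Q d m u') =
      wreathPerm Q d m n * wreathPerm Q d m n' * wreathIncl Q d m (u * u') := by
  rw [mul_assoc, ← mul_assoc (wreathIncl Q d m _), (commute_wreath Q d m n' u).eq, mul_assoc,
    mul_assoc, map_mul]

theorem wreath_mul_col (Q : QPG) (d : ℕ) {m m' : Fin d} (hm : m ≠ m') (n : Fin d)
    (u u' : Q.carrier) :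
    wreathPerm Q d m n * wreathIncl Q d m u * (wreathPerm Q d m' n * wreathIncl Q d m' u') =
      0 := by
  rw [← (commute_wreath Q d m n u).eq, mul_assoc, ← mul_assoc (wreathPerm Q d m n),
    (isMagic_wreathPerm Q d).col_orth _ _ _ hm, zero_mul, mul_zero]

/-! ### Sums of rooted graphs -/

section RootedSum

instance fintypeRootedSum (z : ℕ) {k : ℕ} (a : Fin k → ℕ) (H : Fin k → RootedGraph) :
    Fintype (rootedSum z a H).V :=
  inferInstanceAs (Fintype (Fin z ⊕ (Σ i : Fin k, Fin (a i) × (H i).V)))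

variable {z k : ℕ} {a : Fin k → ℕ} {H : Fin k → RootedGraph}

/-- The vertex `x` of the `m`-th copy of `H i` in a rooted sum. -/
abbrev sumVert (z : ℕ) {k : ℕ} (a : Fin k → ℕ) (H : Fin k → RootedGraph) (i : Fin k)
    (m : Fin (a i)) (x : (H i).V) : (rootedSum z a H).V := Sum.inr ⟨i, m, x⟩

theorem rootedSum_adj {i : Fin k} {m : Fin (a i)} {x : (H i).V} {j : Fin k} {n : Fin (a j)}
    {y : (H j).V} : (rootedSum z a H).graph.Adj (sumVert z a H i m x) (sumVert z a H j n y) ↔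
      ∃ h : i = j, h ▸ m = n ∧ (H j).graph.Adj (h ▸ x) y := by
  constructor
  · rintro ⟨i', m', x', y', hp, hq, hadj⟩
    cases hp; cases hq
    exact ⟨rfl, rfl, hadj⟩
  · rintro ⟨rfl, rfl, hadj⟩
    exact ⟨_, _, _, _, rfl, rfl, hadj⟩

theorem rootedSum_adj_same {i : Fin k} {m n : Fin (a i)} {x y : (H i).V} :
    (rootedSum z a H).graph.Adj (sumVert z a H i m x) (sumVert z a H i n y) ↔
      m = n ∧ (H i).graph.Adj x y := by
  rw [rootedSum_adj]
  exact ⟨fun ⟨_, h⟩ => h, fun h => ⟨rfl, h⟩⟩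

theorem rootedSum_not_adj_inl (c : Fin z) (q : (rootedSum z a H).V) :
    ¬(rootedSum z a H).graph.Adj (Sum.inl c) q := by
  rintro ⟨i, m, x, y, hp, -⟩
  cases hp

theorem inl_mem_marks (c : Fin z) : (Sum.inl c : (rootedSum z a H).V) ∈ (rootedSum z a H).marks :=
  fun _ _ _ h => by cases h

theorem sumVert_mem_marks {i : Fin k} {m : Fin (a i)} {x : (H i).V} :
    sumVert z a H i m x ∈ (rootedSum z a H).marks ↔ x = (H i).root := by
  constructor
  · intro h; exact h i m x rfl
  · rintro rfl j n y h
    cases h; rfl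

theorem rootedSum_reachable {i : Fin k} {m : Fin (a i)} {x : (H i).V} {q : (rootedSum z a H).V}
    (h : (rootedSum z a H).graph.Reachable (sumVert z a H i m x) q) :
    ∃ y, q = sumVert z a H i m y := by
  obtain ⟨p⟩ := h
  have : ∀ {u v : (rootedSum z a H).V}, (rootedSum z a H).graph.Walk u v →
      (∃ y, u = sumVert z a H i m y) → ∃ y, v = sumVert z a H i m y := by
    intro u v p
    induction p with
    | nil => exact id
    | cons hadj p ih =>
      rintro ⟨y, rfl⟩
      obtain ⟨j, n, x', y', hp, rfl, -⟩ := hadj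
      cases hp
      exact ih ⟨_, rfl⟩
  exact this p ⟨x, rfl⟩

theorem rootedSum_reachable_of (hH : ∀ i, (H i).graph.Connected) (i : Fin k) (m : Fin (a i))
    (x y : (H i).V) :
    (rootedSum z a H).graph.Reachable (sumVert z a H i m x) (sumVert z a H i m y) :=
  ((hH i).preconnected x y).map
    (⟨fun x => sumVert z a H i m x, fun h => rootedSum_adj_same.2 ⟨rfl, h⟩⟩ :
      (H i).graph →g (rootedSum z a H).graph)

/-! ### Matrices adapted to a rooted sum: the factorisation of the coefficients -/

section Adapted

variable {B : Type} [Ring B] [StarRing B] [Algebra ℂ B] [StarModule ℂ B]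
  {U : (rootedSum z a H).V → (rootedSum z a H).V → B}

/-- An isolated vertex is marked, so it could only be related to the root of a copy. That root has a
neighbour, because the copy is connected with at least two vertices, and a vertex related to this
neighbour would be adjacent to the isolated vertex. -/
theorem adapted_inl_inr (hU : IsAdapted (rootedSum z a H).graph (rootedSum z a H).marks U)
    (hn : ∀ i, Nontrivial (H i).V) (hH : ∀ i, (H i).graph.Connected) (c : Fin z) (i : Fin k)
    (m : Fin (a i)) (x : (H i).V) : U (Sum.inl c) (sumVert z a H i m x) = 0 := by
  by_contra h0
  have hx := sumVert_mem_marks.1 ((hU.mem_iff h0).1 (inl_mem_marks c))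
  subst hx
  have := hn i
  obtain ⟨y, hy⟩ := (hH i).preconnected.exists_adj_of_nontrivial (H i).root
  obtain ⟨p, hp⟩ := hU.magic.exists_mul_col h0 (sumVert z a H i m y)
  exact rootedSum_not_adj_inl c p ((hU.adj_iff hp).2 (rootedSum_adj_same.2 ⟨rfl, hy⟩))

/-- A matrix adapted to a rooted sum that does not mix isolated vertices and copies of different
rooted graphs. -/
structure IsSumAdapted (U : (rootedSum z a H).V → (rootedSum z a H).V → B) : Prop where
  adapted : IsAdapted (rootedSum z a H).graph (rootedSum z a H).marks U
  connected : ∀ i, (H i).graph.Connected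
  inl_inr : ∀ c i m x, U (Sum.inl c) (sumVert z a H i m x) = 0
  inr_inl : ∀ c i m x, U (sumVert z a H i m x) (Sum.inl c) = 0
  inr_inr : ∀ i j, i ≠ j → ∀ m n x y, U (sumVert z a H i m x) (sumVert z a H j n y) = 0

namespace IsSumAdapted

variable (h : IsSumAdapted U)

theorem isAdapted_isolated (h : IsSumAdapted U) :
    IsAdapted (⊥ : SimpleGraph (Fin z)) ∅ (fun c d => U (Sum.inl c) (Sum.inl d)) := by
  have hm := h.adapted.magic
  refine isAdapted_iff.2 ⟨⟨fun i j => hm.idem _ _, fun i j => hm.star_eq _ _,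
    fun i j k hh => hm.row_orth _ _ _ (Sum.inl_injective.ne hh),
    fun i j k hh => hm.col_orth _ _ _ (Sum.inl_injective.ne hh), fun i => ?_, fun j => ?_⟩,
    fun x x' y y' hne => by simp at hne, fun x y hne => by simp at hne⟩
  · rw [← hm.row_sum (Sum.inl i)]
    refine ((Fintype.sum_sum_type _).trans ?_).symm
    rw [Finset.sum_eq_zero (s := Finset.univ (α := Σ i : Fin k, Fin (a i) × (H i).V)), add_zero]
    rintro ⟨j, n, y⟩ -
    exact h.inl_inr i j n y
  · rw [← hm.col_sum (Sum.inl j)]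
    refine ((Fintype.sum_sum_type _).trans ?_).symm
    rw [Finset.sum_eq_zero (s := Finset.univ (α := Σ i : Fin k, Fin (a i) × (H i).V)), add_zero]
    rintro ⟨i, n, y⟩ -
    exact h.inr_inl j i n y

/-- The copies of `H i` are connected components of the rooted sum, and nonzero products preserve
reachability. -/
theorem copy_eq (h : IsSumAdapted U) {i : Fin k} {m m' n n' : Fin (a i)} {x x' y y' : (H i).V}
    (hne : U (sumVert z a H i m x) (sumVert z a H i n y) *
      U (sumVert z a H i m' x') (sumVert z a H i n' y') ≠ 0) : m = m' ↔ n = n' := by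
  have key := h.adapted.reachable_iff hne
  have aux : ∀ {m n : Fin (a i)} {x y : (H i).V},
      (rootedSum z a H).graph.Reachable (sumVert z a H i m x) (sumVert z a H i n y) ↔ m = n := by
    intro m n x y
    constructor
    · intro hr
      obtain ⟨y', hy⟩ := rootedSum_reachable hr
      cases hy; rfl
    · rintro rfl
      exact rootedSum_reachable_of h.connected i m x y
  rwa [aux, aux] at key

theorem row_sum (h : IsSumAdapted U) (i : Fin k) (m : Fin (a i)) (x : (H i).V) :
    ∑ n, ∑ y, U (sumVert z a H i m x) (sumVert z a H i n y) = 1 := by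
  rw [← h.adapted.magic.row_sum (sumVert z a H i m x)]
  refine ((Fintype.sum_sum_type _).trans ?_).symm
  rw [Finset.sum_eq_zero fun c _ => h.inr_inl c i m x, zero_add, Fintype.sum_sigma,
    Finset.sum_eq_single i, Fintype.sum_prod_type]
  · intro j _ hj
    exact Finset.sum_eq_zero fun q _ => h.inr_inr i j hj.symm m q.1 x q.2
  · simp

theorem col_sum (h : IsSumAdapted U) (i : Fin k) (n : Fin (a i)) (y : (H i).V) :
    ∑ m, ∑ x, U (sumVert z a H i m x) (sumVert z a H i n y) = 1 := by
  rw [← h.adapted.magic.col_sum (sumVert z a H i n y)]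
  refine ((Fintype.sum_sum_type _).trans ?_).symm
  rw [Finset.sum_eq_zero fun c _ => h.inl_inr c i n y, zero_add, Fintype.sum_sigma,
    Finset.sum_eq_single i, Fintype.sum_prod_type]
  · intro j _ hj
    exact Finset.sum_eq_zero fun q _ => h.inr_inr j i hj q.1 n q.2 y
  · simp

theorem root_right (h : IsSumAdapted U) {i : Fin k} {m n : Fin (a i)} {y : (H i).V}
    (hy : y ≠ (H i).root) : U (sumVert z a H i m (H i).root) (sumVert z a H i n y) = 0 := by
  by_contra h0
  exact hy (sumVert_mem_marks.1 ((h.adapted.mem_iff h0).1 (sumVert_mem_marks.2 rfl)))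

theorem root_left (h : IsSumAdapted U) {i : Fin k} {m n : Fin (a i)} {y : (H i).V}
    (hy : y ≠ (H i).root) : U (sumVert z a H i m y) (sumVert z a H i n (H i).root) = 0 := by
  by_contra h0
  exact hy (sumVert_mem_marks.1 ((h.adapted.mem_iff h0).2 (sumVert_mem_marks.2 rfl)))

/-- The magic unitary that permutes the copies of `H i`. -/
def copies (U : (rootedSum z a H).V → (rootedSum z a H).V → B) (i : Fin k)
    (m n : Fin (a i)) : B := U (sumVert z a H i m (H i).root) (sumVert z a H i n (H i).root)

/-- The magic unitary that acts inside the `m`-th copy of `H i`. -/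
def inner (U : (rootedSum z a H).V → (rootedSum z a H).V → B) (i : Fin k) (m : Fin (a i))
    (x y : (H i).V) : B := ∑ n, U (sumVert z a H i m x) (sumVert z a H i n y)

theorem row_sum_root (h : IsSumAdapted U) (i : Fin k) (m : Fin (a i)) :
    ∑ n, copies U i m n = 1 := by
  rw [← h.row_sum i m (H i).root]
  refine Finset.sum_congr rfl fun n _ => ?_
  rw [Finset.sum_eq_single (H i).root (fun y _ hy => h.root_right hy) (by simp)]
  rfl

/-- A product in which copy `m` goes to two different copies vanishes by `copy_eq`. Since the
elements `copies U i m n` sum to 1 over `n`, multiplication by one of them selects the coefficients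
that lead from copy `m` to copy `n`. -/
theorem copies_mul (h : IsSumAdapted U) (i : Fin k) (m n n' : Fin (a i)) (x y : (H i).V) :
    copies U i m n * U (sumVert z a H i m x) (sumVert z a H i n' y) =
      if n = n' then U (sumVert z a H i m x) (sumVert z a H i n y) else 0 := by
  have h1 : ∀ n', n ≠ n' →
      copies U i m n * U (sumVert z a H i m x) (sumVert z a H i n' y) = 0 := by
    intro n' hn
    by_contra h0
    exact hn ((h.copy_eq h0).1 rfl)
  split_ifs with hn
  · subst hn
    conv_rhs => rw [← one_mul (U _ _), ← h.row_sum_root i m, Finset.sum_mul]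
    rw [Finset.sum_eq_single n]
    · intro n' _ hn
      by_contra h0
      exact hn ((h.copy_eq h0).1 rfl)
    · simp
  · exact h1 n' hn

theorem mul_copies (h : IsSumAdapted U) (i : Fin k) (m n n' : Fin (a i)) (x y : (H i).V) :
    U (sumVert z a H i m x) (sumVert z a H i n' y) * copies U i m n =
      if n = n' then U (sumVert z a H i m x) (sumVert z a H i n y) else 0 := by
  have hs := h.adapted.magic.star_eq
  have := congrArg star (h.copies_mul i m n n' x y)
  rw [star_mul, hs, copies, hs, apply_ite star, hs, star_zero] at this
  exact this

/-- This is the shape `s m n * ν m (u x y)` of the fundamental representation of a free wreath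
product. Together with `inner_mul_copies` it yields the commutation relation of that product. -/
theorem copies_mul_inner (h : IsSumAdapted U) (i : Fin k) (m n : Fin (a i)) (x y : (H i).V) :
    copies U i m n * inner U i m x y = U (sumVert z a H i m x) (sumVert z a H i n y) := by
  simp [inner, Finset.mul_sum, h.copies_mul]

theorem inner_mul_copies (h : IsSumAdapted U) (i : Fin k) (m n : Fin (a i)) (x y : (H i).V) :
    inner U i m x y * copies U i m n = U (sumVert z a H i m x) (sumVert z a H i n y) := by
  simp [inner, Finset.sum_mul, h.mul_copies]

theorem isMagic_copies (h : IsSumAdapted U) (i : Fin k) : IsMagic (copies U i) := by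
  have hm := h.adapted.magic
  refine ⟨fun m n => hm.idem _ _, fun m n => hm.star_eq _ _, fun m n n' hh => ?_,
    fun m n m' hh => ?_, h.row_sum_root i, fun n => ?_⟩
  · by_contra h0; exact hh ((h.copy_eq h0).1 rfl)
  · by_contra h0; exact hh ((h.copy_eq h0).2 rfl)
  · rw [← h.col_sum i n (H i).root]
    refine Finset.sum_congr rfl fun m _ => ?_
    rw [Finset.sum_eq_single (H i).root (fun y _ hy => h.root_left hy) (by simp)]
    rfl

theorem inner_mul_inner (h : IsSumAdapted U) (i : Fin k) (m : Fin (a i)) (x y x' y' : (H i).V) :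
    inner U i m x y * inner U i m x' y' =
      ∑ n, U (sumVert z a H i m x) (sumVert z a H i n y) *
        U (sumVert z a H i m x') (sumVert z a H i n y') := by
  simp only [inner, Finset.sum_mul_sum]
  refine Finset.sum_congr rfl fun n _ => ?_
  refine Finset.sum_eq_single n (fun n' _ hn => ?_) (by simp)
  by_contra h0
  exact hn ((h.copy_eq h0).1 rfl).symm

theorem isAdapted_inner (h : IsSumAdapted U) (i : Fin k) (m : Fin (a i)) :
    IsAdapted (H i).graph {(H i).root} (inner U i m) := by
  have hm := h.adapted.magic
  refine isAdapted_iff.2 ⟨⟨fun x y => ?_, fun x y => ?_, fun x y y' hh => ?_,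
    fun x y x' hh => ?_, fun x => ?_, fun y => ?_⟩, fun x x' y y' hne => ?_, fun x y hne => ?_⟩
  · rw [h.inner_mul_inner]
    exact Finset.sum_congr rfl fun n _ => hm.idem _ _
  · rw [inner, star_sum]
    exact Finset.sum_congr rfl fun n _ => hm.star_eq _ _
  · rw [h.inner_mul_inner]
    exact Finset.sum_eq_zero fun n _ => hm.row_orth _ _ _ fun e => hh (by cases e; rfl)
  · rw [h.inner_mul_inner]
    exact Finset.sum_eq_zero fun n _ => hm.col_orth _ _ _ fun e => hh (by cases e; rfl)
  · simp only [inner]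
    rw [Finset.sum_comm, h.row_sum]
  · rw [← (h.isMagic_copies i).row_sum m]
    simp only [inner]
    rw [Finset.sum_comm]
    refine Finset.sum_congr rfl fun n _ => ?_
    -- Multiply `copies U i m n` by the full sum of the column `(n, y)`: only the rows in copy `m`
    -- survive, because two copies cannot both go to copy `n`.
    conv_rhs => rw [← mul_one (copies U i m n), ← h.col_sum i n y, Finset.mul_sum]
    rw [Finset.sum_eq_single m, Finset.mul_sum]
    · refine Finset.sum_congr rfl fun x _ => ?_
      rw [h.copies_mul, if_pos rfl]
    · intro m' _ hm'
      rw [Finset.mul_sum]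
      refine Finset.sum_eq_zero fun x _ => ?_
      by_contra h0
      exact hm' ((h.copy_eq h0).2 rfl).symm
    · simp
  · rw [h.inner_mul_inner]
    refine Finset.sum_eq_zero fun n _ => ?_
    by_contra h0
    have := h.adapted.adj_iff h0
    rw [rootedSum_adj_same, rootedSum_adj_same] at this
    simp at this
    exact hne this
  · refine Finset.sum_eq_zero fun n _ => ?_
    by_contra h0
    have := h.adapted.mem_iff h0
    rw [sumVert_mem_marks, sumVert_mem_marks] at this
    exact hne this

/-- The `*`-morphism given by the copies of `H i`. -/
def wreathHom (h : IsSumAdapted U) (i : Fin k) :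
    WreathAlg (quFix (H i).graph (H i).root) (a i) →⋆ₐ[ℂ] B :=
  wreathLift (quFix (H i).graph (H i).root) (a i) (fun m => adaptedLift (h.isAdapted_inner i m))
    (copies U i) (h.isMagic_copies i) fun m n b =>
      Univ.commute_of_gen _ ((h.isMagic_copies i).star_eq m n) (fun p => by
        change inner U i m p.1 p.2 * copies U i m n = copies U i m n * inner U i m p.1 p.2
        rw [h.copies_mul_inner, h.inner_mul_copies]) b

/-- The `*`-morphism from the free product of the quantum groups acting on the copies. -/
def sumHom (h : IsSumAdapted U) : (freeProd₂ (SPlus z)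
    (freeProd fun i => freeWreath (quFix (H i).graph (H i).root) (a i))).carrier →⋆ₐ[ℂ] B :=
  freeLift₂ (Q := SPlus z)
    (R := freeProd fun i => freeWreath (quFix (H i).graph (H i).root) (a i))
    (adaptedLift h.isAdapted_isolated)
    (freeLift (fun i => freeWreath (quFix (H i).graph (H i).root) (a i)) h.wreathHom)

end IsSumAdapted

end Adapted

/-! ### The fundamental representation of the free product of free wreath products -/

variable (z a H)

/-- The coefficients of the fundamental representation of the `i`-th free wreath product. -/
def wreathMatrix (i : Fin k) (p q : Fin (a i) × (H i).V) :
    WreathAlg (quFix (H i).graph (H i).root) (a i) :=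
  wreathPerm (quFix (H i).graph (H i).root) (a i) p.1 q.1 *
    wreathIncl (quFix (H i).graph (H i).root) (a i) p.1
      (Univ.of (stabRel (H i).graph {(H i).root}) (p.2, q.2))

/-- The fundamental representation of the free product of free wreath products. -/
def freeWreathMatrix (p q : Σ i : Fin k, Fin (a i) × (H i).V) :
    (freeProd fun i => freeWreath (quFix (H i).graph (H i).root) (a i)).carrier :=
  Matrix.blockDiagonal' (fun i => Matrix.of fun x y =>
    freeIncl (fun i => freeWreath (quFix (H i).graph (H i).root) (a i)) i
      (wreathMatrix a H i x y)) p q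

/-- The fundamental representation of the quantum group of a rooted sum. -/
def sumMatrix (p q : (rootedSum z a H).V) : (freeProd₂ (SPlus z)
    (freeProd fun i => freeWreath (quFix (H i).graph (H i).root) (a i))).carrier :=
  blockSum (Q := SPlus z)
    (R := freeProd fun i => freeWreath (quFix (H i).graph (H i).root) (a i))
    (fun c d => Univ.of (stabRel (⊥ : SimpleGraph (Fin z)) ∅) (c, d)) (freeWreathMatrix a H) p q

theorem isFundamental_sumMatrix : IsFundamental (freeProd₂ (SPlus z)
    (freeProd fun i => freeWreath (quFix (H i).graph (H i).root) (a i))).comul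
      (sumMatrix z a H) := by
  have h1 : ∀ i, IsFundamental (freeWreath (quFix (H i).graph (H i).root) (a i)).comul
      (wreathMatrix a H i) := fun i => by
    have : Nonempty (H i).V := ⟨(H i).root⟩
    exact isFundamental_wreath (quFix (H i).graph (H i).root) (a i) _ (isFundamental_of _ _)
  exact isFundamental_blockSum (Q := SPlus z)
    (R := freeProd fun i => freeWreath (quFix (H i).graph (H i).root) (a i))
    (isFundamental_of _ _) (isFundamental_blockDiagonal _ _ h1)

/-- The inclusion of a free wreath product in the quantum group of a rooted sum. -/
def sumIncl (i : Fin k) : WreathAlg (quFix (H i).graph (H i).root) (a i) →⋆ₐ[ℂ]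
    (freeProd₂ (SPlus z)
      (freeProd fun i => freeWreath (quFix (H i).graph (H i).root) (a i))).carrier :=
  (inclR (SPlus z) (freeProd fun i => freeWreath (quFix (H i).graph (H i).root) (a i))).comp
    (freeIncl (fun i => freeWreath (quFix (H i).graph (H i).root) (a i)) i)

theorem sumMatrix_same (i : Fin k) (m n : Fin (a i)) (x y : (H i).V) :
    sumMatrix z a H (sumVert z a H i m x) (sumVert z a H i n y) =
      sumIncl z a H i (wreathMatrix a H i (m, x) (n, y)) :=
  congrArg (inclR (SPlus z) (freeProd fun i => freeWreath (quFix (H i).graph (H i).root) (a i)))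
    (Matrix.blockDiagonal'_apply_eq (fun i => Matrix.of fun x y =>
      freeIncl (fun i => freeWreath (quFix (H i).graph (H i).root) (a i)) i
        (wreathMatrix a H i x y)) i (m, x) (n, y))

theorem sumMatrix_ne {i j : Fin k} (hij : i ≠ j) (m : Fin (a i)) (n : Fin (a j)) (x : (H i).V)
    (y : (H j).V) : sumMatrix z a H (sumVert z a H i m x) (sumVert z a H j n y) = 0 :=
  (congrArg (inclR (SPlus z) (freeProd fun i => freeWreath (quFix (H i).graph (H i).root) (a i)))
    (Matrix.blockDiagonal'_apply_ne (fun i => Matrix.of fun x y =>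
      freeIncl (fun i => freeWreath (quFix (H i).graph (H i).root) (a i)) i
        (wreathMatrix a H i x y)) (k := i) (k' := j) (m, x) (n, y) hij)).trans (map_zero _)

/-- If `m = m'`, the permuting factors can be collected in front of the inner ones, so both parts of
the product must be nonzero. If `n = n'` but `m ≠ m'`, column orthogonality of the permuting factors
annihilates the product. -/
theorem wreathMatrix_mul (i : Fin k) (m n m' n' : Fin (a i)) (x y x' y' : (H i).V)
    (hne : wreathMatrix a H i (m, x) (n, y) * wreathMatrix a H i (m', x') (n', y') ≠ 0) :
    (m = m' ↔ n = n') ∧ (m = m' → ((H i).graph.Adj x x' ↔ (H i).graph.Adj y y')) := by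
  set Q := quFix (H i).graph (H i).root
  have hs := isMagic_wreathPerm Q (a i)
  have h0 := isAdapted_of (H i).graph {(H i).root}
  have key : m = m' → wreathMatrix a H i (m, x) (n, y) * wreathMatrix a H i (m', x') (n', y') =
      wreathPerm Q (a i) m n * wreathPerm Q (a i) m n' * wreathIncl Q (a i) m
        (Univ.of (stabRel (H i).graph {(H i).root}) (x, y) *
        Univ.of (stabRel (H i).graph {(H i).root}) (x', y')) := by
    rintro rfl
    exact wreath_mul_same Q (a i) m n n' _ _
  have hmn : m = m' ↔ n = n' := by
    constructor
    · intro e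
      by_contra hn
      rw [key e, hs.row_orth _ _ _ hn, zero_mul] at hne
      exact hne rfl
    · rintro rfl
      by_contra hm
      exact hne (wreath_mul_col Q (a i) hm n _ _)
  refine ⟨hmn, fun e => ?_⟩
  rw [key e] at hne
  refine h0.adj_iff (x := x) (x' := x') (y := y) (y' := y') fun h => right_ne_zero_of_mul hne ?_
  exact (congrArg (wreathIncl Q (a i) m) h).trans (map_zero _)

theorem isAdapted_sumMatrix :
    IsAdapted (rootedSum z a H).graph (rootedSum z a H).marks (sumMatrix z a H) := by
  refine isAdapted_iff.2 ⟨(isFundamental_sumMatrix z a H).magic, ?_, ?_⟩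
  · rintro (c | ⟨i, m, x⟩) (c' | ⟨i', m', x'⟩) (d | ⟨j, n, y⟩) (d' | ⟨j', n', y'⟩) hne <;>
      try exact mul_zero _
    all_goals try exact zero_mul _
    all_goals try exact absurd (iff_of_false (rootedSum_not_adj_inl _ _)
      (rootedSum_not_adj_inl _ _)) hne
    · refine absurd (iff_of_false (fun h => ?_) (fun h => ?_)) hne
      · exact rootedSum_not_adj_inl _ _ h.symm
      · exact rootedSum_not_adj_inl _ _ h.symm
    · by_contra h0
      by_cases hij : i = j
      · by_cases hij' : i' = j'
        · subst hij hij'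
          refine hne ?_
          by_cases hii : i = i'
          · subst hii
            have h1 : wreathMatrix a H i (m, x) (n, y) * wreathMatrix a H i (m', x') (n', y') ≠ 0
                := by
              intro h1
              refine h0 ?_
              have e1 := sumMatrix_same z a H i m n x y
              have e2 := sumMatrix_same z a H i m' n' x' y'
              refine (congrArg₂ (· * ·) e1 e2).trans ?_
              rw [← map_mul, h1, map_zero]
            have h2 := wreathMatrix_mul a H i m n m' n' x y x' y' h1
            refine rootedSum_adj_same.trans (Iff.trans ?_ rootedSum_adj_same.symm)
            rw [← h2.1]
            exact and_congr_right h2.2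
          · refine iff_of_false (fun h => hii ?_) (fun h => hii ?_)
            · exact (rootedSum_adj.1 h).1
            · exact (rootedSum_adj.1 h).1
        · exact right_ne_zero_of_mul h0 (sumMatrix_ne z a H hij' _ _ _ _)
      · exact left_ne_zero_of_mul h0 (sumMatrix_ne z a H hij _ _ _ _)
  · rintro (c | ⟨i, m, x⟩) (d | ⟨j, n, y⟩) hne
    · exact absurd (iff_of_true (inl_mem_marks _) (inl_mem_marks _)) hne
    · rfl
    · rfl
    · by_cases hij : i = j
      · subst hij
        refine (sumMatrix_same z a H i m n x y).trans ?_
        have h0 : Univ.of (stabRel (H i).graph {(H i).root}) (x, y) = 0 :=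
          (isAdapted_iff.1 (isAdapted_of (H i).graph {(H i).root})).2.2 x y fun h => hne
            (sumVert_mem_marks.trans (h.trans sumVert_mem_marks.symm))
        have h1 : wreathMatrix a H i (m, x) (n, y) = 0 := by
          simp only [wreathMatrix]
          refine (congrArg _ ((congrArg _ h0).trans (map_zero _))).trans (mul_zero _)
        rw [h1, map_zero]
      · exact sumMatrix_ne z a H hij _ _ _ _

/-- The quantum stabiliser of the roots of a rooted sum is a free product of free wreath products,
provided that no isolated vertices and copies of different rooted graphs are mixed. -/
theorem quStab_rootedSum_iso (h : IsSumAdapted (fun p q =>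
      Univ.of (stabRel (rootedSum z a H).graph (rootedSum z a H).marks) (p, q))) :
    (quStab (rootedSum z a H).graph (rootedSum z a H).marks).Iso (freeProd₂ (SPlus z)
      (freeProd fun i => freeWreath (quFix (H i).graph (H i).root) (a i))) := by
  refine quStab_iso (isAdapted_sumMatrix z a H) (isFundamental_sumMatrix z a H) h.sumHom ?_
  rintro (c | ⟨i, m, x⟩) (d | ⟨j, n, y⟩)
  · rfl
  · exact (map_zero _).trans (h.inl_inr c j n y).symm
  · exact (map_zero _).trans (h.inr_inl d i m x).symm
  · by_cases hij : i = j
    · subst hij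
      refine (congrArg h.sumHom (sumMatrix_same z a H i m n x y)).trans ?_
      change h.wreathHom i (wreathMatrix a H i (m, x) (n, y)) = _
      refine (map_mul (h.wreathHom i) _ _).trans ?_
      exact h.copies_mul_inner i m n x y
    · refine (congrArg h.sumHom (sumMatrix_ne z a H hij m n x y)).trans ((map_zero _).trans ?_)
      exact (h.inr_inr i j hij m n x y).symm

end RootedSum

/-! ### Matching coloured equivalence relations -/

section Matching

open Finset Classical

theorem exists_equiv_of_card_fiber {X Y T : Type} [Fintype X] [Fintype Y] (f : X → T) (g : Y → T)
    (h : ∀ t, #{x | f x = t} = #{y | g y = t}) : ∃ e : X ≃ Y, ∀ x, g (e x) = f x := by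
  have h' : ∀ t, Fintype.card {x // f x = t} = Fintype.card {y // g y = t} := fun t => by
    rw [Fintype.card_subtype, Fintype.card_subtype, h]
  exact ⟨Equiv.ofFiberEquiv fun t => Fintype.equivOfCardEq (h' t), fun x =>
    Equiv.ofFiberEquiv_map _ x⟩

/-- Two finite sets with equivalence relations and colours are isomorphic if they have the same
number of elements of each colour and if equivalence classes of elements of the same colour have
the same number of elements of each colour. -/
theorem exists_equiv_of_card_classes {X Y C : Type} [Fintype X] [Fintype Y] (s : Setoid X)
    (t : Setoid Y) (c : X → C) (d : Y → C) (hcard : ∀ k, #{x | c x = k} = #{y | d y = k})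
    (hclass : ∀ x y, c x = d y → ∀ k, #{x' | s x x' ∧ c x' = k} = #{y' | t y y' ∧ d y' = k}) :
    ∃ e : X ≃ Y, (∀ x, d (e x) = c x) ∧ ∀ x x', s x x' ↔ t (e x) (e x') := by
  -- The type of a class records how many elements of each colour it contains. The hypothesis says
  -- that the type of the class of an element depends only on its colour.
  let f : Quotient s → C → ℕ := fun β k => #{x | Quotient.mk s x = β ∧ c x = k}
  let g : Quotient t → C → ℕ := fun β k => #{y | Quotient.mk t y = β ∧ d y = k}
  have hf : ∀ x k, f (Quotient.mk s x) k = #{x' | s x x' ∧ c x' = k} := by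
    intro x k
    simp only [f, Quotient.eq]
    congr! 3
    exact ⟨fun h => s.symm h, fun h => s.symm h⟩
  have hg : ∀ y k, g (Quotient.mk t y) k = #{y' | t y y' ∧ d y' = k} := by
    intro y k
    simp only [g, Quotient.eq]
    congr! 3
    exact ⟨fun h => t.symm h, fun h => t.symm h⟩
  have hfg : ∀ x y, c x = d y → f (Quotient.mk s x) = g (Quotient.mk t y) := fun x y h =>
    funext fun k => by rw [hf, hg, hclass x y h]
  have hpos : ∀ k, (∃ x, c x = k) ↔ ∃ y, d y = k := by
    intro k
    have := hcard k
    constructor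
    · rintro ⟨x, hx⟩
      have h1 : 0 < #{x | c x = k} := Finset.card_pos.2 ⟨x, by simpa using hx⟩
      rw [this] at h1
      obtain ⟨y, hy⟩ := Finset.card_pos.1 h1
      exact ⟨y, by simpa using hy⟩
    · rintro ⟨x, hx⟩
      have h1 : 0 < #{y | d y = k} := Finset.card_pos.2 ⟨x, by simpa using hx⟩
      rw [← this] at h1
      obtain ⟨y, hy⟩ := Finset.card_pos.1 h1
      exact ⟨y, by simpa using hy⟩
  have hfc : ∀ x x', c x = c x' → f (Quotient.mk s x) = f (Quotient.mk s x') := by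
    intro x x' h
    obtain ⟨y, hy⟩ := (hpos (c x)).1 ⟨x, rfl⟩
    rw [hfg x y hy.symm, hfg x' y (h.symm.trans hy.symm)]
  have hgd : ∀ y y', d y = d y' → g (Quotient.mk t y) = g (Quotient.mk t y') := by
    intro y y' h
    obtain ⟨x, hx⟩ := (hpos (d y)).2 ⟨y, rfl⟩
    rw [← hfg x y hx, ← hfg x y' (hx.trans h)]
  -- Each class of type `m` contains exactly `m k` elements of colour `k`.
  have hcf : ∀ m k, #{x | c x = k ∧ f (Quotient.mk s x) = m} = #{β | f β = m} * m k := by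
    intro m k
    rw [Finset.card_eq_sum_card_fiberwise (f := Quotient.mk s) (t := {β | f β = m}),
      Finset.sum_const_nat]
    · intro β hβ
      rw [← (Finset.mem_filter.1 hβ).2, Finset.filter_filter]
      refine congrArg _ (Finset.filter_congr fun x _ => ?_)
      constructor
      · rintro ⟨⟨h1, h2⟩, h3⟩; exact ⟨h3, h1⟩
      · rintro ⟨h1, h2⟩; exact ⟨⟨h2, by rw [h1]⟩, h1⟩
    · intro x hx
      simp at hx ⊢
      exact hx.2
  have hdg : ∀ m k, #{y | d y = k ∧ g (Quotient.mk t y) = m} = #{β | g β = m} * m k := by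
    intro m k
    rw [Finset.card_eq_sum_card_fiberwise (f := Quotient.mk t) (t := {β | g β = m}),
      Finset.sum_const_nat]
    · intro β hβ
      rw [← (Finset.mem_filter.1 hβ).2, Finset.filter_filter]
      refine congrArg _ (Finset.filter_congr fun x _ => ?_)
      constructor
      · rintro ⟨⟨h1, h2⟩, h3⟩; exact ⟨h3, h1⟩
      · rintro ⟨h1, h2⟩; exact ⟨⟨h2, by rw [h1]⟩, h1⟩
    · intro x hx
      simp at hx ⊢
      exact hx.2
  have hq : ∀ m, #{β | f β = m} = #{β | g β = m} := by
    intro m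
    -- If all elements of colour `k` lie in classes of type `m`, the two counts of this colour are
    -- the numbers of classes of type `m` multiplied by `m k`. The factor is positive because a
    -- class of type `m` contains an element of colour `k`, so it can be cancelled.
    have main : ∀ k, (∀ x, c x = k → f (Quotient.mk s x) = m) →
        (∀ y, d y = k → g (Quotient.mk t y) = m) → (∃ x, c x = k) →
        #{β | f β = m} = #{β | g β = m} := by
      rintro k h1 h2 ⟨x, hx⟩
      have h3 : 0 < m k := by
        rw [← h1 x hx, hf]
        exact Finset.card_pos.2 ⟨x, Finset.mem_filter.2 ⟨Finset.mem_univ _, s.refl x, hx⟩⟩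
      refine Nat.eq_of_mul_eq_mul_right h3 ?_
      rw [← hcf, ← hdg]
      have e1 : ∀ x, (c x = k ∧ f (Quotient.mk s x) = m) ↔ c x = k := fun x =>
        ⟨fun h => h.1, fun h => ⟨h, h1 x h⟩⟩
      have e2 : ∀ y, (d y = k ∧ g (Quotient.mk t y) = m) ↔ d y = k := fun y =>
        ⟨fun h => h.1, fun h => ⟨h, h2 y h⟩⟩
      simp only [e1, e2, hcard]
    by_cases hx : ∃ x, f (Quotient.mk s x) = m
    · obtain ⟨x, hx⟩ := hx
      exact main (c x) (fun x' h => (hfc x' x h).trans hx)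
        (fun y h => (hfg x y h.symm).symm.trans hx) ⟨x, rfl⟩
    · by_cases hy : ∃ y, g (Quotient.mk t y) = m
      · obtain ⟨y, hy⟩ := hy
        exact main (d y) (fun x' h => (hfg x' y h).trans hy)
          (fun y' h => (hgd y' y h).trans hy) ((hpos _).2 ⟨y, rfl⟩)
      · have e1 : ∀ β, f β ≠ m := fun β =>
          Quotient.inductionOn β fun x h => hx ⟨x, h⟩
        have e2 : ∀ β, g β ≠ m := fun β =>
          Quotient.inductionOn β fun y h => hy ⟨y, h⟩
        simp [e1, e2]
  obtain ⟨q, hq⟩ := exists_equiv_of_card_fiber f g hq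
  -- Matched classes have the same type, so the elements of each colour inside them can be matched
  -- as well.
  obtain ⟨e, he⟩ := exists_equiv_of_card_fiber (fun x => (q (Quotient.mk s x), c x))
    (fun y => (Quotient.mk t y, d y)) (by
      rintro ⟨γ, k⟩
      obtain ⟨β, rfl⟩ := q.surjective γ
      simp only [Prod.mk.injEq, q.injective.eq_iff]
      exact (congrFun (hq β) k).symm)
  simp only [Prod.mk.injEq] at he
  refine ⟨e, fun x => (he x).2, fun x x' => ?_⟩
  have h1 : s x x' ↔ Quotient.mk s x = Quotient.mk s x' := Quotient.eq.symm
  have h2 : t (e x) (e x') ↔ Quotient.mk t (e x) = Quotient.mk t (e x') := Quotient.eq.symm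
  rw [h1, h2, (he x).1, (he x').1, q.injective.eq_iff]

end Matching

/-! ### Level functions -/

/-- A level function on a graph: neighbours of a vertex are one level below (exactly one of them,
the parent, unless the level is zero), on the same level or one level above, and adjacency of
vertices of the same level is transitive and implies that they have the same parent. These are the
distances to the root of a rooted block graph. -/
structure IsLevel {V : Type} (G : SimpleGraph V) (l : V → ℕ) : Prop where
  le_succ : ∀ {u v}, G.Adj u v → l u ≤ l v + 1
  exists_parent : ∀ {v}, l v ≠ 0 → ∃ p, G.Adj v p ∧ l p + 1 = l v
  parent_unique : ∀ {v p p'}, G.Adj v p → G.Adj v p' → l p + 1 = l v → l p' + 1 = l v → p = p'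
  parent_adj : ∀ {u v p}, G.Adj u v → l u = l v → G.Adj u p → l p + 1 = l u → G.Adj v p
  trans : ∀ {u v w}, G.Adj u v → G.Adj v w → l u = l v → l v = l w → u ≠ w → G.Adj u w

namespace IsLevel

variable {V : Type} {G : SimpleGraph V} {l : V → ℕ}

open Classical in
/-- The parent of a vertex of positive level. -/
def parent (G : SimpleGraph V) (l : V → ℕ) (v : V) : V :=
  if h : ∃ p, G.Adj v p ∧ l p + 1 = l v then h.choose else v

theorem adj_parent (h : IsLevel G l) {v : V} (hv : l v ≠ 0) : G.Adj v (parent G l v) := by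
  rw [parent, dif_pos (h.exists_parent hv)]
  exact (h.exists_parent hv).choose_spec.1

theorem level_parent (h : IsLevel G l) {v : V} (hv : l v ≠ 0) : l (parent G l v) + 1 = l v := by
  rw [parent, dif_pos (h.exists_parent hv)]
  exact (h.exists_parent hv).choose_spec.2

theorem parent_eq (h : IsLevel G l) {v p : V} (ha : G.Adj v p) (hp : l p + 1 = l v) :
    parent G l v = p :=
  have hv : l v ≠ 0 := by omega
  h.parent_unique (h.adj_parent hv) ha (h.level_parent hv) hp

theorem parent_eq_parent (h : IsLevel G l) {u v : V} (ha : G.Adj u v) (hl : l u = l v)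
    (hu : l u ≠ 0) : parent G l u = parent G l v :=
  (h.parent_eq (h.parent_adj ha hl (h.adj_parent hu) (h.level_parent hu))
    (by rw [← hl, h.level_parent hu])).symm

/-- `y` is a child of `x`. -/
def IsChild (G : SimpleGraph V) (l : V → ℕ) (x y : V) : Prop := G.Adj y x ∧ l x + 1 = l y

/-- `y` and `z` lie on the same level and are equal or adjacent. -/
def IsSib (G : SimpleGraph V) (l : V → ℕ) (y z : V) : Prop := y = z ∨ (G.Adj y z ∧ l y = l z)

theorem isSib_refl (y : V) : IsSib G l y y := Or.inl rfl

theorem isSib_symm {y z : V} (h : IsSib G l y z) : IsSib G l z y :=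
  h.imp Eq.symm fun h => ⟨h.1.symm, h.2.symm⟩

theorem isSib_trans (h : IsLevel G l) {u v w : V} (h1 : IsSib G l u v) (h2 : IsSib G l v w) :
    IsSib G l u w := by
  rcases h1 with rfl | h1
  · exact h2
  · rcases h2 with rfl | h2
    · exact Or.inr h1
    · by_cases huw : u = w
      · exact Or.inl huw
      · exact Or.inr ⟨h.trans h1.1 h2.1 h1.2 h2.2 huw, h1.2.trans h2.2⟩

theorem isChild_of_isSib (h : IsLevel G l) {x y z : V} (h1 : IsChild G l x y)
    (h2 : IsSib G l y z) : IsChild G l x z := by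
  rcases h2 with rfl | h2
  · exact h1
  · exact ⟨h.parent_adj h2.1 h2.2 h1.1 h1.2, h1.2.trans h2.2⟩

theorem isChild_parent (h : IsLevel G l) {v : V} (hv : l v ≠ 0) :
    IsChild G l (parent G l v) v := ⟨h.adj_parent hv, h.level_parent hv⟩

theorem parent_of_isChild (h : IsLevel G l) {x y : V} (hy : IsChild G l x y) :
    parent G l y = x := h.parent_eq hy.1 hy.2

theorem IsChild.ne_zero {x y : V} (hy : IsChild G l x y) : l y ≠ 0 := by
  have := hy.2; omega

/-- The map between rooted graphs obtained by extending maps between the children of vertices. -/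
def extend {W : Type} (G : SimpleGraph V) (l : V → ℕ) (hG : IsLevel G l) (r' : W)
    (E : V → W → V → W) (v : V) : W :=
  open Classical in
  if _h : l v = 0 then r' else E (parent G l v) (extend G l hG r' E (parent G l v)) v
termination_by l v
decreasing_by have := hG.level_parent _h; omega

/-- The map is built from the root downwards: once `φ x` is known and has the colour of `x`, the
matching of the children of `x` with children of `φ x` extends it. Adjacency in a graph with a level
function is encoded in the relations child and sibling, which the matchings preserve. -/
theorem exists_embedding {W C : Type} {G' : SimpleGraph W} {l' : W → ℕ} (h : IsLevel G l)
    (h' : IsLevel G' l') {r : V} {r' : W} (hr : ∀ v, l v = 0 ↔ v = r)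
    (hr' : ∀ v, l' v = 0 ↔ v = r') (c : V → C) (c' : W → C) (hc : c r = c' r')
    (hE : ∀ x x', c x = c' x' → ∃ e : V → W, ∀ y, IsChild G l x y →
      IsChild G' l' x' (e y) ∧ c' (e y) = c y ∧ ∀ z, IsChild G l x z →
        (e y = e z → y = z) ∧ (IsSib G l y z ↔ IsSib G' l' (e y) (e z))) :
    ∃ φ : V → W, Function.Injective φ ∧ φ r = r' ∧ ∀ u v, G.Adj u v ↔ G'.Adj (φ u) (φ v) := by
  classical
  choose! E hE using hE
  set φ := extend G l h r' E with hφ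
  have h0 : ∀ v, l v = 0 → φ v = r' := fun v hv => by rw [hφ, extend, dif_pos hv]
  have h1 : ∀ v, l v ≠ 0 → φ v = E (parent G l v) (φ (parent G l v)) v := fun v hv => by
    rw [hφ, extend, dif_neg hv]
  -- The three claims are proved together by induction on the level, because `hE` is available at
  -- the parent only when its image has the same colour.
  have hcol : ∀ n v, l v = n → c' (φ v) = c v ∧ l' (φ v) = l v ∧
      (l v ≠ 0 → IsChild G' l' (φ (parent G l v)) (φ v)) := by
    intro n
    induction n with
    | zero =>
      intro v hv
      rw [h0 v hv, (hr v).1 hv, ← hc, (hr r).2 rfl, (hr' r').2 rfl]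
      exact ⟨rfl, rfl, fun h => absurd rfl h⟩
    | succ n ih =>
      intro v hv
      have hv0 : l v ≠ 0 := by omega
      have hp := h.level_parent hv0
      obtain ⟨i1, i2, -⟩ := ih (parent G l v) (by omega)
      obtain ⟨j1, j2, -⟩ := hE _ _ i1.symm v (h.isChild_parent hv0)
      rw [← h1 v hv0] at j1 j2
      exact ⟨j2, by rw [← j1.2, i2, hp], fun _ => j1⟩
  have hlev : ∀ v, l' (φ v) = l v := fun v => (hcol _ v rfl).2.1
  have hch : ∀ v, l v ≠ 0 → IsChild G' l' (φ (parent G l v)) (φ v) := fun v =>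
    (hcol _ v rfl).2.2
  have hpar : ∀ v, l v ≠ 0 → parent G' l' (φ v) = φ (parent G l v) := fun v hv =>
    h'.parent_of_isChild (hch v hv)
  have hinj : ∀ n u v, l u = n → φ u = φ v → u = v := by
    intro n
    induction n with
    | zero =>
      intro u v hu huv
      have hv : l v = 0 := by rw [← hlev, ← huv, hlev, hu]
      rw [(hr u).1 hu, (hr v).1 hv]
    | succ n ih =>
      intro u v hu huv
      have hv : l v = n + 1 := by rw [← hlev, ← huv, hlev, hu]
      have hu0 : l u ≠ 0 := by omega
      have hv0 : l v ≠ 0 := by omega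
      have hp : parent G l u = parent G l v :=
        ih _ _ (by have := h.level_parent hu0; omega) (by rw [← hpar u hu0, ← hpar v hv0, huv])
      have hcv := h.isChild_parent hv0
      rw [h1 u hu0, h1 v hv0, hp] at huv
      rw [← hp] at hcv huv
      exact ((hE _ _ (hcol _ _ rfl).1.symm u (h.isChild_parent hu0)).2.2 v hcv).1 huv
  have hinj' : Function.Injective φ := fun u v huv => hinj _ u v rfl huv
  have hsib : ∀ u v, l u ≠ 0 → parent G l u = parent G l v → l v ≠ 0 →
      (IsSib G l u v ↔ IsSib G' l' (φ u) (φ v)) := by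
    intro u v hu hp hv
    have hcv := h.isChild_parent hv
    rw [h1 u hu, h1 v hv, ← hp]
    rw [← hp] at hcv
    exact ((hE _ _ (hcol _ _ rfl).1.symm u (h.isChild_parent hu)).2.2 v hcv).2
  have hpa : ∀ u v, l u + 1 = l v → (G.Adj u v ↔ G'.Adj (φ u) (φ v)) := by
    intro u v huv
    have hv : l v ≠ 0 := by omega
    constructor
    · intro ha
      rw [← h.parent_eq ha.symm huv]
      exact (hch v hv).1.symm
    · intro ha
      have := h'.parent_eq ha.symm (by rw [hlev, hlev, huv])
      rw [hpar v hv] at this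
      rw [← hinj' this]
      exact (h.adj_parent hv).symm
  refine ⟨φ, hinj', h0 r ((hr r).2 rfl), fun u v => ?_⟩
  -- Levels of adjacent vertices differ by at most one. Consecutive levels are settled by uniqueness
  -- of parents, equal levels by siblings, which share a parent.
  rcases lt_trichotomy (l u) (l v) with hlt | heq | hlt
  · by_cases huv : l u + 1 = l v
    · exact hpa u v huv
    · refine iff_of_false (fun ha => ?_) fun ha => ?_
      · have := h.le_succ ha.symm; omega
      · have := h'.le_succ ha.symm; rw [hlev, hlev] at this; omega
  · by_cases hu : l u = 0
    · rw [(hr u).1 hu, (hr v).1 (heq ▸ hu)]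
      simp
    · have hv : l v ≠ 0 := heq ▸ hu
      constructor
      · intro ha
        have := (hsib u v hu (h.parent_eq_parent ha heq hu) hv).1 (Or.inr ⟨ha, heq⟩)
        exact (this.resolve_left fun e => ha.ne (hinj' e)).1
      · intro ha
        have heq' : l' (φ u) = l' (φ v) := by rw [hlev, hlev, heq]
        have hp := h'.parent_eq_parent ha heq' (by rwa [hlev])
        rw [hpar u hu, hpar v hv] at hp
        have := (hsib u v hu (hinj' hp) hv).2 (Or.inr ⟨ha, heq'⟩)
        exact (this.resolve_left fun e => ha.ne (congrArg φ e)).1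
  · by_cases huv : l v + 1 = l u
    · rw [G.adj_comm, G'.adj_comm]; exact hpa v u huv
    · refine iff_of_false (fun ha => ?_) fun ha => ?_
      · have := h.le_succ ha; omega
      · have := h'.le_succ ha; rw [hlev, hlev] at this; omega

open Finset Classical in
/-- Two rooted graphs with colourings that agree on the numbers of children and of siblings of
each colour are isomorphic. -/
theorem exists_iso {W C : Type} [Fintype V] [Fintype W] {G' : SimpleGraph W} {l' : W → ℕ}
    (h : IsLevel G l) (h' : IsLevel G' l') {r : V} {r' : W} (hr : ∀ v, l v = 0 ↔ v = r)
    (hr' : ∀ v, l' v = 0 ↔ v = r') (c : V → C) (c' : W → C) (hc : c r = c' r')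
    (hchild : ∀ x x', c x = c' x' → ∀ k, #{y | IsChild G l x y ∧ c y = k} =
      #{y | IsChild G' l' x' y ∧ c' y = k})
    (hsib : ∀ x x', c x = c' x' → ∀ k, #{y | IsSib G l x y ∧ c y = k} =
      #{y | IsSib G' l' x' y ∧ c' y = k}) : ∃ φ : G ≃g G', φ r = r' := by
  have hmatch : ∀ x x', c x = c' x' → ∃ e : {y // IsChild G l x y} ≃ {y // IsChild G' l' x' y},
      (∀ y, c' (e y).1 = c y.1) ∧ ∀ y z, IsSib G l y.1 z.1 ↔ IsSib G' l' (e y).1 (e z).1 := by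
    intro x x' hx
    refine exists_equiv_of_card_classes (X := {y // IsChild G l x y})
      (Y := {y // IsChild G' l' x' y})
      ⟨fun y z => IsSib G l y.1 z.1, fun y => isSib_refl _, isSib_symm, h.isSib_trans⟩
      ⟨fun y z => IsSib G' l' y.1 z.1, fun y => isSib_refl _, isSib_symm, h'.isSib_trans⟩
      (fun y => c y.1) (fun y => c' y.1) (fun k => ?_) fun y y' hy k => ?_
    · rw [← card_map (Function.Embedding.subtype _), ← card_map (Function.Embedding.subtype _)]
      convert hchild x x' hx k using 2 <;> (ext y; simp [and_comm])
    · rw [← card_map (Function.Embedding.subtype _), ← card_map (Function.Embedding.subtype _)]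
      -- A sibling of a child of `x` is a child of `x`, so nothing is lost by counting siblings
      -- among the children only.
      convert hsib y.1 y'.1 hy k using 2
      · ext z
        simp only [mem_map, mem_filter, mem_univ, true_and, Function.Embedding.subtype_apply,
          Subtype.exists, exists_and_right, exists_eq_right]
        exact ⟨fun ⟨⟨_, h1⟩, h2⟩ => ⟨h1, h2⟩, fun hz => ⟨⟨h.isChild_of_isSib y.2 hz.1, hz.1⟩, hz.2⟩⟩
      · ext z
        simp only [mem_map, mem_filter, mem_univ, true_and, Function.Embedding.subtype_apply,
          Subtype.exists, exists_and_right, exists_eq_right]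
        exact ⟨fun ⟨⟨_, h1⟩, h2⟩ => ⟨h1, h2⟩, fun hz => ⟨⟨h'.isChild_of_isSib y'.2 hz.1, hz.1⟩, hz.2⟩⟩
  obtain ⟨φ, hφ, hφr, hφa⟩ := h.exists_embedding h' hr hr' c c' hc fun x x' hx => by
    obtain ⟨e, he1, he2⟩ := hmatch x x' hx
    -- The value `r'` off the children of `x` is arbitrary and never used.
    refine ⟨fun y => if hy : IsChild G l x y then (e ⟨y, hy⟩).1 else r', fun y hy => ?_⟩
    simp only [dif_pos hy]
    refine ⟨(e ⟨y, hy⟩).2, he1 _, fun z hz => ?_⟩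
    simp only [dif_pos hz]
    refine ⟨fun hyz => ?_, he2 ⟨y, hy⟩ ⟨z, hz⟩⟩
    simpa using e.injective (Subtype.ext hyz)
  -- The inverse matchings give an injection in the other direction. It is not claimed to be inverse
  -- to `φ`; it serves to compare cardinalities, which makes `φ` bijective.
  obtain ⟨ψ, hψ, -, -⟩ := h'.exists_embedding h hr' hr c' c hc.symm fun x' x hx => by
    obtain ⟨e, he1, he2⟩ := hmatch x x' hx.symm
    refine ⟨fun y => if hy : IsChild G' l' x' y then (e.symm ⟨y, hy⟩).1 else r, fun y hy => ?_⟩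
    simp only [dif_pos hy]
    refine ⟨(e.symm ⟨y, hy⟩).2, by rw [← he1]; simp, fun z hz => ?_⟩
    simp only [dif_pos hz]
    refine ⟨fun hyz => ?_, by rw [he2]; simp⟩
    simpa using e.symm.injective (Subtype.ext hyz)
  have hcard : Fintype.card V = Fintype.card W :=
    le_antisymm (Fintype.card_le_of_injective φ hφ) (Fintype.card_le_of_injective ψ hψ)
  exact ⟨⟨Equiv.ofBijective φ ((Fintype.bijective_iff_injective_and_card φ).2 ⟨hφ, hcard⟩),
    fun {u v} => (hφa u v).symm⟩, hφr⟩

end IsLevel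

/-! ### Rigidity of sums of rooted graphs with level functions -/

section Rigid

open IsLevel

variable {V B : Type} [Fintype V] [Ring B] [StarRing B] [Algebra ℂ B] [StarModule ℂ B]
  {G : SimpleGraph V} {l : V → ℕ} {U : V → V → B}

/-- An image of the parent of `x` is a neighbour of `y` and has level one less than `x` by
induction, so `y` is not above the level of `x`. If `y` had smaller level, the induction hypothesis
for the transpose would give `x` that same level; this is why the statement quantifies over `U`. -/
theorem IsAdapted.level_aux (hl : IsLevel G l) (n : ℕ) :
    ∀ (U : V → V → B), IsAdapted G {v | l v = 0} U → ∀ x y, U x y ≠ 0 → l x = n → l y = n := by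
  induction n using Nat.strong_induction_on with
  | _ n ih =>
    intro U hU x y hxy hx
    obtain _ | n := n
    · exact (hU.mem_iff hxy).1 hx
    · obtain ⟨p, hp, hlp⟩ := hl.exists_parent (v := x) (by omega)
      obtain ⟨q, hq⟩ := hU.magic.exists_mul_row hxy p
      have h1 := ih n (by omega) U hU p q (right_ne_zero_of_mul hq) (by omega)
      have h2 := hl.le_succ ((hU.adj_iff hq).1 hp)
      by_contra hne
      have := ih (l y) (by omega) _ hU.transpose y x hxy rfl
      omega

theorem IsAdapted.level_eq (hl : IsLevel G l) (hU : IsAdapted G {v | l v = 0} U) {x y : V}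
    (hxy : U x y ≠ 0) : l x = l y :=
  (IsAdapted.level_aux hl (l x) U hU x y hxy rfl).symm

theorem IsAdapted.isChild_iff (hl : IsLevel G l) (hU : IsAdapted G {v | l v = 0} U)
    {x y x' y' : V} (h : U x y * U x' y' ≠ 0) : IsChild G l x x' ↔ IsChild G l y y' := by
  rw [IsChild, IsChild, hU.level_eq hl (left_ne_zero_of_mul h),
    hU.level_eq hl (right_ne_zero_of_mul h), G.adj_comm, hU.adj_iff h, G.adj_comm]

theorem IsAdapted.isSib_iff (hl : IsLevel G l) (hU : IsAdapted G {v | l v = 0} U)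
    {x y x' y' : V} (h : U x y * U x' y' ≠ 0) : IsSib G l x x' ↔ IsSib G l y y' := by
  rw [IsSib, IsSib, hU.level_eq hl (left_ne_zero_of_mul h),
    hU.level_eq hl (right_ne_zero_of_mul h), hU.adj_iff h, hU.magic.eq_left h]

/-- The colour of a vertex: its class for the equivalence relation generated by the nonzero
coefficients of `U`. -/
def orbitColour (U : V → V → B) (x : V) : Quot fun x y => U x y ≠ 0 := Quot.mk _ x

open Finset Classical in
-- By `IsMagic.card_eq` the count does not change along a nonzero coefficient, so it descends to the
-- orbits.
theorem card_colour_eq (hU : IsMagic U) {S : V → V → Prop}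
    (hS : ∀ x y x' y', U x y * U x' y' ≠ 0 → (S x x' ↔ S y y')) {x y : V}
    (hxy : orbitColour U x = orbitColour U y) (k : Quot fun x y => U x y ≠ 0) :
    #{z | S x z ∧ orbitColour U z = k} = #{z | S y z ∧ orbitColour U z = k} := by
  refine congrArg (Quot.lift (fun x => #{z | S x z ∧ orbitColour U z = k}) ?_) hxy
  intro x y hne
  refine hU.card_eq hne fun x' y' h => ?_
  rw [hS x y x' y' h, show orbitColour U x' = orbitColour U y' from
    Quot.sound (right_ne_zero_of_mul h)]

end Rigid

/-! ### Non-isomorphic rooted graphs are not mixed -/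

section RigidSum

open IsLevel

variable {z k : ℕ} {a : Fin k → ℕ} {H : Fin k → RootedGraph} {l : ∀ i, (H i).V → ℕ}

/-- The level function of a rooted sum. -/
def sumLevel (z : ℕ) {k : ℕ} (a : Fin k → ℕ) (H : Fin k → RootedGraph) (l : ∀ i, (H i).V → ℕ) :
    (rootedSum z a H).V → ℕ
  | .inl _ => 0
  | .inr p => l p.1 p.2.2

theorem isLevel_sumLevel (hl : ∀ i, IsLevel (H i).graph (l i)) :
    IsLevel (rootedSum z a H).graph (sumLevel z a H l) := by
  refine ⟨?_, ?_, ?_, ?_, ?_⟩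
  · rintro _ _ ⟨i, m, x, y, rfl, rfl, h⟩
    exact (hl i).le_succ h
  · rintro (c | ⟨i, m, x⟩) hv
    · exact absurd rfl hv
    · obtain ⟨p, h1, h2⟩ := (hl i).exists_parent hv
      exact ⟨sumVert z a H i m p, rootedSum_adj_same.2 ⟨rfl, h1⟩, h2⟩
  · rintro _ _ _ ⟨i, m, x, y, rfl, rfl, h⟩ ⟨i', m', x', y', h0, rfl, h'⟩ h1 h2
    cases h0
    exact congrArg (sumVert z a H i m) ((hl i).parent_unique h h' h1 h2)
  · rintro _ _ _ ⟨i, m, x, y, rfl, rfl, h⟩ h1 ⟨i', m', x', y', h0, rfl, h'⟩ h2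
    cases h0
    exact rootedSum_adj_same.2 ⟨rfl, (hl i).parent_adj h h1 h' h2⟩
  · rintro _ _ _ ⟨i, m, x, y, rfl, rfl, h⟩ ⟨i', m', x', y', h0, rfl, h'⟩ h1 h2 h3
    cases h0
    exact rootedSum_adj_same.2 ⟨rfl, (hl i).trans h h' h1 h2 fun e => h3 (by rw [e])⟩

theorem marks_eq_sumLevel (hr : ∀ i v, l i v = 0 ↔ v = (H i).root) :
    (rootedSum z a H).marks = {v | sumLevel z a H l v = 0} := by
  ext (c | ⟨i, m, x⟩)
  · exact iff_of_true (inl_mem_marks c) rfl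
  · exact sumVert_mem_marks.trans (hr i x).symm

variable {B : Type} [Ring B] [StarRing B] [Algebra ℂ B] [StarModule ℂ B]
  {U : (rootedSum z a H).V → (rootedSum z a H).V → B}

/-- The inclusion of a copy of a rooted graph in a rooted sum. -/
def sumEmb (z : ℕ) {k : ℕ} (a : Fin k → ℕ) (H : Fin k → RootedGraph) (i : Fin k)
    (m : Fin (a i)) : (H i).V ↪ (rootedSum z a H).V :=
  ⟨sumVert z a H i m, fun x y h => by cases h; rfl⟩

open Finset Classical in
-- Children of a vertex stay in its copy, so counts in the rooted sum can be read off in `H i`. The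
-- predicate `P` will be a colour.
theorem card_isChild_sum (i : Fin k) (m : Fin (a i)) (x : (H i).V)
    (P : (rootedSum z a H).V → Prop) :
    #{y | IsChild (H i).graph (l i) x y ∧ P (sumVert z a H i m y)} =
      #{q | IsChild (rootedSum z a H).graph (sumLevel z a H l) (sumVert z a H i m x) q ∧ P q} := by
  rw [← card_map (sumEmb z a H i m)]
  congr 1
  ext q
  simp only [mem_map, mem_filter, mem_univ, true_and]
  constructor
  · rintro ⟨y, ⟨h1, h2⟩, rfl⟩
    exact ⟨⟨rootedSum_adj_same.2 ⟨rfl, h1.1⟩, h1.2⟩, h2⟩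
  · rintro ⟨⟨h1, h2⟩, h3⟩
    obtain ⟨y, rfl⟩ := rootedSum_reachable h1.symm.reachable
    exact ⟨y, ⟨⟨(rootedSum_adj_same.1 h1).2, h2⟩, h3⟩, rfl⟩

open Finset Classical in
theorem card_isSib_sum (i : Fin k) (m : Fin (a i)) (x : (H i).V)
    (P : (rootedSum z a H).V → Prop) :
    #{y | IsSib (H i).graph (l i) x y ∧ P (sumVert z a H i m y)} =
      #{q | IsSib (rootedSum z a H).graph (sumLevel z a H l) (sumVert z a H i m x) q ∧ P q} := by
  rw [← card_map (sumEmb z a H i m)]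
  congr 1
  ext q
  simp only [mem_map, mem_filter, mem_univ, true_and]
  constructor
  · rintro ⟨y, ⟨h1, h2⟩, rfl⟩
    refine ⟨h1.imp (fun h => by rw [h]; rfl) fun h => ⟨rootedSum_adj_same.2 ⟨rfl, h.1⟩, h.2⟩, h2⟩
  · rintro ⟨h1, h3⟩
    rcases h1 with rfl | ⟨h1, h2⟩
    · exact ⟨x, ⟨Or.inl rfl, h3⟩, rfl⟩
    · obtain ⟨y, rfl⟩ := rootedSum_reachable h1.reachable
      exact ⟨y, ⟨Or.inr ⟨(rootedSum_adj_same.1 h1).2, h2⟩, h3⟩, rfl⟩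

/-- The orbit colouring of the rooted sum is pulled back to `H i` and `H j` along the two copies in
question. Equal colours have equal numbers of children and siblings of each colour, which is the
input of `IsLevel.exists_iso`. -/
theorem exists_iso_of_adapted (hl : ∀ i, IsLevel (H i).graph (l i))
    (hr : ∀ i v, l i v = 0 ↔ v = (H i).root) (hc : ∀ i, (H i).graph.Connected)
    (hU : IsAdapted (rootedSum z a H).graph (rootedSum z a H).marks U) {i j : Fin k}
    {m : Fin (a i)} {n : Fin (a j)} {x : (H i).V} {y : (H j).V}
    (hne : U (sumVert z a H i m x) (sumVert z a H j n y) ≠ 0) :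
    ∃ φ : (H i).graph ≃g (H j).graph, φ (H i).root = (H j).root := by
  classical
  -- An image of the root of the first copy lies in the component of `y` and is marked, so it is the
  -- root of the second copy. Thus the two roots have the same colour.
  have hroot : U (sumVert z a H i m (H i).root) (sumVert z a H j n (H j).root) ≠ 0 := by
    obtain ⟨q, hq⟩ := hU.magic.exists_mul_row hne (sumVert z a H i m (H i).root)
    have h1 := (hU.reachable_iff hq).1 (rootedSum_reachable_of hc i m x _)
    obtain ⟨y', rfl⟩ := rootedSum_reachable h1
    have h2 := right_ne_zero_of_mul hq
    have h3 := sumVert_mem_marks.1 ((hU.mem_iff h2).1 (sumVert_mem_marks.2 rfl))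
    rwa [h3] at h2
  have hL := isLevel_sumLevel (z := z) (a := a) hl
  rw [marks_eq_sumLevel hr] at hU
  refine (hl i).exists_iso (hl j) (hr i) (hr j) (fun x => orbitColour U (sumVert z a H i m x))
    (fun y => orbitColour U (sumVert z a H j n y)) (Quot.sound hroot) (fun x x' hx t => ?_)
    fun x x' hx t => ?_
  · have := card_colour_eq hU.magic (fun _ _ _ _ => hU.isChild_iff hL) hx t
    rw [← card_isChild_sum, ← card_isChild_sum] at this
    convert this
  · have := card_colour_eq hU.magic (fun _ _ _ _ => hU.isSib_iff hL) hx t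
    rw [← card_isSib_sum, ← card_isSib_sum] at this
    convert this

theorem isSumAdapted_of_adapted (hl : ∀ i, IsLevel (H i).graph (l i))
    (hr : ∀ i v, l i v = 0 ↔ v = (H i).root) (hc : ∀ i, (H i).graph.Connected)
    (hn : ∀ i, Nontrivial (H i).V)
    (hiso : ∀ i j, i ≠ j → ¬∃ φ : (H i).graph ≃g (H j).graph, φ (H i).root = (H j).root)
    (hU : IsAdapted (rootedSum z a H).graph (rootedSum z a H).marks U) : IsSumAdapted U where
  adapted := hU
  connected := hc
  inl_inr := adapted_inl_inr hU hn hc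
  inr_inl := adapted_inl_inr hU.transpose hn hc
  inr_inr i j hij m n x y := by
    by_contra h0
    exact hiso i j hij (exists_iso_of_adapted hl hr hc hU h0)

/-- The quantum stabiliser of the roots of a sum of rooted graphs with level functions. -/
theorem quStab_iso_of_isLevel (hl : ∀ i, IsLevel (H i).graph (l i))
    (hr : ∀ i v, l i v = 0 ↔ v = (H i).root) (hc : ∀ i, (H i).graph.Connected)
    (hn : ∀ i, Nontrivial (H i).V)
    (hiso : ∀ i j, i ≠ j → ¬∃ φ : (H i).graph ≃g (H j).graph, φ (H i).root = (H j).root) :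
    (quStab (rootedSum z a H).graph (rootedSum z a H).marks).Iso (freeProd₂ (SPlus z)
      (freeProd fun i => freeWreath (quFix (H i).graph (H i).root) (a i))) :=
  quStab_rootedSum_iso z a H (isSumAdapted_of_adapted hl hr hc hn hiso (isAdapted_of _ _))

end RigidSum

/-! ### Separate cones over the connected components -/

/-- The graph obtained from `K` by adding one vertex for each connected component, which is joined
to the vertices of the component that are in `R`. -/
def multiCone {N : Type} (K : SimpleGraph N) (R : Set N) :
    SimpleGraph (K.ConnectedComponent ⊕ N) where
  Adj p q := match p, q with
    | .inl _, .inl _ => False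
    | .inl C, .inr x => K.connectedComponentMk x = C ∧ x ∈ R
    | .inr x, .inl C => K.connectedComponentMk x = C ∧ x ∈ R
    | .inr x, .inr y => K.Adj x y
  symm := ⟨by rintro (C | x) (D | y) <;> simp [K.adj_comm]⟩
  loopless := ⟨by rintro (C | x) <;> simp⟩

section MultiCone

variable {N : Type} [Fintype N] {K : SimpleGraph N} {R : Set N}

instance fintypeComponent : Fintype K.ConnectedComponent := Fintype.ofFinite _

/-- The component of `K` to which a vertex belongs, or over which an apex lies, is constant along
edges. -/
theorem multiCone_component {p q : K.ConnectedComponent ⊕ N} (h : (multiCone K R).Reachable p q) :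
    Sum.elim id K.connectedComponentMk p = Sum.elim id K.connectedComponentMk q := by
  obtain ⟨w⟩ := h
  induction w with
  | nil => rfl
  | @cons u v w huv _ ih =>
    rw [← ih]
    rcases u with C | x <;> rcases v with D | y
    · exact huv.elim
    · exact huv.1.symm
    · exact huv.1
    · exact SimpleGraph.ConnectedComponent.sound (SimpleGraph.Adj.reachable huv)

theorem multiCone_reachable (hR : ∀ C : K.ConnectedComponent, ∃ x ∈ R, K.connectedComponentMk x = C)
    (x : N) : (multiCone K R).Reachable (.inl (K.connectedComponentMk x)) (.inr x) := by
  obtain ⟨y, hy, hyx⟩ := hR (K.connectedComponentMk x)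
  have h1 : (multiCone K R).Adj (.inl (K.connectedComponentMk x)) (.inr y) := ⟨hyx, hy⟩
  exact h1.reachable.trans ((SimpleGraph.ConnectedComponent.exact hyx).map
    (⟨Sum.inr, fun h => h⟩ : K →g multiCone K R))

variable {B : Type} [Ring B] [StarRing B] [Algebra ℂ B] [StarModule ℂ B]

/-! ### Restriction of adapted matrices from the separate cones to the base -/

section Restrict

variable {W : K.ConnectedComponent ⊕ N → K.ConnectedComponent ⊕ N → B}

theorem multiCone_inl_inr (hW : IsAdapted (multiCone K R) (Set.range Sum.inl) W)
    (C : K.ConnectedComponent) (x : N) : W (.inl C) (.inr x) = 0 := by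
  by_contra h
  simpa using hW.mem_iff h

theorem multiCone_inr_inl (hW : IsAdapted (multiCone K R) (Set.range Sum.inl) W)
    (C : K.ConnectedComponent) (x : N) : W (.inr x) (.inl C) = 0 := by
  by_contra h
  simpa using hW.mem_iff h

/-- Membership in `R` is adjacency to the apex of one's own component, and apices are related only
to apices. -/
theorem multiCone_mem (hW : IsAdapted (multiCone K R) (Set.range Sum.inl) W) {x y : N}
    (hne : W (.inr x) (.inr y) ≠ 0) (hx : x ∈ R) : y ∈ R := by
  obtain ⟨q, hq⟩ := hW.magic.exists_mul_row hne (.inl (K.connectedComponentMk x))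
  rcases q with D | y'
  · have h1 : (multiCone K R).Adj (.inr x) (.inl (K.connectedComponentMk x)) := ⟨rfl, hx⟩
    exact ((hW.adj_iff hq).1 h1).2
  · exact absurd (multiCone_inl_inr hW _ _) (right_ne_zero_of_mul hq)

theorem isAdapted_of_multiCone (hW : IsAdapted (multiCone K R) (Set.range Sum.inl) W) :
    IsAdapted K R fun x y => W (.inr x) (.inr y) := by
  have hm := hW.magic
  refine isAdapted_iff.2 ⟨⟨fun i j => hm.idem _ _, fun i j => hm.star_eq _ _,
    fun i j k hh => hm.row_orth _ _ _ (Sum.inr_injective.ne hh),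
    fun i j k hh => hm.col_orth _ _ _ (Sum.inr_injective.ne hh), fun i => ?_, fun j => ?_⟩,
    fun x x' y y' hne => ?_, fun x y hne => ?_⟩
  · have := hm.row_sum (.inr i)
    rwa [Fintype.sum_sum_type, Finset.sum_eq_zero fun C _ => multiCone_inr_inl hW C i,
      zero_add] at this
  · have := hm.col_sum (.inr j)
    rwa [Fintype.sum_sum_type, Finset.sum_eq_zero fun C _ => multiCone_inl_inr hW C j,
      zero_add] at this
  · by_contra h0
    exact hne (hW.adj_iff h0)
  · by_contra h0
    exact hne ⟨multiCone_mem hW h0, multiCone_mem hW.transpose h0⟩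

open Classical in
-- The apex over `x` goes to the apex of the component to which `x` goes: its coefficient at `D`
-- fixes `W (.inr x) (.inr y)` if `y` lies in `D` and annihilates it otherwise. Hence the
-- coefficients on the base generate all the others.
theorem multiCone_inl_inl (hW : IsAdapted (multiCone K R) (Set.range Sum.inl) W)
    (hR : ∀ C : K.ConnectedComponent, ∃ x ∈ R, K.connectedComponentMk x = C) (x : N)
    (D : K.ConnectedComponent) : W (.inl (K.connectedComponentMk x)) (.inl D) =
      ∑ y, if K.connectedComponentMk y = D then W (.inr x) (.inr y) else 0 := by
  have hm := hW.magic
  have h1 : ∀ D y, K.connectedComponentMk y ≠ D →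
      W (.inl (K.connectedComponentMk x)) (.inl D) * W (.inr x) (.inr y) = 0 := by
    intro D y hy
    by_contra h0
    exact hy (multiCone_component
      ((hW.reachable_iff h0).1 (multiCone_reachable hR x))).symm
  have h2 : ∀ y, W (.inl (K.connectedComponentMk x)) (.inl (K.connectedComponentMk y)) *
      W (.inr x) (.inr y) = W (.inr x) (.inr y) := by
    intro y
    conv_rhs => rw [← one_mul (W (.inr x) (.inr y)), ← hm.row_sum (.inl (K.connectedComponentMk x)),
      Fintype.sum_sum_type, Finset.sum_eq_zero (s := Finset.univ (α := N))
        (fun y _ => multiCone_inl_inr hW _ y), add_zero, Finset.sum_mul]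
    rw [Finset.sum_eq_single (K.connectedComponentMk y) (fun D _ hD => h1 D y hD.symm) (by simp)]
  conv_lhs => rw [← mul_one (W _ _), ← hm.row_sum (.inr x), Fintype.sum_sum_type,
    Finset.sum_eq_zero (fun C _ => multiCone_inr_inl hW C x), zero_add, Finset.mul_sum]
  refine Finset.sum_congr rfl fun y _ => ?_
  split_ifs with hy
  · rw [← hy, h2]
  · exact h1 D y hy

end Restrict

/-! ### Extension of adapted matrices from the base to the separate cones -/

section Extend

variable {U : N → N → B}

open Classical in
/-- The sum of the coefficients in the row of `x` over a component. -/
def componentSum (U : N → N → B) (x : N) (D : K.ConnectedComponent) : B :=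
  ∑ y, if K.connectedComponentMk y = D then U x y else 0

open Classical in
theorem componentSum_def (U : N → N → B) (x : N) (D : K.ConnectedComponent) :
    componentSum U x D = ∑ y, if K.connectedComponentMk y = D then U x y else 0 := rfl

theorem componentSum_mul_ne_zero (hU : IsAdapted K R U) {x x' y' : N} {D : K.ConnectedComponent}
    (hne : componentSum U x D * U x' y' ≠ 0) : K.Reachable x x' ↔ K.connectedComponentMk y' = D := by
  rw [componentSum, Finset.sum_mul] at hne
  obtain ⟨y, -, hy⟩ := Finset.exists_ne_zero_of_sum_ne_zero hne
  split_ifs at hy with h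
  · rw [hU.reachable_iff hy, ← h, SimpleGraph.ConnectedComponent.eq, SimpleGraph.reachable_comm]
  · simp at hy

theorem componentSum_sum (hU : IsAdapted K R U) (x : N) :
    ∑ D : K.ConnectedComponent, componentSum U x D = 1 := by
  classical
  simp only [componentSum_def]
  rw [Finset.sum_comm]
  simp [hU.magic.row_sum]

theorem componentSum_mul (hU : IsAdapted K R U) {x x' : N} (hx : K.Reachable x x') (y : N) :
    componentSum U x (K.connectedComponentMk y) * U x' y = U x' y := by
  conv_rhs => rw [← one_mul (U x' y), ← componentSum_sum hU x, Finset.sum_mul]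
  rw [Finset.sum_eq_single (K.connectedComponentMk y) (fun D _ hD => ?_)
    fun h => absurd (Finset.mem_univ _) h]
  by_contra h0
  exact hD ((componentSum_mul_ne_zero hU h0).1 hx).symm

theorem componentSum_star (hU : IsAdapted K R U) (x : N) (D : K.ConnectedComponent) :
    star (componentSum U x D) = componentSum U x D := by
  simp only [componentSum_def, star_sum, apply_ite star, hU.magic.star_eq, star_zero]

theorem componentSum_mul_componentSum (hU : IsAdapted K R U) (x x' : N)
    (C D : K.ConnectedComponent) (h : ¬(K.Reachable x x' ↔ C = D)) :
    componentSum U x C * componentSum U x' D = 0 := by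
  by_contra h0
  rw [componentSum_def U x', Finset.mul_sum] at h0
  obtain ⟨y, -, hy⟩ := Finset.exists_ne_zero_of_sum_ne_zero h0
  split_ifs at hy with hD
  · have := componentSum_mul_ne_zero hU hy
    rw [hD] at this
    exact h (this.trans eq_comm)
  · simp at hy

/-- For a vertex `y` and a component `C`, summing row `C.out` over the component of `y` gives the
same element as summing column `y` over `C`: the two agree after insertion of the column sum. The
claim is thus the column relation of `U`, grouped by components. -/
theorem componentSum_col (hU : IsAdapted K R U) (y : N) :
    ∑ C : K.ConnectedComponent, componentSum U C.out (K.connectedComponentMk y) = 1 := by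
  classical
  have hout : ∀ C : K.ConnectedComponent, K.connectedComponentMk C.out = C := fun C =>
    Quot.out_eq C
  have h1 : ∀ C : K.ConnectedComponent, componentSum U C.out (K.connectedComponentMk y) =
      ∑ x, if K.connectedComponentMk x = C then U x y else 0 := by
    intro C
    conv_lhs => rw [← mul_one (componentSum U _ _), ← hU.magic.col_sum y, Finset.mul_sum]
    refine Finset.sum_congr rfl fun x _ => ?_
    split_ifs with hx
    · exact componentSum_mul hU (SimpleGraph.ConnectedComponent.exact ((hout C).trans hx.symm)) y
    · by_contra h0
      have := (componentSum_mul_ne_zero hU h0).2 rfl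
      exact hx ((SimpleGraph.ConnectedComponent.sound this).symm.trans (hout C))
  simp only [h1]
  rw [Finset.sum_comm]
  simp [hU.magic.col_sum]

/-- The extension of a matrix to the separate cones. -/
def multiConeMatrix (U : N → N → B) : K.ConnectedComponent ⊕ N → K.ConnectedComponent ⊕ N → B
  -- For adapted `U` the choice of the representative of `C` does not matter.
  | .inl C, .inl D => componentSum U C.out D
  | .inr x, .inr y => U x y
  | .inl _, .inr _ => 0
  | .inr _, .inl _ => 0

theorem isAdapted_multiConeMatrix (hU : IsAdapted K R U) :
    IsAdapted (multiCone K R) (Set.range Sum.inl) (multiConeMatrix U) := by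
  have hm := hU.magic
  have hout : ∀ C : K.ConnectedComponent, K.connectedComponentMk C.out = C := fun C =>
    Quot.out_eq C
  have hreach : ∀ C D : K.ConnectedComponent, K.Reachable C.out D.out ↔ C = D := fun C D => by
    rw [← SimpleGraph.ConnectedComponent.eq, hout, hout]
  have hidem : ∀ x (D : K.ConnectedComponent),
      componentSum U x D * componentSum U x D = componentSum U x D := by
    intro x D
    conv_rhs => rw [← mul_one (componentSum U x D), ← componentSum_sum hU x, Finset.mul_sum]
    rw [Finset.sum_eq_single D (fun D' _ hD' => ?_) fun h => absurd (Finset.mem_univ _) h]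
    exact componentSum_mul_componentSum hU _ _ _ _ fun h =>
      hD' (h.1 (SimpleGraph.Reachable.refl x)).symm
  have hM : IsMagic (multiConeMatrix (K := K) U) := by
    refine ⟨?_, ?_, ?_, ?_, ?_, ?_⟩
    · rintro (C | x) (D | y)
      · exact hidem _ _
      · exact mul_zero _
      · exact mul_zero _
      · exact hm.idem _ _
    · rintro (C | x) (D | y)
      · exact componentSum_star hU _ _
      · exact star_zero _
      · exact star_zero _
      · exact hm.star_eq _ _
    · rintro (C | x) (D | y) (D' | y') hne
      · exact componentSum_mul_componentSum hU _ _ _ _ fun h =>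
          hne (by rw [h.1 (SimpleGraph.Reachable.refl _)])
      · exact mul_zero _
      · exact zero_mul _
      · exact zero_mul _
      · exact mul_zero _
      · exact zero_mul _
      · exact mul_zero _
      · exact hm.row_orth _ _ _ fun h => hne (by rw [h])
    · rintro (C | x) (D | y) (D' | y') hne
      · exact componentSum_mul_componentSum hU _ _ _ _ fun h =>
          hne (by rw [(hreach _ _).1 (h.2 rfl)])
      · exact mul_zero _
      · exact mul_zero _
      · exact zero_mul _
      · exact zero_mul _
      · exact mul_zero _
      · exact mul_zero _
      · exact hm.col_orth _ _ _ fun h => hne (by rw [h])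
    · rintro (C | x)
      · rw [Fintype.sum_sum_type]
        exact (congrArg₂ (· + ·) (componentSum_sum hU C.out)
          (Finset.sum_eq_zero fun _ _ => rfl)).trans (add_zero _)
      · rw [Fintype.sum_sum_type]
        exact (congrArg₂ (· + ·) (Finset.sum_eq_zero fun _ _ => rfl)
          (hm.row_sum x)).trans (zero_add _)
    · rintro (D | y)
      · rw [Fintype.sum_sum_type]
        have := componentSum_col hU D.out
        rw [hout] at this
        exact (congrArg₂ (· + ·) this (Finset.sum_eq_zero fun _ _ => rfl)).trans (add_zero _)
      · rw [Fintype.sum_sum_type]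
        exact (congrArg₂ (· + ·) (Finset.sum_eq_zero fun _ _ => rfl)
          (hm.col_sum y)).trans (zero_add _)
  have key : ∀ (C D : K.ConnectedComponent) (x y : N), componentSum U C.out D * U x y ≠ 0 →
      ((K.connectedComponentMk x = C ∧ x ∈ R) ↔ K.connectedComponentMk y = D ∧ y ∈ R) := by
    intro C D x y hne
    rw [← componentSum_mul_ne_zero hU hne, hU.mem_iff (right_ne_zero_of_mul hne),
      ← SimpleGraph.ConnectedComponent.eq, hout, eq_comm (a := C)]
  refine isAdapted_iff.2 ⟨hM, ?_, ?_⟩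
  · rintro (C | x) (C' | x') (D | y) (D' | y') hne <;> by_contra h0 <;>
      first
        | exact h0 (mul_zero _)
        | exact h0 (zero_mul _)
        | exact hne Iff.rfl
        | exact hne (key _ _ _ _ h0)
        | exact hne (key _ _ _ _ (hM.mul_ne_zero_comm h0))
        | exact hne (hU.adj_iff h0)
  · rintro (C | x) (D | y) hne
    · simp at hne
    · rfl
    · rfl
    · simp at hne

end Extend

/-- The quantum stabiliser of the apices of the separate cones over the components. -/
theorem quStab_iso_multiCone
    (hR : ∀ C : K.ConnectedComponent, ∃ x ∈ R, K.connectedComponentMk x = C) :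
    (quStab K R).Iso (quStab (multiCone K R) (Set.range Sum.inl)) := by
  have h1 := isAdapted_of (multiCone K R) (Set.range Sum.inl)
  have hF := isFundamental_of (multiCone K R) (Set.range Sum.inl)
  have hA := isAdapted_of_multiCone h1
  -- Each component meets `R`, so every coefficient between apices is a sum of coefficients on the
  -- base, and mixed coefficients vanish.
  have hgen : ∀ p q, Univ.of (stabRel (multiCone K R) (Set.range Sum.inl)) (p, q) ∈
      StarAlgebra.adjoin ℂ (Set.range fun p : N × N =>
        Univ.of (stabRel (multiCone K R) (Set.range Sum.inl)) (.inr p.1, .inr p.2)) := by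
    have h0 : ∀ x y, Univ.of (stabRel (multiCone K R) (Set.range Sum.inl)) (.inr x, .inr y) ∈
        StarAlgebra.adjoin ℂ (Set.range fun p : N × N =>
          Univ.of (stabRel (multiCone K R) (Set.range Sum.inl)) (.inr p.1, .inr p.2)) :=
      fun x y => StarAlgebra.subset_adjoin ℂ _ ⟨(x, y), rfl⟩
    rintro (C | x) (D | y)
    · obtain ⟨x, -, rfl⟩ := hR C
      rw [multiCone_inl_inl h1 hR x D]
      refine sum_mem fun y _ => ?_
      split_ifs
      · exact h0 x y
      · exact zero_mem _
    · rw [multiCone_inl_inr h1]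
      exact zero_mem _
    · rw [multiCone_inr_inl h1]
      exact zero_mem _
    · exact h0 x y
  -- Intermediate apices contribute nothing to the comultiplication of base coefficients.
  have hco : ∀ x y, coprod (fun p q =>
      Univ.of (stabRel (multiCone K R) (Set.range Sum.inl)) (p, q)) (.inr x) (.inr y) =
      coprod (fun x y => Univ.of (stabRel (multiCone K R) (Set.range Sum.inl))
        (Sum.inr x, Sum.inr y)) x y := by
    intro x y
    rw [coprod_apply, coprod_apply, Fintype.sum_sum_type, Finset.sum_eq_zero, zero_add]
    intro C _
    rw [multiCone_inr_inl h1, TensorProduct.zero_tmul]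
  refine quStab_iso (Q := quStab (multiCone K R) (Set.range Sum.inl)) hA
    ⟨hA.magic, ?_, fun x y => (hF.comul_eq (.inr x) (.inr y)).trans (hco x y)⟩
    (adaptedLift (isAdapted_multiConeMatrix (isAdapted_of K R))) fun _ _ => rfl
  rw [eq_top_iff, ← hF.generates]
  refine StarAlgebra.adjoin_le ?_
  rintro _ ⟨p, rfl⟩
  exact hgen p.1 p.2

end MultiCone

/-! ### The quantum stabiliser of a vertex -/

section Fix

variable {V : Type} [Fintype V]

instance fintypePsiCut (G : SimpleGraph V) (r : V) : Fintype (psiCut G r).V :=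
  letI : Finite (G.induce {r}ᶜ).ConnectedComponent := inferInstance
  haveI : Finite (psiCut G r).V := inferInstanceAs (Finite {p : (G.induce {r}ᶜ).ConnectedComponent × V //
    ∀ h : p.2 ≠ r, (G.induce {r}ᶜ).connectedComponentMk ⟨p.2, h⟩ = p.1})
  Fintype.ofFinite _

instance fintypeComplSingleton (r : V) : Fintype ({r}ᶜ : Set V) := Fintype.ofFinite _

/-- A rooted graph is the cone over the graph without the root. -/
theorem exists_cone_iso (G : SimpleGraph V) (r : V) :
    ∃ φ : cone (G.induce {r}ᶜ) {x | G.Adj x r} ≃g G, φ none = r := by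
  classical
  let e : Option ({r}ᶜ : Set V) ≃ V := Equiv.optionSubtypeNe r
  refine ⟨⟨e, ?_⟩, rfl⟩
  rintro (_ | x) (_ | y)
  · exact iff_of_false (G.loopless.irrefl _) id
  · exact G.adj_comm _ _
  · exact Iff.rfl
  · exact Iff.rfl

theorem quFix_iso_quStab_induce (G : SimpleGraph V) (r : V) :
    (quFix G r).Iso (quStab (G.induce {r}ᶜ) {x | G.Adj x r}) := by
  obtain ⟨φ, hφ⟩ := exists_cone_iso G r
  refine ((quStab_iso_cone _ _).trans (quStab_congr φ fun x => ?_)).symm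
  rw [Set.mem_singleton_iff, Set.mem_singleton_iff]
  exact ⟨fun h => φ.injective (h.trans hφ.symm), fun h => h ▸ hφ⟩

/-- The apex over a component `C` of `G ∖ r` is the copy of `r` that belongs to `C`. -/
theorem exists_multiCone_iso (G : SimpleGraph V) (r : V) :
    ∃ φ : multiCone (G.induce {r}ᶜ) {x | G.Adj x r} ≃g (psiCut G r).graph,
      ∀ x, φ x ∈ (psiCut G r).marks ↔ x ∈ Set.range Sum.inl := by
  let f : (G.induce {r}ᶜ).ConnectedComponent ⊕ ({r}ᶜ : Set V) → (psiCut G r).V := fun p =>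
    match p with
    | .inl C => ⟨(C, r), fun h => absurd rfl h⟩
    | .inr x => ⟨((G.induce {r}ᶜ).connectedComponentMk x, x.1), fun _ => rfl⟩
  have hf : Function.Bijective f := by
    constructor
    · rintro (C | x) (D | y) h
      · have := congrArg (fun p : (psiCut G r).V => p.1.1) h
        exact congrArg Sum.inl this
      · exact (y.2 (congrArg (fun p : (psiCut G r).V => p.1.2) h).symm).elim
      · exact (x.2 (congrArg (fun p : (psiCut G r).V => p.1.2) h)).elim
      · exact congrArg Sum.inr (Subtype.ext (congrArg (fun p : (psiCut G r).V => p.1.2) h))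
    · rintro ⟨⟨C, v⟩, h⟩
      by_cases hv : v = r
      · subst hv; exact ⟨.inl C, rfl⟩
      · exact ⟨.inr ⟨v, hv⟩, Subtype.ext (Prod.ext (h hv) rfl)⟩
  refine ⟨⟨Equiv.ofBijective f hf, ?_⟩, ?_⟩
  · rintro (C | x) (D | y)
    · exact iff_of_false (fun h => G.loopless.irrefl _ h.2) id
    · exact ⟨fun h => ⟨h.1.symm, h.2.symm⟩, fun h => ⟨h.1.symm, SimpleGraph.Adj.symm h.2⟩⟩
    · exact Iff.rfl
    · exact ⟨fun h => h.2, fun h => ⟨SimpleGraph.ConnectedComponent.sound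
        (SimpleGraph.Adj.reachable h), h⟩⟩
  · rintro (C | x)
    · exact iff_of_true rfl ⟨C, rfl⟩
    · refine iff_of_false (fun h => x.2 h) (by simp)

/-- A walk from a vertex of `C` to `r` stays in `C` until just before it first meets `r`. -/
theorem exists_adj_of_component {G : SimpleGraph V} (hG : G.Connected) (r : V)
    (C : (G.induce {r}ᶜ).ConnectedComponent) :
    ∃ x ∈ {x : ({r}ᶜ : Set V) | G.Adj x r}, (G.induce {r}ᶜ).connectedComponentMk x = C := by
  induction C using SimpleGraph.ConnectedComponent.ind with
  | _ x =>
    obtain ⟨x, hx⟩ := x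
    have : ∀ {u v : V}, G.Walk u v → v = r → ∀ hu : u ≠ r,
        ∃ y : ({r}ᶜ : Set V), G.Adj y r ∧ (G.induce {r}ᶜ).Reachable y ⟨u, hu⟩ := by
      intro u v p
      induction p with
      | nil => intro hv hu; exact absurd hv hu
      | @cons u v w huv p ih =>
        intro hw hu
        by_cases hv : v = r
        · subst hv
          exact ⟨⟨u, hu⟩, huv, SimpleGraph.Reachable.refl _⟩
        · obtain ⟨y, h1, h2⟩ := ih hw hv
          refine ⟨y, h1, h2.trans (SimpleGraph.Adj.reachable ?_)⟩
          exact huv.symm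
    obtain ⟨p⟩ := hG.preconnected x r
    obtain ⟨y, h1, h2⟩ := this p rfl hx
    exact ⟨y, h1, SimpleGraph.ConnectedComponent.sound h2⟩

/-- Splitting a connected graph at a vertex. -/
theorem quFix_iso_psiCut {G : SimpleGraph V} (hG : G.Connected) (r : V) :
    (quFix G r).Iso (quStab (psiCut G r).graph (psiCut G r).marks) := by
  obtain ⟨φ, hφ⟩ := exists_multiCone_iso G r
  exact (quFix_iso_quStab_induce G r).trans
    ((quStab_iso_multiCone (exists_adj_of_component hG r)).trans (quStab_congr φ hφ))

end Fix

/-! ### Walks inside sets and 2-connectedness -/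

section Walks

variable {V : Type} {G : SimpleGraph V}

/-- There is a walk from `a` to `b` inside `S`. -/
def WalkIn (G : SimpleGraph V) (S : Set V) (a b : V) : Prop :=
  ∃ w : G.Walk a b, ∀ x ∈ w.support, x ∈ S

theorem WalkIn.refl {S : Set V} {a : V} (ha : a ∈ S) : WalkIn G S a a :=
  ⟨.nil, by simpa using ha⟩

theorem WalkIn.symm {S : Set V} {a b : V} (h : WalkIn G S a b) : WalkIn G S b a := by
  obtain ⟨w, hw⟩ := h
  exact ⟨w.reverse, by simpa using hw⟩

theorem WalkIn.trans {S : Set V} {a b c : V} (h : WalkIn G S a b) (h' : WalkIn G S b c) :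
    WalkIn G S a c := by
  obtain ⟨w, hw⟩ := h
  obtain ⟨w', hw'⟩ := h'
  refine ⟨w.append w', fun x hx => ?_⟩
  rcases (SimpleGraph.Walk.mem_support_append_iff _ _).1 hx with h | h
  · exact hw x h
  · exact hw' x h

theorem WalkIn.mono {S T : Set V} (hST : S ⊆ T) {a b : V} (h : WalkIn G S a b) :
    WalkIn G T a b := by
  obtain ⟨w, hw⟩ := h
  exact ⟨w, fun x hx => hST (hw x hx)⟩

theorem WalkIn.of_adj {S : Set V} {a b : V} (ha : a ∈ S) (hb : b ∈ S) (h : G.Adj a b) :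
    WalkIn G S a b :=
  ⟨.cons h .nil, by simpa using ⟨ha, hb⟩⟩

theorem WalkIn.reachable_induce {S : Set V} {a b : V} (h : WalkIn G S a b) (ha : a ∈ S)
    (hb : b ∈ S) : (G.induce S).Reachable ⟨a, ha⟩ ⟨b, hb⟩ := by
  obtain ⟨w, hw⟩ := h
  exact ⟨w.induce S hw⟩

theorem walkIn_of_reachable_induce {S : Set V} {a b : S} (h : (G.induce S).Reachable a b) :
    WalkIn G S a.1 b.1 := by
  obtain ⟨w⟩ := h
  induction w with
  | nil => exact WalkIn.refl (Subtype.property _)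
  | cons h p ih => exact (WalkIn.of_adj (Subtype.property _) (Subtype.property _) h).trans ih

/-- A property that is preserved along the edges leaving vertices inside a set is preserved along
walks. -/
theorem WalkIn.preserves {S : Set V} {P : V → Prop}
    (hP : ∀ u v, u ∈ S → v ∈ S → G.Adj u v → P u → P v) {a b : V} (h : WalkIn G S a b) (ha : P a) :
    P b := by
  obtain ⟨w, hw⟩ := h
  induction w with
  | nil => exact ha
  | cons h p ih =>
    exact ih (hP _ _ (hw _ (by simp)) (hw _ (by simp)) h ha) fun x hx => hw x (by simp [hx])

theorem twoConnected_of {S : Set V} (hne : S.Nonempty) (h : ∀ a ∈ S, ∀ b ∈ S, WalkIn G S a b)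
    (h' : ∀ v ∈ S, ∀ a ∈ S, ∀ b ∈ S, a ≠ v → b ≠ v → WalkIn G (S \ {v}) a b) :
    TwoConnected (G.induce S) := by
  have : Nonempty S := hne.to_subtype
  refine ⟨⟨fun a b => (h a a.2 b b.2).reachable_induce a.2 b.2⟩, ?_⟩
  rintro ⟨v, hv⟩ ⟨⟨a, ha⟩, hav⟩ ⟨⟨b, hb⟩, hbv⟩
  have hav' : a ≠ v := fun e => hav (Subtype.ext e)
  have hbv' : b ≠ v := fun e => hbv (Subtype.ext e)
  have h1 := (h' v hv a ha b hb hav' hbv').reachable_induce ⟨ha, hav'⟩ ⟨hb, hbv'⟩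
  exact h1.map (⟨fun x => ⟨⟨x.1, x.2.1⟩, fun e => x.2.2 (congrArg Subtype.val e)⟩, fun h => h⟩ :
    G.induce (S \ {v}) →g (G.induce S).induce {⟨v, hv⟩}ᶜ)

theorem TwoConnected.walkIn {S : Set V} (h : TwoConnected (G.induce S)) (v : V) {a b : V}
    (ha : a ∈ S) (hb : b ∈ S) (hav : a ≠ v) (hbv : b ≠ v) : WalkIn G (S \ {v}) a b := by
  by_cases hv : v ∈ S
  · have h1 := h.2 ⟨v, hv⟩ ⟨⟨a, ha⟩, fun e => hav (congrArg Subtype.val e)⟩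
      ⟨⟨b, hb⟩, fun e => hbv (congrArg Subtype.val e)⟩
    have h2 := h1.map (⟨fun x => ⟨x.1.1, x.1.2, fun e => x.2 (Subtype.ext e)⟩, fun h => h⟩ :
      (G.induce S).induce {⟨v, hv⟩}ᶜ →g G.induce (S \ {v}))
    exact walkIn_of_reachable_induce h2
  · rw [Set.sdiff_singleton_eq_self hv]
    exact walkIn_of_reachable_induce (h.1.preconnected ⟨a, ha⟩ ⟨b, hb⟩)

theorem twoConnected_of_isClique {S : Set V} (hne : S.Nonempty) (hS : G.IsClique S) :
    TwoConnected (G.induce S) := by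
  refine twoConnected_of hne (fun a ha b hb => ?_) fun v _ a ha b hb hav hbv => ?_
  · by_cases hab : a = b
    · subst hab; exact WalkIn.refl ha
    · exact WalkIn.of_adj ha hb (hS ha hb hab)
  · by_cases hab : a = b
    · subst hab; exact WalkIn.refl ⟨ha, hav⟩
    · exact WalkIn.of_adj ⟨ha, hav⟩ ⟨hb, hbv⟩ (hS ha hb hab)

theorem isBlockGraph_of (h : ∀ S : Set V, TwoConnected (G.induce S) → G.IsClique S) :
    IsBlockGraph G := fun S hS => h S hS.prop

theorem IsBlockGraph.isClique [Finite V] (h : IsBlockGraph G) {S : Set V}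
    (hS : TwoConnected (G.induce S)) : G.IsClique S := by
  obtain ⟨T, hST, hT⟩ := Set.Finite.exists_le_maximal
    (Set.toFinite {T : Set V | TwoConnected (G.induce T)}) hS
  exact (h T hT).subset hST

/-- A path visits its endpoint only once, so its initial segment up to `z` misses `b`. -/
theorem walkIn_path {a b : V} (q : G.Walk a b) (hq : q.IsPath) {z : V} (hz : z ∈ q.support)
    (hzb : z ≠ b) : WalkIn G {t | t ∈ q.support ∧ t ≠ b} a z := by
  classical
  refine ⟨q.takeUntil z hz, fun x hx => ⟨q.support_takeUntil_subset_support hz hx, ?_⟩⟩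
  rintro rfl
  exact SimpleGraph.Walk.endpoint_notMem_support_takeUntil hq hz hzb.symm hx

/-- In a block graph, two neighbours of `v` that are connected by a walk avoiding `v` are
adjacent. -/
theorem IsBlockGraph.adj_of_walkIn [Finite V] (h : IsBlockGraph G) {x v y : V} (hx : G.Adj x v)
    (hy : G.Adj y v) (hxy : x ≠ y) (hw : WalkIn G {v}ᶜ x y) : G.Adj x y := by
  classical
  obtain ⟨w, hw⟩ := hw
  set p := w.bypass with hp
  have hpp : p.IsPath := w.bypass_isPath
  have hpv : v ∉ p.support := fun hv => hw v (w.support_bypass_subset_support hv) rfl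
  -- The path from `x` to `y` and the vertex `v` form a closed cycle, so `S` is 2-connected and
  -- therefore a clique.
  set S : Set V := insert v {t | t ∈ p.support} with hS
  have hvS : v ∈ S := Set.mem_insert _ _
  have hpS : ∀ {t}, t ∈ p.support → t ∈ S := fun ht => Set.mem_insert_of_mem _ ht
  -- When `u` is removed from the cycle, `z` is reached from `v` through `x` or through `y`,
  -- according to the side of `u` on which it lies.
  have htov : ∀ u ∈ S, u ≠ v → ∀ z ∈ S, z ≠ u → WalkIn G (S \ {u}) v z := by
    intro u hu huv z hz hzu
    have hup : u ∈ p.support := hu.resolve_left huv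
    rcases hz with rfl | hz
    · exact WalkIn.refl ⟨hvS, huv.symm⟩
    · have hz' : z ∈ p.support := hz
      rw [← p.take_spec hup, SimpleGraph.Walk.mem_support_append_iff] at hz'
      have hsub : ∀ t, t ∈ p.support → t ≠ u → t ∈ S \ {u} := fun t ht ht' =>
        ⟨hpS ht, ht'⟩
      rcases hz' with h1 | h1
      · have h2 := (walkIn_path _ (hpp.takeUntil hup) h1 hzu).mono (T := S \ {u}) fun t ht =>
          hsub t (p.support_takeUntil_subset_support hup ht.1) ht.2
        have h3 : x ∈ S \ {u} := by obtain ⟨w, hw⟩ := h2; exact hw _ w.start_mem_support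
        exact (WalkIn.of_adj (S := S \ {u}) ⟨hvS, huv.symm⟩ h3 hx.symm).trans h2
      · have h2 := (walkIn_path (p.dropUntil u hup).reverse ((hpp.dropUntil hup).reverse)
          (by simpa using h1) hzu).mono (T := S \ {u}) fun t ht =>
            hsub t (p.support_dropUntil_subset_support hup (by simpa using ht.1)) ht.2
        have h3 : y ∈ S \ {u} := by obtain ⟨w, hw⟩ := h2; exact hw _ w.start_mem_support
        exact (WalkIn.of_adj (S := S \ {u}) ⟨hvS, huv.symm⟩ h3 hy.symm).trans h2
  have hpath : ∀ z ∈ p.support, WalkIn G (S \ {v}) x z := by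
    intro z hz
    refine ⟨p.takeUntil z hz, fun t ht => ?_⟩
    have := p.support_takeUntil_subset_support hz ht
    exact ⟨hpS this, fun e => hpv (e ▸ this)⟩
  have hcon : ∀ z ∈ S, WalkIn G S v z := by
    intro z hz
    rcases hz with rfl | hz
    · exact WalkIn.refl hvS
    · exact (WalkIn.of_adj hvS (hpS p.start_mem_support) hx.symm).trans
        ((hpath z hz).mono Set.sdiff_subset)
  have h2 : TwoConnected (G.induce S) := by
    refine twoConnected_of ⟨v, hvS⟩ (fun a ha b hb => (hcon a ha).symm.trans (hcon b hb))
      fun u hu a ha b hb hau hbu => ?_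
    by_cases huv : u = v
    · subst huv
      exact (hpath a (ha.resolve_left hau)).symm.trans (hpath b (hb.resolve_left hbu))
    · exact (htov u hu huv a ha hau).symm.trans (htov u hu huv b hb hbu)
  exact h.isClique h2 (hpS p.start_mem_support) (hpS p.end_mem_support) hxy

/-- Reachability cannot be dropped: unreachable vertices have `dist` zero. -/
theorem dist_triangle_of_reachable {u v w : V} (h : G.Reachable u v) (h' : G.Reachable v w) :
    G.dist u w ≤ G.dist u v + G.dist v w := by
  obtain ⟨p, hp⟩ := h.exists_walk_length_eq_dist
  obtain ⟨q, hq⟩ := h'.exists_walk_length_eq_dist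
  rw [← hp, ← hq, ← SimpleGraph.Walk.length_append]
  exact SimpleGraph.dist_le _

end Walks

/-! ### The level function of a rooted block graph -/

section BlockLevel

variable {V : Type} {G : SimpleGraph V}

/-- `root` selects one vertex in every connected component. -/
structure IsRootMap (G : SimpleGraph V) (root : V → V) : Prop where
  reachable : ∀ x, G.Reachable x (root x)
  eq_of_reachable : ∀ {x y}, G.Reachable x y → root x = root y

/-- The distance to the root. -/
def rootDist (G : SimpleGraph V) (root : V → V) (x : V) : ℕ := G.dist x (root x)

theorem rootDist_eq_zero {root : V → V} (h : IsRootMap G root) {x : V} :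
    rootDist G root x = 0 ↔ x = root x := (h.reachable x).dist_eq_zero_iff

theorem rootDist_le_succ {root : V → V} (h : IsRootMap G root) {u v : V} (huv : G.Adj u v) :
    rootDist G root u ≤ rootDist G root v + 1 := by
  rw [rootDist, rootDist, h.eq_of_reachable huv.reachable, add_comm]
  refine (dist_triangle_of_reachable huv.reachable (h.reachable v)).trans ?_
  exact Nat.add_le_add_right (SimpleGraph.dist_le huv.toWalk) _

theorem exists_adj_dist_succ {v r : V} (h : G.Reachable v r) (hv : G.dist v r ≠ 0) :
    ∃ p, G.Adj v p ∧ G.dist p r + 1 = G.dist v r := by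
  obtain ⟨w, hw⟩ := h.exists_walk_length_eq_dist
  cases w with
  | nil => exact absurd hw.symm hv
  | @cons _ p _ hadj q =>
    refine ⟨p, hadj, le_antisymm ?_ ?_⟩
    · rw [← hw, SimpleGraph.Walk.length_cons]
      exact Nat.add_le_add_right (SimpleGraph.dist_le q) 1
    · rw [add_comm]
      exact (dist_triangle_of_reachable hadj.reachable ⟨q⟩).trans
        (Nat.add_le_add_right (SimpleGraph.dist_le hadj.toWalk) _)

theorem rootDist_exists_parent {root : V → V} (h : IsRootMap G root) {v : V}
    (hv : rootDist G root v ≠ 0) : ∃ p, G.Adj v p ∧ rootDist G root p + 1 = rootDist G root v := by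
  obtain ⟨p, hp, hl⟩ := exists_adj_dist_succ (h.reachable v) hv
  refine ⟨p, hp, ?_⟩
  rw [rootDist, rootDist, ← h.eq_of_reachable hp.reachable, hl]

/-- Passing from parent to parent meets only lower levels after the start. This makes it possible to
avoid a given vertex in the next lemma. -/
theorem rootDist_walkIn {root : V → V} (h : IsRootMap G root) (n : ℕ) :
    ∀ p, rootDist G root p = n →
      WalkIn G {x | x = p ∨ rootDist G root x < rootDist G root p} p (root p) := by
  induction n with
  | zero =>
    intro p hp
    rw [← (rootDist_eq_zero h).1 hp]
    exact WalkIn.refl (Or.inl rfl)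
  | succ n ih =>
    intro p hp
    obtain ⟨q, hq, hq'⟩ := rootDist_exists_parent h (v := p) (by omega)
    rw [h.eq_of_reachable hq.reachable]
    refine (WalkIn.of_adj (S := {x | x = p ∨ rootDist G root x < rootDist G root p}) (Or.inl rfl)
      (Or.inr (by omega)) hq).trans ((ih q (by omega)).mono ?_)
    rintro x (rfl | hx)
    · exact Or.inr (by omega)
    · exact Or.inr (by omega)

theorem rootDist_walkIn_avoid {root : V → V} (h : IsRootMap G root) {x y v : V}
    (hxy : G.Reachable x y) (hxv : x ≠ v) (hyv : y ≠ v)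
    (hx : rootDist G root x ≤ rootDist G root v) (hy : rootDist G root y ≤ rootDist G root v) :
    WalkIn G {v}ᶜ x y := by
  have key : ∀ x, x ≠ v → rootDist G root x ≤ rootDist G root v → WalkIn G {v}ᶜ x (root x) := by
    intro x hxv hx
    refine (rootDist_walkIn h _ x rfl).mono ?_
    rintro t (rfl | ht) e
    · exact hxv e
    · rw [Set.mem_singleton_iff.1 e] at ht; omega
  have h2 := key y hyv hy
  rw [← h.eq_of_reachable hxy] at h2
  exact (key x hxv hx).trans h2.symm

/-- All the axioms on neighbours come from `adj_of_walkIn`: vertices that are not above the level of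
`v` and differ from `v` are joined through the root without meeting `v`, so two such neighbours of
`v` are adjacent. -/
theorem IsBlockGraph.isLevel [Finite V] (hG : IsBlockGraph G) {root : V → V}
    (h : IsRootMap G root) : IsLevel G (rootDist G root) := by
  have huniq : ∀ {v p p'}, G.Adj v p → G.Adj v p' → rootDist G root p + 1 = rootDist G root v →
      rootDist G root p' + 1 = rootDist G root v → p = p' := by
    intro v p p' hp hp' hl hl'
    by_contra hne
    have hr : G.Reachable p p' := hp.symm.reachable.trans hp'.reachable
    have hpv : p ≠ v := hp.ne'
    have hpv' : p' ≠ v := hp'.ne'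
    have hpp : G.Adj p p' := hG.adj_of_walkIn hp.symm hp'.symm hne
      (rootDist_walkIn_avoid h hr hpv hpv' (by omega) (by omega))
    have hp0 : rootDist G root p ≠ 0 := by
      intro h0
      have h0' : rootDist G root p' = 0 := by omega
      rw [rootDist_eq_zero h] at h0 h0'
      exact hne (h0.trans ((h.eq_of_reachable hr).trans h0'.symm))
    obtain ⟨q, hq, hql⟩ := rootDist_exists_parent h hp0
    have hvq : v ≠ q := by rintro rfl; omega
    -- The route through the second parent `p'` avoids `p`. It makes `v` adjacent to its grandparent
    -- `q`, two levels below.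
    have hw : WalkIn G {p}ᶜ v q := by
      refine (WalkIn.of_adj (b := p') (Ne.symm hpv) (Ne.symm hne) hp').trans ?_
      refine rootDist_walkIn_avoid h (hr.symm.trans hq.reachable) (Ne.symm hne) hq.ne' (by omega)
        (by omega)
    have := rootDist_le_succ h (hG.adj_of_walkIn hp hq.symm hvq hw)
    omega
  refine ⟨rootDist_le_succ h, rootDist_exists_parent h, huniq, ?_, ?_⟩
  · intro u v p huv hl hup hpl
    obtain ⟨p', hp', hpl'⟩ := rootDist_exists_parent h (v := v) (by omega)
    by_cases hpp : p' = p
    · rwa [← hpp]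
    · have hw : WalkIn G {u}ᶜ v p := by
        refine (WalkIn.of_adj (b := p') huv.ne' ?_ hp').trans ?_
        · rintro e; rw [Set.mem_singleton_iff.1 e] at hpl'; omega
        · refine rootDist_walkIn_avoid h
            (hp'.symm.reachable.trans (huv.symm.reachable.trans hup.reachable)) ?_ hup.ne'
            (by omega) (by omega)
          rintro rfl; omega
      refine hG.adj_of_walkIn huv.symm hup.symm ?_ hw
      rintro rfl; omega
  · intro u v w huv hvw h1 h2 huw
    exact hG.adj_of_walkIn huv hvw.symm huw (rootDist_walkIn_avoid h
      (huv.reachable.trans hvw.reachable) huv.ne hvw.ne' h1.le (by omega))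

end BlockLevel

/-! ### Branches -/

namespace IsLevel

variable {V : Type} {G : SimpleGraph V} {l : V → ℕ}

/-- `x` is a descendant of `b`. -/
def Dsc (G : SimpleGraph V) (l : V → ℕ) (b x : V) : Prop := Relation.ReflTransGen (IsChild G l) b x

/-- `x` is a descendant of a sibling of `b`. -/
def InBranch (G : SimpleGraph V) (l : V → ℕ) (b x : V) : Prop :=
  ∃ b', IsSib G l b b' ∧ Dsc G l b' x

theorem isSib_level {y z : V} (h : IsSib G l y z) : l y = l z := by
  rcases h with rfl | h
  · rfl
  · exact h.2

theorem adj_cases (h : IsLevel G l) {u v : V} (huv : G.Adj u v) :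
    IsChild G l u v ∨ l u = l v ∨ IsChild G l v u := by
  have h1 := h.le_succ huv
  have h2 := h.le_succ huv.symm
  rcases lt_trichotomy (l u) (l v) with h3 | h3 | h3
  · exact Or.inl ⟨huv.symm, by omega⟩
  · exact Or.inr (Or.inl h3)
  · exact Or.inr (Or.inr ⟨huv, by omega⟩)

theorem dsc_level {b x : V} (h : Dsc G l b x) : l b ≤ l x := by
  induction h with
  | refl => exact le_rfl
  | tail _ h ih => have := h.2; omega

theorem dsc_eq {b x : V} (h : Dsc G l b x) (hl : l x ≤ l b) : x = b := by
  cases h with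
  | refl => rfl
  | tail h h' => have := h'.2; have := dsc_level h; omega

theorem dsc_reachable {b x : V} (h : Dsc G l b x) : G.Reachable b x := by
  induction h with
  | refl => rfl
  | tail _ h ih => exact ih.trans h.1.symm.reachable

theorem dsc_dist {b x : V} (h : Dsc G l b x) : G.dist b x + l b ≤ l x := by
  induction h with
  | refl => simp
  | tail h h' ih =>
    have := h'.2
    have h1 := dist_triangle_of_reachable (dsc_reachable h) h'.1.symm.reachable
    have h2 := SimpleGraph.dist_le h'.1.symm.toWalk
    simp only [SimpleGraph.Walk.length_cons, SimpleGraph.Walk.length_nil] at h2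
    omega

theorem dsc_unique (h : IsLevel G l) {b b' x : V} (h1 : Dsc G l b x) (h2 : Dsc G l b' x)
    (hl : l b = l b') : b = b' := by
  induction h1 with
  | refl => exact dsc_eq h2 hl.le
  | @tail c x h1 hc ih =>
    rcases Relation.ReflTransGen.cases_tail h2 with rfl | ⟨c', h2, hc'⟩
    · have := dsc_level h1; have := hc.2; omega
    · have : c = c' := h.parent_unique hc.1 hc'.1 hc.2 hc'.2
      exact ih (this ▸ h2)

/-- A descendant other than `b` has its parent among the descendants, hence also its siblings and
its children. -/
theorem dsc_adj (h : IsLevel G l) {b u v : V} (hu : Dsc G l b u) (huv : G.Adj u v) :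
    Dsc G l b v ∨ u = b := by
  rcases Relation.ReflTransGen.cases_tail hu with e | ⟨c, hc, hcu⟩
  · exact Or.inr e
  · left
    rcases h.adj_cases huv with h1 | h1 | h1
    · exact hu.tail h1
    · exact hc.tail (h.isChild_of_isSib hcu (Or.inr ⟨huv, h1⟩))
    · rwa [h.parent_unique h1.1 hcu.1 h1.2 hcu.2]

theorem exists_dsc (h : IsLevel G l) (n : ℕ) : ∀ x, n ≤ l x → ∃ b, l b = n ∧ Dsc G l b x := by
  intro x
  induction hk : l x - n generalizing x with
  | zero => exact fun hn => ⟨x, by omega, .refl⟩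
  | succ k ih =>
    intro hn
    have hx : l x ≠ 0 := by omega
    have hp := h.level_parent hx
    obtain ⟨b, hb, hd⟩ := ih (parent G l x) (by omega) (by omega)
    exact ⟨b, hb, hd.tail (h.isChild_parent hx)⟩

theorem inBranch_level {b x : V} (h : InBranch G l b x) : l b ≤ l x := by
  obtain ⟨b', hb, hx⟩ := h
  rw [isSib_level hb]
  exact dsc_level hx

theorem isSib_of_inBranch {b x : V} (h : InBranch G l b x) (hl : l x ≤ l b) : IsSib G l b x := by
  obtain ⟨b', hb, hx⟩ := h
  rwa [dsc_eq hx (hl.trans (isSib_level hb).le)]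

theorem inBranch_of_isSib {b x : V} (h : IsSib G l b x) : InBranch G l b x := ⟨x, h, .refl⟩

theorem isSib_of_inBranch_of_inBranch (h : IsLevel G l) {b c x : V} (h1 : InBranch G l b x)
    (h2 : InBranch G l c x) (hl : l b = l c) : IsSib G l b c := by
  obtain ⟨b', hb, hx⟩ := h1
  obtain ⟨c', hc, hx'⟩ := h2
  have : b' = c' := h.dsc_unique hx hx' (by rw [← isSib_level hb, ← isSib_level hc, hl])
  subst this
  exact h.isSib_trans hb (isSib_symm hc)

/-- A branch can only be left through its parent. -/
theorem inBranch_adj (h : IsLevel G l) {b u v : V} (hu : InBranch G l b u) (huv : G.Adj u v) :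
    InBranch G l b v ∨ (IsSib G l b u ∧ IsChild G l v b) := by
  obtain ⟨b', hb, hd⟩ := hu
  rcases h.dsc_adj hd huv with h1 | rfl
  · exact Or.inl ⟨b', hb, h1⟩
  · rcases h.adj_cases huv with h1 | h1 | h1
    · exact Or.inl ⟨u, hb, hd.tail h1⟩
    · exact Or.inl ⟨v, h.isSib_trans hb (Or.inr ⟨huv, h1⟩), .refl⟩
    · exact Or.inr ⟨hb, h.isChild_of_isSib h1 (isSib_symm hb)⟩

theorem inBranch_of_walkIn (h : IsLevel G l) {S : Set V} {b p x y : V} (hp : IsChild G l p b)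
    (hS : p ∉ S) (hx : InBranch G l b x) (hw : WalkIn G S x y) : InBranch G l b y := by
  refine hw.preserves (fun u v _ hv huv hu => ?_) hx
  refine (h.inBranch_adj hu huv).resolve_right fun h1 => hS ?_
  rwa [h.parent_unique hp.1 h1.2.1 hp.2 h1.2.2]

/-- Paths that leave a branch pass through its parent. -/
theorem dist_parent_lt (h : IsLevel G l) {b p x y : V} (hp : IsChild G l p b)
    (hx : InBranch G l b x) (hy : ¬InBranch G l b y) (hxy : G.Reachable x y) :
    G.dist p y + 1 ≤ G.dist x y := by
  obtain ⟨w, hw⟩ := hxy.exists_walk_length_eq_dist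
  rw [← hw]
  clear hw
  induction w with
  | nil => exact absurd hx hy
  | @cons u v y huv q ih =>
    rw [SimpleGraph.Walk.length_cons]
    rcases h.inBranch_adj hx huv with h1 | h1
    · have := ih h1 hy ⟨q⟩; omega
    · rw [h.parent_unique hp.1 h1.2.1 hp.2 h1.2.2]
      exact Nat.add_le_add_right (SimpleGraph.dist_le q) 1

/-- Let `x, y` be distinct in a 2-connected set with `y` not above `x`. From an `x` of level zero a
walk could only reach descendants, which lie strictly higher. Otherwise either `y` is the parent of
`x`, or a walk from `x` to `y` avoiding this parent stays in the branch of `x`, where the level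
bound leaves only siblings. -/
theorem isBlockGraph (h : IsLevel G l) (h0 : ∀ {u v}, G.Adj u v → l u = 0 → l v ≠ 0) :
    IsBlockGraph G := by
  refine isBlockGraph_of fun S hS => ?_
  have key : ∀ x ∈ S, ∀ y ∈ S, x ≠ y → l y ≤ l x → G.Adj x y := by
    intro x hx y hy hxy hl
    by_cases hx0 : l x = 0
    · have hw := walkIn_of_reachable_induce (hS.1.preconnected ⟨x, hx⟩ ⟨y, hy⟩)
      have : Dsc G l x y := by
        refine hw.preserves (P := Dsc G l x) (fun u v _ _ huv hu => ?_) .refl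
        rcases h.dsc_adj hu huv with h1 | rfl
        · exact h1
        · have h2 := h.le_succ huv.symm
          exact .single ⟨huv.symm, by have := h0 huv hx0; omega⟩
      exact absurd (dsc_eq this hl).symm hxy
    · have hp := h.isChild_parent hx0
      by_cases hyp : y = parent G l x
      · rw [hyp]; exact hp.1
      · have hw := hS.walkIn (parent G l x) hx hy hp.1.ne hyp
        have := h.inBranch_of_walkIn hp (fun e => e.2 rfl) (inBranch_of_isSib (isSib_refl x)) hw
        exact ((isSib_of_inBranch this hl).resolve_left hxy).1
  intro x hx y hy hxy
  rcases le_total (l y) (l x) with hl | hl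
  · exact key x hx y hy hxy hl
  · exact (key y hy x hx hxy.symm hl).symm

theorem connected (h : IsLevel G l) {r : V} (hr : ∀ v, l v = 0 → v = r) : G.Connected := by
  have : ∀ v, G.Reachable r v := by
    intro v
    obtain ⟨b, hb, hd⟩ := h.exists_dsc 0 v (Nat.zero_le _)
    rw [hr b hb] at hd
    exact dsc_reachable hd
  have : Nonempty V := ⟨r⟩
  exact ⟨fun u v => (‹∀ v, G.Reachable r v› u).symm.trans (‹∀ v, G.Reachable r v› v)⟩

end IsLevel

/-! ### The centers of the components of a block graph -/

section Center

open IsLevel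

variable {V : Type} [Fintype V] {G : SimpleGraph V}

/-- The eccentricity of a vertex in its connected component. -/
def ecc (G : SimpleGraph V) (x : V) : ℕ := Finset.univ.sup (G.dist x)

/-- The union of the centers of the connected components. -/
def centers (G : SimpleGraph V) : Set V := {x | ∀ y, G.Reachable x y → ecc G x ≤ ecc G y}

theorem dist_le_ecc (x y : V) : G.dist x y ≤ ecc G x := Finset.le_sup (Finset.mem_univ y)

theorem ecc_le {x : V} {n : ℕ} (h : ∀ y, G.Reachable x y → G.dist x y ≤ n) : ecc G x ≤ n := by
  refine Finset.sup_le fun y _ => ?_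
  by_cases hy : G.Reachable x y
  · exact h y hy
  · rw [SimpleGraph.dist_eq_zero_of_not_reachable hy]
    exact Nat.zero_le _

theorem ecc_eq_of_mem {x y : V} (hx : x ∈ centers G) (hy : y ∈ centers G) (h : G.Reachable x y) :
    ecc G x = ecc G y := le_antisymm (hx y h) (hy x h.symm)

theorem mem_centers_of_le {x y : V} (hx : x ∈ centers G) (h : G.Reachable x y)
    (hl : ecc G y ≤ ecc G x) : y ∈ centers G := fun z hz => hl.trans (hx z (h.trans hz))

/-- A vertex of the same component whose distances are all strictly below the eccentricity of `x`
contradicts centrality of `x`. Positivity is needed for the subtraction of one. -/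
theorem not_ecc_lt {x y : V} (hx : x ∈ centers G) (h : G.Reachable x y) (hpos : 0 < ecc G x)
    (hlt : ∀ z, G.Reachable y z → G.dist y z + 1 ≤ ecc G x) : False := by
  have h1 := hx y h
  have h2 : ecc G y ≤ ecc G x - 1 := ecc_le fun z hz => by have := hlt z hz; omega
  omega

theorem exists_rootMap_centers (G : SimpleGraph V) :
    ∃ root, IsRootMap G root ∧ ∀ x, root x ∈ centers G := by
  classical
  have key : ∀ c : G.ConnectedComponent, ∃ r, G.connectedComponentMk r = c ∧ r ∈ centers G := by
    intro c
    induction c using SimpleGraph.ConnectedComponent.ind with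
    | h v =>
      obtain ⟨r, hr, hmin⟩ := Finset.exists_min_image ({x | G.Reachable v x} : Finset V) (ecc G)
        ⟨v, by simp⟩
      simp only [Finset.mem_filter, Finset.mem_univ, true_and] at hr hmin
      exact ⟨r, SimpleGraph.ConnectedComponent.sound hr.symm, fun y hy => hmin y (hr.trans hy)⟩
  choose f hf hf' using key
  refine ⟨fun x => f (G.connectedComponentMk x), ⟨fun x => ?_, fun {x y} h => ?_⟩, fun x => hf' _⟩
  · exact (SimpleGraph.ConnectedComponent.exact (hf _)).symm
  · simp only [SimpleGraph.ConnectedComponent.sound h]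

variable {root : V → V}

theorem dist_root_eq (hr : IsRootMap G root) {r y : V} (h0 : rootDist G root r = 0)
    (h : G.Reachable r y) : G.dist r y = rootDist G root y := by
  rw [rootDist, ← hr.eq_of_reachable h, ← (rootDist_eq_zero hr).1 h0, SimpleGraph.dist_comm]

theorem rootDist_adj_ne_zero (hr : IsRootMap G root) {u v : V} (h : G.Adj u v)
    (hu : rootDist G root u = 0) : rootDist G root v ≠ 0 := by
  intro hv
  rw [rootDist_eq_zero hr] at hu hv
  exact h.ne (hu.trans ((hr.eq_of_reachable h.reachable).trans hv.symm))

/-- Among the vertices of positive level, only those of level one can be central. -/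
theorem rootDist_le_one_of_mem_centers (hG : IsBlockGraph G) (hr : IsRootMap G root)
    (hc : ∀ x, root x ∈ centers G) {x : V} (hx : x ∈ centers G) : rootDist G root x ≤ 1 := by
  by_contra hlt
  have hl := hG.isLevel hr
  have hx0 : rootDist G root x ≠ 0 := by omega
  have hp := hl.isChild_parent hx0
  have hp2 := hp.2
  have hpos : 0 < ecc G x := by
    have := dist_le_ecc (G := G) x (root x)
    rw [rootDist] at hlt
    omega
  -- The parent would be better than `x`. Inside the branch of `x` it is closer than the root, since
  -- its own level is positive, and the root is as central as `x`. Outside the branch it is one step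
  -- closer than `x`.
  refine not_ecc_lt hx hp.1.reachable hpos fun z hz => ?_
  by_cases hz' : InBranch G (rootDist G root) x z
  · obtain ⟨b, hb, hbz⟩ := hz'
    have h1 := dsc_dist (Relation.ReflTransGen.head (hl.isChild_of_isSib hp hb) hbz)
    have h2 := dist_root_eq hr (r := root x) (y := z)
      ((rootDist_eq_zero hr).2 (hr.eq_of_reachable (hr.reachable x)))
      ((hr.reachable x).symm.trans (hp.1.reachable.trans hz))
    have h3 := dist_le_ecc (G := G) (root x) z
    rw [ecc_eq_of_mem (hc x) hx (hr.reachable x).symm] at h3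
    omega
  · exact (hl.dist_parent_lt hp (inBranch_of_isSib (isSib_refl x)) hz'
      (hp.1.reachable.trans hz)).trans (dist_le_ecc _ _)

/-- If `s` and `t` lay in different branches, every vertex would be outside one of them, and `r`
would be one step closer to it than `s` or `t`. Then `r` would have smaller eccentricity than these
central vertices. -/
theorem isSib_of_mem_centers (hG : IsBlockGraph G) (hr : IsRootMap G root) {r s t : V}
    (hc : r ∈ centers G) (hs : s ∈ centers G) (ht : t ∈ centers G)
    (hrs : IsChild G (rootDist G root) r s) (hrt : IsChild G (rootDist G root) r t) :
    IsSib G (rootDist G root) s t := by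
  have hl := hG.isLevel hr
  by_contra hst
  have es := ecc_eq_of_mem hc hs hrs.1.symm.reachable
  have et := ecc_eq_of_mem hc ht hrt.1.symm.reachable
  have hpos : 0 < ecc G r := by
    have := hrs.1.symm.reachable.pos_dist_of_ne hrs.1.ne'
    exact this.trans_le (dist_le_ecc r s)
  refine not_ecc_lt hc .rfl hpos fun z hz => ?_
  by_cases hz' : InBranch G (rootDist G root) s z
  · have hz2 : ¬InBranch G (rootDist G root) t z := fun h =>
      hst (hl.isSib_of_inBranch_of_inBranch hz' h (by have := hrs.2; have := hrt.2; omega))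
    rw [et]
    exact (hl.dist_parent_lt hrt (inBranch_of_isSib (isSib_refl t)) hz2
      (hrt.1.reachable.trans hz)).trans (dist_le_ecc _ _)
  · rw [es]
    exact (hl.dist_parent_lt hrs (inBranch_of_isSib (isSib_refl s)) hz'
      (hrs.1.reachable.trans hz)).trans (dist_le_ecc _ _)

theorem isSib_reachable {l : V → ℕ} {s t : V} (h : IsSib G l s t) : G.Reachable s t := by
  rcases h with rfl | h
  · rfl
  · exact h.1.reachable

theorem isSib_dist {l : V → ℕ} {s t : V} (h : IsSib G l s t) : G.dist s t ≤ 1 := by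
  rcases h with rfl | h
  · simp
  · exact (SimpleGraph.dist_le h.1.toWalk)

/-- From `t` at most one sideways step is needed before descending to `z`. As `s` has level one, the
total is at most the level of `z`, which is its distance from `r`. -/
theorem dist_lt_of_inBranch (hG : IsBlockGraph G) (hr : IsRootMap G root) {r s t z : V}
    (h0 : rootDist G root r = 0) (hrs : IsChild G (rootDist G root) r s)
    (hst : IsSib G (rootDist G root) s t) (hz : InBranch G (rootDist G root) s z) :
    G.dist t z ≤ ecc G r := by
  have hl := hG.isLevel hr
  obtain ⟨b, hb, hbz⟩ := hz
  have htb := hl.isSib_trans (isSib_symm hst) hb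
  have h1 := dsc_dist hbz
  have h2 := isSib_dist htb
  have h3 := dist_triangle_of_reachable (isSib_reachable htb) (dsc_reachable hbz)
  have h4 := isSib_level hb
  have h5 := hrs.2
  have h6 := dist_root_eq hr h0
    (hrs.1.symm.reachable.trans ((isSib_reachable hb).trans (dsc_reachable hbz)))
  have h7 := dist_le_ecc (G := G) r z
  omega

/-- Inside the branch of `s` the previous lemma bounds the distances from `t`. Outside, the detour
through `r` costs one step, which is regained because `r` is one step closer than `s`. -/
theorem mem_centers_of_isSib (hG : IsBlockGraph G) (hr : IsRootMap G root) {r s t : V}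
    (h0 : rootDist G root r = 0)
    (hc : r ∈ centers G) (hs : s ∈ centers G) (hrs : IsChild G (rootDist G root) r s)
    (hst : IsSib G (rootDist G root) s t) : t ∈ centers G := by
  have hl := hG.isLevel hr
  have es := ecc_eq_of_mem hc hs hrs.1.symm.reachable
  have hrt := hl.isChild_of_isSib hrs hst
  refine mem_centers_of_le hc hrt.1.symm.reachable (ecc_le fun z hz => ?_)
  by_cases hz' : InBranch G (rootDist G root) s z
  · exact dist_lt_of_inBranch hG hr h0 hrs hst hz'
  · have h1 := dist_triangle_of_reachable hrt.1.reachable (hrt.1.symm.reachable.trans hz)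
    have h2 := SimpleGraph.dist_le hrt.1.toWalk
    simp only [SimpleGraph.Walk.length_cons, SimpleGraph.Walk.length_nil] at h2
    have h3 := hl.dist_parent_lt hrs (inBranch_of_isSib (isSib_refl s)) hz'
      ((isSib_reachable hst).trans hz)
    have h4 := dist_le_ecc (G := G) s z
    omega

end Center

/-! ### The level function of a block graph with respect to its centers -/

section CenterLevel

open IsLevel

variable {V : Type} [Fintype V] {G : SimpleGraph V}

theorem mem_centers_iff {root : V → V} (hG : IsBlockGraph G) (hr : IsRootMap G root)
    (hc : ∀ x, root x ∈ centers G) {x : V} : x ∈ centers G ↔ x = root x ∨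
      ∃ s ∈ centers G, IsChild G (rootDist G root) (root x) s ∧
        IsSib G (rootDist G root) s x := by
  have hrr : ∀ x, rootDist G root (root x) = 0 := fun x =>
    (rootDist_eq_zero hr).2 (hr.eq_of_reachable (hr.reachable x))
  constructor
  · intro hx
    by_cases h0 : rootDist G root x = 0
    · exact Or.inl ((rootDist_eq_zero hr).1 h0)
    · have h1 := rootDist_le_one_of_mem_centers hG hr hc hx
      have h2 := (hG.isLevel hr).isChild_parent h0
      have h3 : rootDist G root (parent G (rootDist G root) x) = 0 := by have := h2.2; omega
      rw [rootDist_eq_zero hr, ← hr.eq_of_reachable h2.1.reachable] at h3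
      rw [h3] at h2
      exact Or.inr ⟨x, hx, h2, isSib_refl x⟩
  · rintro (h | ⟨s, hs, hrs, hsx⟩)
    · rw [h]; exact hc x
    · exact mem_centers_of_isSib hG hr (hrr x) (hc x) hs hrs hsx

/-- Lowering the level of a set of branches. -/
theorem IsLevel.shift {l : V → ℕ} (hl : IsLevel G l) (h0 : ∀ {u v}, G.Adj u v → l u = 0 → l v ≠ 0)
    (P : V → Prop) [DecidablePred P] (h1 : ∀ x, P x → l x ≠ 0)
    (h2 : ∀ {x y}, P x → G.Adj x y → ¬P y → l x = 1 ∧ l y = 0)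
    (h3 : ∀ {x y z}, P x → P z → l x = 1 → l z = 1 → G.Adj x y → G.Adj y z → l y = 0 → x ≠ z →
      G.Adj x z) :
    IsLevel G fun x => if P x then l x - 1 else l x := by
  set l' : V → ℕ := fun x => if P x then l x - 1 else l x with hl'
  have e1 : ∀ {x}, P x → l' x + 1 = l x := fun {x} hx => by
    have := h1 x hx
    simp only [hl', if_pos hx]
    omega
  have e2 : ∀ {x}, ¬P x → l' x = l x := fun {x} hx => if_neg hx
  -- An edge either does not cross the boundary of `P`, and both levels are shifted alike, or it
  -- joins old levels one and zero, which both become zero.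
  have hmix : ∀ {x y}, G.Adj x y → (P x ↔ P y) ∨ (l' x = 0 ∧ l' y = 0) := by
    intro x y hxy
    by_cases hx : P x <;> by_cases hy : P y
    · exact Or.inl (iff_of_true hx hy)
    · have := h2 hx hxy hy
      have := e1 hx
      have := e2 hy
      exact Or.inr (by omega)
    · have := h2 hy hxy.symm hx
      have := e1 hy
      have := e2 hx
      exact Or.inr (by omega)
    · exact Or.inl (iff_of_false hx hy)
  have hstep : ∀ {x y k m}, (P x ↔ P y) → (l' x + k = l' y + m ↔ l x + k = l y + m) := by
    intro x y k m hxy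
    by_cases hx : P x
    · have := e1 hx
      have := e1 (hxy.1 hx)
      omega
    · rw [e2 hx, e2 (mt hxy.2 hx)]
  have htop : ∀ {x y}, G.Adj x y → l' x ≠ 0 → (P x ↔ P y) := fun hxy hx =>
    (hmix hxy).resolve_right fun h => hx h.1
  have hz : ∀ {x}, P x → l' x = 0 → l x = 1 := fun hx h => by have := e1 hx; omega
  refine ⟨?_, ?_, ?_, ?_, ?_⟩
  · intro u v huv
    rcases hmix huv with h | h
    · have := hl.le_succ huv
      by_cases hu : P u
      · have := e1 hu
        have := e1 (h.1 hu)
        omega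
      · rwa [e2 hu, e2 (mt h.2 hu)]
    · omega
  · intro v hv
    have hv0 : l v ≠ 0 := by
      by_cases hP : P v
      · exact h1 v hP
      · rwa [e2 hP] at hv
    obtain ⟨p, hp, hpl⟩ := hl.exists_parent hv0
    exact ⟨p, hp, (hstep (m := 0) (htop hp hv).symm).2 hpl⟩
  · intro v p p' hp hp' hpl hpl'
    have hv : l' v ≠ 0 := by omega
    exact hl.parent_unique hp hp' ((hstep (m := 0) (htop hp hv).symm).1 hpl)
      ((hstep (m := 0) (htop hp' hv).symm).1 hpl')
  · intro u v p huv he hup hpl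
    have hu : l' u ≠ 0 := by omega
    exact hl.parent_adj huv ((hstep (k := 0) (m := 0) (htop huv hu)).1 he) hup
      ((hstep (m := 0) (htop hup hu).symm).1 hpl)
  · intro u v w huv hvw he he' huw
    by_cases hv0 : l' v = 0
    · have hu0 : l' u = 0 := by omega
      have hw0 : l' w = 0 := by omega
      -- At new level zero the old level is one inside `P` and zero outside. The cases follow from
      -- the old axioms for siblings and parents or from `h3`, or are excluded: `h0` forbids edges
      -- at old level zero, and a vertex has only one old parent.
      by_cases hu : P u <;> by_cases hv : P v <;> by_cases hw : P w
      · exact hl.trans huv hvw (by rw [hz hu hu0, hz hv hv0]) (by rw [hz hv hv0, hz hw hw0]) huw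
      · refine (hl.parent_adj huv.symm (by rw [hz hu hu0, hz hv hv0]) hvw ?_)
        rw [hz hv hv0, ← e2 hw, hw0]
      · exact h3 hu hw (hz hu hu0) (hz hw hw0) huv hvw (by rw [← e2 hv, hv0]) huw
      · exact absurd (by rw [← e2 hw, hw0]) (h0 hvw (by rw [← e2 hv, hv0]))
      · refine (hl.parent_adj hvw (by rw [hz hw hw0, hz hv hv0]) huv.symm ?_).symm
        rw [hz hv hv0, ← e2 hu, hu0]
      · refine absurd (hl.parent_unique huv.symm hvw ?_ ?_) huw
        · rw [hz hv hv0, ← e2 hu, hu0]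
        · rw [hz hv hv0, ← e2 hw, hw0]
      · exact absurd (by rw [← e2 hv, hv0]) (h0 huv (by rw [← e2 hu, hu0]))
      · exact absurd (by rw [← e2 hv, hv0]) (h0 huv (by rw [← e2 hu, hu0]))
    · have hu0 : l' u ≠ 0 := by omega
      exact hl.trans huv hvw ((hstep (k := 0) (m := 0) (htop huv hu0)).1 he)
        ((hstep (k := 0) (m := 0) (htop hvw hv0)).1 he') huw

/-- A block graph has a level function that vanishes exactly on the centers of the components. -/
theorem IsBlockGraph.exists_isLevel_centers (hG : IsBlockGraph G) :
    ∃ l : V → ℕ, IsLevel G l ∧ ∀ x, l x = 0 ↔ x ∈ centers G := by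
  classical
  obtain ⟨root, hr, hc⟩ := exists_rootMap_centers G
  have hl := hG.isLevel hr
  have hrr : ∀ x, rootDist G root (root x) = 0 := fun x =>
    (rootDist_eq_zero hr).2 (hr.eq_of_reachable (hr.reachable x))
  -- The branches of the central vertices of level one. Where the center is a block, its members
  -- other than the root have level one, and lowering their branches puts the whole block at level
  -- zero; where the center is a single vertex, nothing changes.
  let P : V → Prop := fun x =>
    ∃ s ∈ centers G, rootDist G root s = 1 ∧ InBranch G (rootDist G root) s x
  have h1 : ∀ x, P x → (rootDist G root) x ≠ 0 := by
    rintro x ⟨s, -, hs, hx⟩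
    have := inBranch_level hx
    omega
  have hPc : ∀ {x}, P x → (rootDist G root) x = 1 → x ∈ centers G := by
    rintro x ⟨s, hsc, hs, hx⟩ hx1
    have hs0 : (rootDist G root) s ≠ 0 := by omega
    have hp := hl.isChild_parent hs0
    have hp0 : rootDist G root (parent G (rootDist G root) s) = 0 := by have := hp.2; omega
    refine mem_centers_of_isSib hG hr hp0 ?_ hsc hp (isSib_of_inBranch hx (by omega))
    rw [(rootDist_eq_zero hr).1 hp0]
    exact hc _
  refine ⟨_, hl.shift (fun h => rootDist_adj_ne_zero hr h) P h1 ?_ ?_, fun x => ?_⟩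
  · rintro x y ⟨s, hsc, hs, hx⟩ hxy hy
    rcases hl.inBranch_adj hx hxy with h | h
    · exact absurd ⟨s, hsc, hs, h⟩ hy
    · have := isSib_level h.1
      have := h.2.2
      omega
  · intro x y z hx hz hx1 hz1 hxy hyz hy hne
    refine ((isSib_of_mem_centers hG hr ?_ (hPc hx hx1) (hPc hz hz1) ⟨hxy, by omega⟩
      ⟨hyz.symm, by omega⟩).resolve_left hne).1
    rw [(rootDist_eq_zero hr).1 hy]
    exact hc _
  · by_cases hx : P x
    · rw [if_pos hx]
      have hx0 := h1 x hx
      refine ⟨fun h => hPc hx (by omega), fun h => ?_⟩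
      have := rootDist_le_one_of_mem_centers hG hr hc h
      omega
    · rw [if_neg hx]
      constructor
      · intro h
        rw [(rootDist_eq_zero hr).1 h]
        exact hc _
      · intro h
        rcases (mem_centers_iff hG hr hc).1 h with h2 | ⟨s, hs, hrs, hsx⟩
        · exact (rootDist_eq_zero hr).2 h2
        · refine absurd ⟨s, hs, ?_, inBranch_of_isSib hsx⟩ hx
          rw [← hrs.2]
          exact congrArg (· + 1) (hrr x)

theorem IsAdapted.ecc_eq {A : Type} [Ring A] [StarRing A] {U : V → V → A} {R : Set V}
    (h : IsAdapted G R U) {x y : V} (hxy : U x y ≠ 0) : ecc G x = ecc G y := by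
  apply le_antisymm
  · refine ecc_le fun z _ => ?_
    obtain ⟨z', hz⟩ := h.magic.exists_mul_row hxy z
    rw [h.dist_eq hz]
    exact dist_le_ecc _ _
  · refine ecc_le fun z _ => ?_
    obtain ⟨z', hz⟩ := h.magic.exists_mul_col hxy z
    rw [← h.dist_eq hz]
    exact dist_le_ecc _ _

theorem IsAdapted.mem_centers_iff {A : Type} [Ring A] [StarRing A] {U : V → V → A} {R : Set V}
    (h : IsAdapted G R U) {x y : V} (hxy : U x y ≠ 0) : x ∈ centers G ↔ y ∈ centers G := by
  constructor
  · intro hx z hz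
    obtain ⟨z', hz'⟩ := h.magic.exists_mul_col hxy z
    rw [← h.ecc_eq hxy, ← h.ecc_eq (right_ne_zero_of_mul hz')]
    exact hx z' ((h.reachable_iff hz').2 hz)
  · intro hx z hz
    obtain ⟨z', hz'⟩ := h.magic.exists_mul_row hxy z
    rw [h.ecc_eq hxy, h.ecc_eq (right_ne_zero_of_mul hz')]
    exact hx z' ((h.reachable_iff hz').1 hz)

/-- Nonzero products preserve reachability and nonzero coefficients preserve eccentricities, so
stabilising the centers is no additional relation. -/
theorem qu_iso_quStab_centers (G : SimpleGraph V) : (qu G).Iso (quStab G (centers G)) := by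
  refine quStab_iso_of_iff fun B _ _ _ _ U => ?_
  constructor
  · intro h
    refine isAdapted_iff.2 ⟨h.magic, (isAdapted_iff.1 h).2.1, fun x y hne => ?_⟩
    by_contra h0
    exact hne (h.mem_centers_iff h0)
  · intro h
    exact isAdapted_iff.2 ⟨h.magic, (isAdapted_iff.1 h).2.1, fun x y hne => absurd Iff.rfl hne⟩

/-! ### Connected graphs -/

theorem eccent_eq_ecc (hG : G.Connected) (x : V) : G.eccent x = (ecc G x : ℕ∞) := by
  apply le_antisymm
  · rw [SimpleGraph.eccent_le_iff]
    intro y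
    rw [← (hG.preconnected x y).coe_dist_eq_edist]
    exact_mod_cast dist_le_ecc x y
  · obtain ⟨y, -, hy⟩ := Finset.exists_mem_eq_sup Finset.univ ⟨x, Finset.mem_univ x⟩ (G.dist x)
    rw [ecc, hy, (hG.preconnected x y).coe_dist_eq_edist]
    exact SimpleGraph.edist_le_eccent

theorem center_eq_centers (hG : G.Connected) : G.center = centers G := by
  ext x
  rw [SimpleGraph.mem_center_iff]
  constructor
  · intro hx y _
    have := SimpleGraph.radius_le_eccent (G := G) (u := y)
    rw [← hx, eccent_eq_ecc hG, eccent_eq_ecc hG] at this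
    exact_mod_cast this
  · intro hx
    refine le_antisymm (le_iInf fun y => ?_) SimpleGraph.radius_le_eccent
    rw [eccent_eq_ecc hG, eccent_eq_ecc hG]
    exact_mod_cast hx y (hG.preconnected x y)

theorem isCutVertex_of_not_reachable (hG : G.Connected) {r s z : V} (hs : s ≠ r) (hz : z ≠ r)
    (h : ¬WalkIn G {r}ᶜ s z) : IsCutVertex G r := by
  right
  have h1 : Nat.card G.ConnectedComponent = 1 := by
    rw [Nat.card_eq_one_iff_unique]
    have := hG.nonempty
    exact ⟨hG.preconnected.subsingleton_connectedComponent, inferInstance⟩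
  rw [h1, Finite.one_lt_card_iff_nontrivial]
  refine ⟨(G.induce {r}ᶜ).connectedComponentMk ⟨s, hs⟩,
    (G.induce {r}ᶜ).connectedComponentMk ⟨z, hz⟩, fun e => h ?_⟩
  exact walkIn_of_reachable_induce (SimpleGraph.ConnectedComponent.exact e)

/-- The center of a connected block graph is a cut vertex or a block. -/
theorem IsBlockGraph.center_cases (hB : IsBlockGraph G) (hG : G.Connected) :
    (∃ r, IsCutVertex G r ∧ G.center = {r}) ∨ IsBlock G G.center := by
  rw [center_eq_centers hG]
  obtain ⟨root, hr, hc⟩ := exists_rootMap_centers G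
  have hl := hB.isLevel hr
  obtain ⟨v⟩ := hG.nonempty
  set r := root v with hrdef
  have hroot : ∀ x, root x = r := fun x => hr.eq_of_reachable (hG.preconnected x v)
  have hr0 : ∀ x, rootDist G root x = 0 ↔ x = r := fun x => by
    rw [rootDist_eq_zero hr, hroot]
  have hmem := fun x => mem_centers_iff hB hr hc (x := x)
  simp only [hroot] at hmem
  have hrc : r ∈ centers G := hc v
  have hdist : ∀ z, G.dist r z = rootDist G root z := fun z =>
    dist_root_eq hr ((hr0 r).2 rfl) (hG.preconnected r z)
  by_cases hex : ∃ s ∈ centers G, IsChild G (rootDist G root) r s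
  · right
    obtain ⟨s, hs, hrs⟩ := hex
    have hmem' : ∀ x, x ∈ centers G ↔ x = r ∨ IsSib G (rootDist G root) s x := by
      intro x
      rw [hmem]
      refine or_congr_right ⟨?_, fun h => ⟨s, hs, hrs, h⟩⟩
      rintro ⟨t, ht, hrt, htx⟩
      exact hl.isSib_trans (isSib_of_mem_centers hB hr hrc hs ht hrs hrt) htx
    have hclique : G.IsClique (centers G) := by
      intro x hx y hy hxy
      rcases (hmem' x).1 hx with rfl | hx <;> rcases (hmem' y).1 hy with rfl | hy
      · exact absurd rfl hxy
      · exact (hl.isChild_of_isSib hrs hy).1.symm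
      · exact (hl.isChild_of_isSib hrs hx).1
      · exact ((hl.isSib_trans (isSib_symm hx) hy).resolve_left hxy).1
    -- A 2-connected set containing the center is a clique, so its further vertices are adjacent to
    -- both `r` and `s`; they have level one and are siblings of `s`.
    refine ⟨twoConnected_of_isClique ⟨r, hrc⟩ hclique, fun T hT hle x hx => ?_⟩
    have hTc := hB.isClique hT
    rw [hmem']
    by_cases hxr : x = r
    · exact Or.inl hxr
    · by_cases hxs : s = x
      · exact Or.inr (Or.inl hxs)
      · have h1 := hTc hx (hle hrc) hxr
        have h2 := hTc (hle hs) hx hxs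
        have h3 := hl.le_succ h1
        have h4 := (hr0 r).2 rfl
        have h5 := mt (hr0 x).1 hxr
        have h6 := hrs.2
        exact Or.inr (Or.inr ⟨h2, by omega⟩)
  · left
    refine ⟨r, ?_, ?_⟩
    · by_cases hsub : Subsingleton V
      · exact Or.inl hsub
      · rw [not_subsingleton_iff_nontrivial] at hsub
        -- Let `s` be the child of `r` below which a farthest vertex `y` lies. It is not central, so
        -- some `z` is farther from `s` than any vertex is from `r`. Such a `z` is outside the
        -- branch of `s`, and `r` separates `s` from `z`.
        obtain ⟨y, -, hy⟩ := Finset.exists_mem_eq_sup Finset.univ ⟨r, Finset.mem_univ r⟩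
          (G.dist r)
        obtain ⟨t, ht⟩ := exists_ne r
        have hpos : 0 < ecc G r :=
          ((hG.preconnected r t).pos_dist_of_ne ht.symm).trans_le (dist_le_ecc r t)
        have hy' : ecc G r = rootDist G root y := by rw [← hdist]; exact hy
        obtain ⟨s, hs1, hsy⟩ := hl.exists_dsc 1 y (by omega)
        have hs0 : rootDist G root s ≠ 0 := by omega
        have hrs : IsChild G (rootDist G root) r s := by
          have h1 := hl.isChild_parent hs0
          rwa [(hr0 (parent G (rootDist G root) s)).1 (by have := h1.2; omega)] at h1
        have hsc : s ∉ centers G := fun h => hex ⟨s, h, hrs⟩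
        have hlt : ecc G r < ecc G s := by
          by_contra hle
          exact hsc (mem_centers_of_le hrc (hG.preconnected _ _) (by omega))
        obtain ⟨z, -, hz⟩ := Finset.exists_mem_eq_sup Finset.univ ⟨s, Finset.mem_univ s⟩
          (G.dist s)
        have hz' : ecc G s = G.dist s z := hz
        have hzb : ¬InBranch G (rootDist G root) s z := fun h => by
          have := dist_lt_of_inBranch hB hr ((hr0 r).2 rfl) hrs (isSib_refl s) h
          omega
        refine isCutVertex_of_not_reachable hG hrs.1.ne (z := z) ?_ fun hw => hzb ?_
        · rintro rfl
          have := SimpleGraph.dist_le hrs.1.toWalk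
          simp only [SimpleGraph.Walk.length_cons, SimpleGraph.Walk.length_nil] at this
          omega
        · exact hl.inBranch_of_walkIn hrs (S := {r}ᶜ) (fun e => e rfl) (inBranch_of_isSib (isSib_refl s)) hw
    · ext x
      rw [hmem, Set.mem_singleton_iff]
      refine or_iff_left ?_
      rintro ⟨s, hs, hrs, -⟩
      exact hex ⟨s, hs, hrs⟩

end CenterLevel

open IsLevel

/-! ### Rooted trees and forests of blocks -/

/-- A connected block graph with a root, described by the distance to the root. -/
def IsRootedTree {V : Type} (G : SimpleGraph V) (r : V) : Prop :=
  ∃ l : V → ℕ, IsLevel G l ∧ ∀ x, l x = 0 ↔ x = r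

/-- A disjoint union of connected block graphs with one marked vertex each. -/
def IsRootedForest (M : MarkedGraph) : Prop :=
  ∃ l : M.V → ℕ, IsLevel M.graph l ∧ (∀ x, l x = 0 ↔ x ∈ M.marks) ∧
    ∀ u v, M.graph.Adj u v → u ∈ M.marks → v ∉ M.marks

section Forest

variable {V : Type} {G : SimpleGraph V}

theorem IsRootedTree.connected {r : V} (h : IsRootedTree G r) : G.Connected :=
  let ⟨_, hl, hr⟩ := h
  hl.connected fun v => (hr v).1

theorem IsRootedTree.isBlockGraph {r : V} (h : IsRootedTree G r) : IsBlockGraph G := by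
  obtain ⟨l, hl, hr⟩ := h
  refine hl.isBlockGraph fun {u v} huv hu hv => huv.ne ?_
  rw [(hr u).1 hu, (hr v).1 hv]

theorem IsBlockGraph.isRootedTree [Finite V] (hB : IsBlockGraph G) (hG : G.Connected) (r : V) :
    IsRootedTree G r := by
  have hr : IsRootMap G fun _ => r := ⟨fun x => hG.preconnected x r, fun _ => rfl⟩
  exact ⟨_, hB.isLevel hr, fun x => rootDist_eq_zero hr⟩

theorem isRootedForest_psiBlock {R : Set V} {l : V → ℕ} (hl : IsLevel G l)
    (hR : ∀ x, l x = 0 ↔ x ∈ R) : IsRootedForest (psiBlock G R) := by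
  refine ⟨l, ⟨fun {u v} h => hl.le_succ h.1, fun {v} hv => ?_,
    fun {v p p'} h h' => hl.parent_unique h.1 h'.1, fun {u v p} huv he hup hpl => ?_,
    fun {u v w} huv hvw he he' huw => ?_⟩, hR, fun u v h hu hv => h.2 ⟨hu, hv⟩⟩
  · obtain ⟨p, hp, hpl⟩ := hl.exists_parent hv
    exact ⟨p, ⟨hp, fun h => hv ((hR v).2 h.1)⟩, hpl⟩
  · exact ⟨hl.parent_adj huv.1 he hup.1 hpl, fun h => by have := (hR v).2 h.1; omega⟩
  · refine ⟨hl.trans huv.1 hvw.1 he he' huw, fun h => huv.2 ⟨h.1, ?_⟩⟩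
    exact (hR v).1 (he.symm.trans ((hR u).2 h.1))

/-- The level function of a cone. -/
def coneLevel (l : V → ℕ) : Option V → ℕ := fun x => x.elim 0 (l · + 1)

theorem coneLevel_eq_zero {l : V → ℕ} {x : Option V} : coneLevel l x = 0 ↔ x = none := by
  rcases x with _ | v <;> simp [coneLevel]

theorem isLevel_cone {R : Set V} {l : V → ℕ} (hl : IsLevel G l)
    (hR : ∀ x, l x = 0 ↔ x ∈ R) : IsLevel (cone G R) (coneLevel l) := by
  refine ⟨?_, ?_, ?_, ?_, ?_⟩
  · rintro (_ | u) (_ | v) h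
    · exact Nat.zero_le _
    · exact Nat.zero_le _
    · have : l u = 0 := (hR u).2 h
      simp [coneLevel, this]
    · exact Nat.succ_le_succ (hl.le_succ h)
  · rintro (_ | v) hv
    · exact absurd rfl hv
    · by_cases h0 : l v = 0
      · exact ⟨none, (hR v).1 h0, by simp [coneLevel, h0]⟩
      · obtain ⟨p, hp, hpl⟩ := hl.exists_parent h0
        exact ⟨some p, hp, congrArg (· + 1) hpl⟩
  · rintro (_ | v) (_ | p) (_ | p') h h' hp hp'
    all_goals first | rfl | simp only [coneLevel, Option.elim] at hp hp'; try omega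
    exact congrArg some (hl.parent_unique h h' (by omega) (by omega))
  · rintro (_ | u) (_ | v) (_ | p) huv he hup hpl
    all_goals simp only [coneLevel, Option.elim] at he hpl; try omega
    · exact (hR v).1 (by omega)
    · exact hl.parent_adj huv (by omega) hup (by omega)
  · rintro (_ | u) (_ | v) (_ | w) huv hvw he he' huw
    all_goals simp only [coneLevel, Option.elim] at he he'; try omega
    exact hl.trans huv hvw (by omega) (by omega) fun e => huw (congrArg some e)

theorem isRootedTree_cone {R : Set V} {l : V → ℕ} (hl : IsLevel G l)
    (hR : ∀ x, l x = 0 ↔ x ∈ R) : IsRootedTree (cone G R) none :=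
  ⟨coneLevel l, isLevel_cone hl hR, fun _ => coneLevel_eq_zero⟩

theorem IsRootedForest.isRootedTree_cone {M : MarkedGraph} (h : IsRootedForest M) :
    IsRootedTree (cone M.graph M.marks) none :=
  let ⟨_, hl, hR, _⟩ := h
  QBlock.isRootedTree_cone hl hR

theorem isRootedForest_psiCut {r : V} (h : IsRootedTree G r) : IsRootedForest (psiCut G r) := by
  obtain ⟨l, hl, hr⟩ := h
  refine ⟨fun p => l p.1.2, ⟨fun h => hl.le_succ h.2, ?_, ?_, ?_, ?_⟩, fun x => hr _, ?_⟩
  · rintro ⟨⟨C, v⟩, hC⟩ hv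
    obtain ⟨p, hp, hpl⟩ := hl.exists_parent hv
    have hvr : v ≠ r := fun e => hv ((hr v).2 e)
    refine ⟨⟨(C, p), fun hpr => ?_⟩, ⟨rfl, hp⟩, hpl⟩
    rw [← hC hvr]
    exact SimpleGraph.ConnectedComponent.sound (SimpleGraph.Adj.reachable
      (show (G.induce {r}ᶜ).Adj ⟨p, hpr⟩ ⟨v, hvr⟩ from hp.symm))
  · intro v p p' h h' hp hp'
    exact Subtype.ext (Prod.ext (h.1.symm.trans h'.1) (hl.parent_unique h.2 h'.2 hp hp'))
  · intro u v p huv he hup hpl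
    exact ⟨huv.1.symm.trans hup.1, hl.parent_adj huv.2 he hup.2 hpl⟩
  · intro u v w huv hvw he he' huw
    refine ⟨huv.1.trans hvw.1, hl.trans huv.2 hvw.2 he he' fun e => huw ?_⟩
    exact Subtype.ext (Prod.ext (huv.1.trans hvw.1) e)
  · rintro u v h hu hv
    refine h.2.ne ?_
    rw [show u.1.2 = r from hu, show v.1.2 = r from hv]

/-- In `Ψ(G, {r})`, the neighbours of a root are pairwise adjacent. -/
theorem psiCut_adj_of_adj {r : V} (h : IsRootedTree G r) {ρ u v : (psiCut G r).V}
    (hρ : ρ ∈ (psiCut G r).marks) (hu : (psiCut G r).graph.Adj u ρ)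
    (hv : (psiCut G r).graph.Adj v ρ) (huv : u ≠ v) : (psiCut G r).graph.Adj u v := by
  obtain ⟨l, hl, hr⟩ := h
  have hρ' : ρ.1.2 = r := hρ
  have hur := hu.2
  have hvr := hv.2
  rw [hρ'] at hur hvr
  have hC : u.1.1 = v.1.1 := hu.1.trans hv.1.symm
  refine ⟨hC, ?_⟩
  -- Both vertices lie in the same component of `G ∖ r`. A walk that avoids `r` cannot leave the
  -- branch of a child of `r`, so two children joined by it are siblings.
  have hw : WalkIn G {r}ᶜ u.1.2 v.1.2 := by
    refine walkIn_of_reachable_induce (a := ⟨u.1.2, hur.ne⟩) (b := ⟨v.1.2, hvr.ne⟩) ?_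
    refine SimpleGraph.ConnectedComponent.exact ?_
    rw [u.2 hur.ne, v.2 hvr.ne, hC]
  have hch : ∀ {x}, G.Adj x r → IsChild G l r x := fun {x} hx => by
    have h1 := hl.le_succ hx
    have h2 := mt (hr x).1 hx.ne
    have h3 := (hr r).2 rfl
    exact ⟨hx, by omega⟩
  have h1 := hl.inBranch_of_walkIn (hch hur) (S := {r}ᶜ) (fun e => e rfl)
    (inBranch_of_isSib (isSib_refl _)) hw
  have h2 := (hch hur).2
  have h3 := (hch hvr).2
  rcases isSib_of_inBranch h1 (by omega) with h4 | h4
  · exact absurd (Subtype.ext (Prod.ext hC h4)) huv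
  · exact h4.1

/-- The graph without the root is a forest with respect to the neighbours of the root. -/
theorem isLevel_induce {r : V} {l : V → ℕ} (hl : IsLevel G l) (hr : ∀ x, l x = 0 ↔ x = r) :
    IsLevel (G.induce {r}ᶜ) (fun x => l x.1 - 1) ∧
      ∀ x : ({r}ᶜ : Set V), l x.1 - 1 = 0 ↔ x ∈ {x : ({r}ᶜ : Set V) | G.Adj x r} := by
  have hpos : ∀ x : ({r}ᶜ : Set V), l x.1 ≠ 0 := fun x => mt (hr _).1 x.2
  refine ⟨⟨?_, ?_, ?_, ?_, ?_⟩, fun x => ?_⟩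
  · intro u v huv
    have := hl.le_succ (u := u.1) (v := v.1) huv
    have := hpos v
    omega
  · intro v hv
    have hvp := hpos v
    obtain ⟨p, hp, hpl⟩ := hl.exists_parent hvp
    have hpr : p ≠ r := fun e => by have := (hr p).2 e; omega
    exact ⟨⟨p, hpr⟩, hp, by change l p - 1 + 1 = l v.1 - 1; omega⟩
  · intro v p p' h h' hp hp'
    have := hpos v
    have := hpos p
    have := hpos p'
    exact Subtype.ext (hl.parent_unique (v := v.1) (p := p.1) (p' := p'.1) h h' (by omega) (by omega))
  · intro u v p huv he hup hpl
    have := hpos u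
    have := hpos v
    have := hpos p
    exact hl.parent_adj (u := u.1) (v := v.1) (p := p.1) huv (by omega) hup (by omega)
  · intro u v w huv hvw he he' huw
    have := hpos u
    have := hpos v
    have := hpos w
    exact hl.trans (u := u.1) (v := v.1) (w := w.1) huv hvw (by omega) (by omega) fun e => huw (Subtype.ext e)
  · have hx := hpos x
    have h0 := (hr r).2 rfl
    constructor
    · intro h
      obtain ⟨p, hp, hpl⟩ := hl.exists_parent hx
      have : p = r := (hr p).1 (by omega)
      exact this ▸ hp
    · intro h
      have := hl.le_succ (u := x.1) h
      omega

end Forest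

/-! ### Decompositions -/

section Decomposition

variable {M : MarkedGraph} {z k : ℕ} {a : Fin k → ℕ} {H : Fin k → RootedGraph}

theorem IsDecomposition.isRootedTree (h : IsDecomposition M z a H) (i : Fin k) :
    IsRootedTree (H i).graph (H i).root :=
  (h.isBlockGraph i).isRootedTree (h.connected i) _

theorem IsDecomposition.quStab_iso [Fintype M.V] (h : IsDecomposition M z a H) :
    (quStab M.graph M.marks).Iso (freeProd₂ (SPlus z)
      (freeProd fun i => freeWreath (quFix (H i).graph (H i).root) (a i))) := by
  obtain ⟨φ, hφ⟩ := h.iso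
  choose l hl hr using h.isRootedTree
  exact (quStab_congr φ hφ).trans
    (quStab_iso_of_isLevel hl hr h.connected h.nontrivial h.not_iso)

theorem isRootedForest_rootedSum (h : ∀ i, IsRootedTree (H i).graph (H i).root) :
    IsRootedForest (rootedSum z a H) := by
  choose l hl hr using h
  refine ⟨sumLevel z a H l, isLevel_sumLevel hl, fun x => ?_, ?_⟩
  · rw [marks_eq_sumLevel hr]; rfl
  · rintro _ _ ⟨i, m, x, y, rfl, rfl, hxy⟩ hx hy
    exact hxy.ne ((sumVert_mem_marks.1 hx).trans (sumVert_mem_marks.1 hy).symm)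

/-- A rooted forest is determined by a decomposition of its set of roots. -/
theorem exists_isDecomposition [Fintype M.V] (h : IsRootedForest M) :
    ∃ (z k : ℕ) (a : Fin k → ℕ) (H : Fin k → RootedGraph), IsDecomposition M z a H := by
  classical
  obtain ⟨l, hl, hR, hind⟩ := h
  have hex := fun x => hl.exists_dsc 0 x (Nat.zero_le _)
  -- The ancestor of level zero. It is constant along edges, since marked vertices are not adjacent,
  -- and so it names the component.
  choose rt hrt0 hrt using hex
  have huniq : ∀ {b x}, l b = 0 → Dsc M.graph l b x → rt x = b := fun hb hx =>
    hl.dsc_unique (hrt _) hx (by rw [hrt0, hb])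
  have hadj : ∀ {u v}, M.graph.Adj u v → rt u = rt v := by
    intro u v huv
    refine (huniq (hrt0 u) ?_).symm
    rcases hl.dsc_adj (hrt u) huv with h1 | h1
    · exact h1
    · have h2 := hl.le_succ huv.symm
      have h3 : l u = 0 := by rw [h1]; exact hrt0 u
      have h4 : l v ≠ 0 := fun h4 => hind u v huv ((hR u).1 h3) ((hR v).1 h4)
      rw [← h1]
      exact .single ⟨huv.symm, by omega⟩
  have hself : ∀ {ρ}, l ρ = 0 → rt ρ = ρ := fun hρ => huniq hρ .refl
  let comp : M.V → Set M.V := fun ρ => {v | rt v = ρ}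
  let K : M.V → RootedGraph := fun v =>
    ⟨comp (rt v), M.graph.induce (comp (rt v)), ⟨rt v, hself (hrt0 v)⟩⟩
  have hK : ∀ v, IsRootedTree (K v).graph (K v).root := by
    intro v
    refine ⟨fun x => l x.1, ⟨fun {x y} h => hl.le_succ h, ?_,
      fun {x y z} h h' e e' => Subtype.ext (hl.parent_unique h h' e e'),
      fun {x y z} h => hl.parent_adj h,
      fun {x y z} h h' e e' hne => hl.trans h h' e e' fun h0 => hne (Subtype.ext h0)⟩, fun x => ?_⟩
    · intro x hx
      obtain ⟨p, hp, hpl⟩ := hl.exists_parent hx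
      exact ⟨⟨p, (hadj hp).symm.trans x.2⟩, hp, hpl⟩
    · constructor
      · intro hx
        exact Subtype.ext ((hself hx).symm.trans x.2)
      · rintro rfl
        exact hrt0 v
  -- Roots of one-vertex components, which are counted by `z`; the remaining roots are grouped below
  -- by the isomorphism class of their rooted component.
  let Z0 := {ρ : M.V // l ρ = 0 ∧ ∀ v, rt v = ρ → v = ρ}
  let Z1 := {ρ : M.V // l ρ = 0 ∧ ∃ v, rt v = ρ ∧ v ≠ ρ}
  let s : Setoid Z1 :=
    { r := fun ρ σ => ∃ φ : (K ρ.1).graph ≃g (K σ.1).graph, φ (K ρ.1).root = (K σ.1).root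
      iseqv := ⟨fun ρ => ⟨SimpleGraph.Iso.refl, rfl⟩,
        fun ⟨φ, hφ⟩ => ⟨φ.symm, by rw [← hφ, φ.symm_apply_apply]⟩,
        fun ⟨φ, hφ⟩ ⟨ψ, hψ⟩ => ⟨φ.trans ψ, by rw [← hψ, ← hφ]; rfl⟩⟩ }
  let eQ : Fin (Fintype.card (Quotient s)) ≃ Quotient s := (Fintype.equivFin _).symm
  let e0 : Fin (Fintype.card Z0) ≃ Z0 := (Fintype.equivFin _).symm
  let F : Quotient s → Type := fun q => {ρ : Z1 // Quotient.mk s ρ = q}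
  let f : ∀ i, Fin (Fintype.card (F (eQ i))) ≃ F (eQ i) := fun i => (Fintype.equivFin _).symm
  let H : Fin (Fintype.card (Quotient s)) → RootedGraph := fun i => K (eQ i).out.1
  have hφ : ∀ i m, ∃ φ : (H i).graph ≃g (K (f i m).1.1).graph,
      φ (H i).root = (K (f i m).1.1).root := by
    intro i m
    have h1 : Quotient.mk s (eQ i).out = Quotient.mk s (f i m).1 :=
      (Quotient.out_eq _).trans (f i m).2.symm
    exact Quotient.exact h1
  choose φ hφr using hφ
  let ψ : (rootedSum (Fintype.card Z0) (fun i => Fintype.card (F (eQ i))) H).V → M.V :=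
    Sum.elim (fun j => (e0 j).1) fun p => (φ p.1 p.2.1 p.2.2).1
  have hψ0 : ∀ j, ψ (Sum.inl j) = (e0 j).1 := fun _ => rfl
  have hψ1 : ∀ i m x, ψ (Sum.inr ⟨i, m, x⟩) = (φ i m x).1 := fun _ _ _ => rfl
  have hrt1 : ∀ i m x, rt (φ i m x).1 = (f i m).1.1 := fun i m x =>
    (φ i m x).2.trans (hself (f i m).1.2.1)
  have hrt0' : ∀ j, rt (e0 j).1 = (e0 j).1 := fun j => hself (e0 j).2.1
  have hdisj : ∀ (ρ : Z0) (σ : Z1), ρ.1 ≠ σ.1 := by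
    rintro ⟨ρ, hρ, hρ'⟩ ⟨σ, hσ, v, hv, hv'⟩ e
    dsimp only at e
    subst e
    exact hv' (hρ' v hv)
  have hinj : Function.Injective ψ := by
    rintro (j | ⟨i, m, x⟩) (j' | ⟨i', m', x'⟩) e
    · exact congrArg Sum.inl (e0.injective (Subtype.ext e))
    · have h1 := congrArg rt e
      rw [hψ0, hψ1, hrt1, hrt0'] at h1
      exact absurd h1 (hdisj _ _)
    · have h1 := congrArg rt e
      rw [hψ0, hψ1, hrt1, hrt0'] at h1
      exact absurd h1.symm (hdisj _ _)
    · have h1 := congrArg rt e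
      rw [hψ1, hψ1, hrt1, hrt1] at h1
      have h2 : (f i m).1 = (f i' m').1 := Subtype.ext h1
      have h3 : i = i' := eQ.injective (by rw [← (f i m).2, ← (f i' m').2, h2])
      subst h3
      have h4 : m = m' := (f i).injective (Subtype.ext h2)
      subst h4
      rw [hψ1, hψ1] at e
      have h5 : x = x' := (φ i m).injective (Subtype.ext e)
      rw [h5]
  have hsurj : Function.Surjective ψ := by
    intro v
    by_cases hv : ∀ w, rt w = rt v → w = rt v
    · refine ⟨Sum.inl (e0.symm ⟨rt v, hrt0 v, hv⟩), ?_⟩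
      rw [hψ0, Equiv.apply_symm_apply]
      exact (hv v rfl).symm
    · push Not at hv
      let ρ : Z1 := ⟨rt v, hrt0 v, hv⟩
      obtain ⟨i, hi⟩ := eQ.surjective (Quotient.mk s ρ)
      obtain ⟨m, hm⟩ := (f i).surjective ⟨ρ, hi.symm⟩
      have hm' : (f i m).1.1 = rt v := by rw [hm]
      have hv' : rt v = rt (f i m).1.1 := by rw [hm', hself (hrt0 v)]
      obtain ⟨x, hx⟩ := (φ i m).surjective ⟨v, hv'⟩
      exact ⟨Sum.inr ⟨i, m, x⟩, by rw [hψ1, hx]⟩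
  have hψadj : ∀ p q, M.graph.Adj (ψ p) (ψ q) ↔
      (rootedSum (Fintype.card Z0) (fun i => Fintype.card (F (eQ i))) H).graph.Adj p q := by
    intro p q
    constructor
    · intro hpq
      have h1 := hadj hpq
      have h0 : ∀ j v, ¬M.graph.Adj (e0 j).1 v := by
        intro j v hv
        have h2 := (e0 j).2.2 v ((hadj hv).symm.trans (hrt0' j))
        exact hv.ne h2.symm
      rcases p with j | ⟨i, m, x⟩
      · exact absurd hpq (h0 j _)
      · rcases q with j' | ⟨i', m', x'⟩
        · exact absurd hpq.symm (h0 j' _)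
        · rw [hψ1, hψ1, hrt1, hrt1] at h1
          have h2 : (f i m).1 = (f i' m').1 := Subtype.ext h1
          have h3 : i = i' := eQ.injective (by rw [← (f i m).2, ← (f i' m').2, h2])
          subst h3
          have h4 : m = m' := (f i).injective (Subtype.ext h2)
          subst h4
          exact ⟨i, m, x, x', rfl, rfl, (φ i m).map_adj_iff.1 hpq⟩
    · rintro ⟨i, m, x, y, rfl, rfl, hxy⟩
      exact (φ i m).map_adj_iff.2 hxy
  have hψmarks : ∀ p, ψ p ∈ M.marks ↔ p ∈
      (rootedSum (Fintype.card Z0) (fun i => Fintype.card (F (eQ i))) H).marks := by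
    rintro (j | ⟨i, m, x⟩)
    · exact iff_of_true ((hR _).1 (e0 j).2.1) (inl_mem_marks j)
    · rw [← hR]
      refine Iff.trans ?_ sumVert_mem_marks.symm
      rw [← (φ i m).injective.eq_iff, hφr, hψ1]
      constructor
      · intro h1
        exact Subtype.ext ((hself h1).symm.trans (φ i m x).2)
      · intro h1
        rw [h1]
        exact hrt0 _
  let Ψ : (rootedSum (Fintype.card Z0) (fun i => Fintype.card (F (eQ i))) H).graph ≃g M.graph :=
    ⟨Equiv.ofBijective ψ ⟨hinj, hsurj⟩, fun {p q} => hψadj p q⟩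
  refine ⟨Fintype.card Z0, _, fun i => Fintype.card (F (eQ i)), H,
    ⟨⟨Ψ.symm, fun x => ?_⟩, fun i => ?_, fun i => ?_, fun i => (hK _).connected,
      fun i => (hK _).isBlockGraph, fun i j hij => ?_⟩⟩
  · rw [← hψmarks]
    exact iff_of_eq (congrArg (· ∈ M.marks) (Ψ.apply_symm_apply x))
  · exact Fintype.card_pos_iff.2 ⟨⟨(eQ i).out, Quotient.out_eq _⟩⟩
  · obtain ⟨v, hv, hne⟩ := (eQ i).out.2.2
    have hs := hself (eQ i).out.2.1
    exact ⟨⟨v, hv.trans hs.symm⟩, ⟨(eQ i).out.1, rfl⟩, fun e => hne (congrArg Subtype.val e)⟩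
  · intro h1
    have h2 : Quotient.mk s (eQ i).out = Quotient.mk s (eQ j).out := Quotient.sound h1
    rw [Quotient.out_eq, Quotient.out_eq] at h2
    exact hij (eQ.injective h2)

end Decomposition

/-! ### Isomorphisms between free products and free wreath products -/

section Congruence

theorem tmap_comp_comp {A B C A' B' C' : Type} [Ring A] [StarRing A] [Algebra ℂ A]
    [StarModule ℂ A] [Ring B] [StarRing B] [Algebra ℂ B] [StarModule ℂ B]
    [Ring C] [StarRing C] [Algebra ℂ C] [StarModule ℂ C]
    [Ring A'] [StarRing A'] [Algebra ℂ A'] [StarModule ℂ A']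
    [Ring B'] [StarRing B'] [Algebra ℂ B'] [StarModule ℂ B']
    [Ring C'] [StarRing C'] [Algebra ℂ C'] [StarModule ℂ C']
    (f : B →⋆ₐ[ℂ] C) (f' : B' →⋆ₐ[ℂ] C') (g : A →⋆ₐ[ℂ] B) (g' : A' →⋆ₐ[ℂ] B')
    (x : A ⊗[ℂ] A') : tmap f f' (tmap g g' x) = tmap (f.comp g) (f'.comp g') x := by
  induction x using TensorProduct.induction_on with
  | zero => simp
  | tmul a b => rfl
  | add x y hx hy => simp only [map_add, hx, hy]

/-- The unit of a unital `*`-algebra. -/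
def scalarHom (B : Type) [Ring B] [StarRing B] [Algebra ℂ B] [StarModule ℂ B] : ℂ →⋆ₐ[ℂ] B where
  toAlgHom := Algebra.ofId ℂ B
  map_star' c := algebraMap_star_comm (A := B) c

theorem complex_hom_ext {B : Type} [Ring B] [StarRing B] [Algebra ℂ B] [StarModule ℂ B]
    (f g : ℂ →⋆ₐ[ℂ] B) : f = g :=
  StarAlgHom.ext fun c => by
    have hf := AlgHomClass.commutes f c
    have hg := AlgHomClass.commutes g c
    exact hf.trans hg.symm

/-- Compatibility with the comultiplications is automatic, because there is only one morphism from ℂ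
to any algebra. -/
theorem iso_trivialQPG {Q : QPG} (ε : Q.carrier →⋆ₐ[ℂ] ℂ)
    (h : ∀ a, scalarHom Q.carrier (ε a) = a) : Q.Iso trivialQPG := by
  refine QPG.iso_of_inverse (R := trivialQPG) ε (scalarHom Q.carrier) h (fun c => ?_) fun a => ?_
  · exact AlgHomClass.commutes ε c
  · have h1 : ∀ c : ℂ, trivialQPG.comul (ε (scalarHom Q.carrier c)) =
        tmap ε ε (Q.comul (scalarHom Q.carrier c)) := fun c =>
      DFunLike.congr_fun (complex_hom_ext
        ((trivialQPG.comul.comp ε).comp (scalarHom Q.carrier))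
        (((tmap ε ε).comp Q.comul).comp (scalarHom Q.carrier))) c
    have h2 := h1 (ε a)
    rwa [h] at h2

theorem freeProd_congr {ι : Type} [Fintype ι] {Q R : ι → QPG} (h : ∀ i, (Q i).Iso (R i)) :
    (freeProd Q).Iso (freeProd R) := by
  choose f g hgf hfg hf _ using fun i => (h i).exists_inverse
  let F : Univ (freeRel Q) →⋆ₐ[ℂ] Univ (freeRel R) :=
    freeLift Q fun i => (freeIncl R i).comp (f i)
  let F' : Univ (freeRel R) →⋆ₐ[ℂ] Univ (freeRel Q) :=
    freeLift R fun i => (freeIncl Q i).comp (g i)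
  refine QPG.iso_of_inverse (Q := freeProd Q) (R := freeProd R) F F' ?_ ?_ ?_
  · refine DFunLike.congr_fun (freeProd_hom_ext Q (f := F'.comp F) (g := StarAlgHom.id ℂ _)
      fun i a => ?_)
    exact congrArg (freeIncl Q i) (hgf i a)
  · refine DFunLike.congr_fun (freeProd_hom_ext R (f := F.comp F') (g := StarAlgHom.id ℂ _)
      fun i a => ?_)
    exact congrArg (freeIncl R i) (hfg i a)
  · refine DFunLike.congr_fun (freeProd_hom_ext Q (f := (freeComul R).comp F)
      (g := (tmap F F).comp (freeComul Q)) fun i a => ?_)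
    change freeComul R (freeIncl R i (f i a)) = tmap F F (freeComul Q (freeIncl Q i a))
    rw [freeComul_incl, freeComul_incl, hf, ← tmap_comp, ← tmap_comp]
    rfl

theorem freeProd₂_congr {Q Q' R R' : QPG} (h : Q.Iso Q') (h' : R.Iso R') :
    (freeProd₂ Q R).Iso (freeProd₂ Q' R') :=
  freeProd_congr fun b => match b with
    | true => h
    | false => h'

theorem freeProd_iso_trivial {ι : Type} [Fintype ι] [IsEmpty ι] (Q : ι → QPG) :
    (freeProd Q).Iso trivialQPG := by
  refine iso_trivialQPG (Q := freeProd Q) (freeLift Q fun i => isEmptyElim i) ?_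
  exact DFunLike.congr_fun (freeProd_hom_ext Q
    (f := (scalarHom (Univ (freeRel Q))).comp (freeLift Q fun i => isEmptyElim i))
    (g := StarAlgHom.id ℂ _) fun i => isEmptyElim i)

theorem freeProd_succ_iso {k : ℕ} (Q : Fin (k + 1) → QPG) :
    (freeProd Q).Iso (freeProd₂ (Q 0) (freeProd fun i : Fin k => Q i.succ)) := by
  let T : Fin k → QPG := fun i => Q i.succ
  let F : Univ (freeRel Q) →⋆ₐ[ℂ] (freeProd₂ (Q 0) (freeProd T)).carrier :=
    freeLift Q fun i => Fin.cases (motive := fun i => (Q i).carrier →⋆ₐ[ℂ] _)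
      (inclL (Q 0) (freeProd T)) (fun i => (inclR (Q 0) (freeProd T)).comp (freeIncl T i)) i
  let F' : (freeProd₂ (Q 0) (freeProd T)).carrier →⋆ₐ[ℂ] Univ (freeRel Q) :=
    freeLift₂ (R := freeProd T) (freeIncl Q 0) (freeLift T fun i => freeIncl Q i.succ)
  refine QPG.iso_of_inverse (Q := freeProd Q) F F' ?_ ?_ ?_
  · refine DFunLike.congr_fun (freeProd_hom_ext Q (f := F'.comp F) (g := StarAlgHom.id ℂ _)
      fun i => ?_)
    refine Fin.cases (motive := fun i => ∀ a : (Q i).carrier,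
      (F'.comp F) (freeIncl Q i a) = StarAlgHom.id ℂ _ (freeIncl Q i a)) ?_ ?_ i
    · exact fun a => rfl
    · exact fun i a => rfl
  · refine DFunLike.congr_fun (freeProd₂_hom_ext (f := F.comp F') (g := StarAlgHom.id ℂ _)
      (fun a => rfl) ?_)
    exact DFunLike.congr_fun (freeProd_hom_ext T
      (f := (F.comp F').comp (inclR (Q 0) (freeProd T))) (g := inclR (Q 0) (freeProd T))
      fun i a => rfl)
  · refine DFunLike.congr_fun (freeProd_hom_ext Q
      (f := (freeProd₂ (Q 0) (freeProd T)).comul.comp F)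
      (g := (tmap F F).comp (freeComul Q)) fun i => ?_)
    refine Fin.cases (motive := fun i => ∀ a : (Q i).carrier,
      ((freeProd₂ (Q 0) (freeProd T)).comul.comp F) (freeIncl Q i a) =
        ((tmap F F).comp (freeComul Q)) (freeIncl Q i a)) ?_ ?_ i
    · intro a
      change tmap (inclL (Q 0) (freeProd T)) (inclL (Q 0) (freeProd T)) ((Q 0).comul a) =
        tmap F F (tmap (freeIncl Q 0) (freeIncl Q 0) ((Q 0).comul a))
      rw [tmap_comp_comp]
      rfl
    · intro i a
      change tmap (inclR (Q 0) (freeProd T)) (inclR (Q 0) (freeProd T))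
        (tmap (freeIncl T i) (freeIncl T i) ((T i).comul a)) =
        tmap F F (tmap (freeIncl Q i.succ) (freeIncl Q i.succ) ((T i).comul a))
      rw [tmap_comp_comp]
      exact tmap_comp_comp (inclR (Q 0) (freeProd T)) (inclR (Q 0) (freeProd T)) (freeIncl T i)
        (freeIncl T i) ((T i).comul a)

theorem freeProd₂_trivial_iso (R : QPG) : (freeProd₂ trivialQPG R).Iso R := by
  let F' : (freeProd₂ trivialQPG R).carrier →⋆ₐ[ℂ] R.carrier :=
    freeLift₂ (Q := trivialQPG) (scalarHom R.carrier) (StarAlgHom.id ℂ _)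
  refine (QPG.iso_of_inverse (Q := R) (R := freeProd₂ trivialQPG R) (inclR trivialQPG R) F'
    (fun _ => rfl) ?_ fun _ => rfl).symm
  refine DFunLike.congr_fun (freeProd₂_hom_ext (f := (inclR trivialQPG R).comp F')
    (g := StarAlgHom.id ℂ _) ?_ fun _ => rfl)
  exact DFunLike.congr_fun (complex_hom_ext
    (((inclR trivialQPG R).comp F').comp (inclL trivialQPG R)) (inclL trivialQPG R))

theorem freeProd₂_comm_iso (Q R : QPG) : (freeProd₂ Q R).Iso (freeProd₂ R Q) := by
  refine QPG.iso_of_inverse (freeLift₂ (inclR R Q) (inclL R Q)) (freeLift₂ (inclR Q R) (inclL Q R))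
    ?_ ?_ ?_
  · exact DFunLike.congr_fun (freeProd₂_hom_ext
      (f := (freeLift₂ (inclR Q R) (inclL Q R)).comp (freeLift₂ (inclR R Q) (inclL R Q)))
      (g := StarAlgHom.id ℂ _) (fun _ => rfl) fun _ => rfl)
  · exact DFunLike.congr_fun (freeProd₂_hom_ext
      (f := (freeLift₂ (inclR R Q) (inclL R Q)).comp (freeLift₂ (inclR Q R) (inclL Q R)))
      (g := StarAlgHom.id ℂ _) (fun _ => rfl) fun _ => rfl)
  · refine DFunLike.congr_fun (freeProd₂_hom_ext
      (f := (freeProd₂ R Q).comul.comp (freeLift₂ (inclR R Q) (inclL R Q)))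
      (g := (tmap (freeLift₂ (inclR R Q) (inclL R Q)) (freeLift₂ (inclR R Q) (inclL R Q))).comp
        (freeProd₂ Q R).comul) (fun a => ?_) fun a => ?_)
    · change _ = tmap _ _ (tmap (inclL Q R) (inclL Q R) (Q.comul a))
      rw [tmap_comp_comp]
      rfl
    · change _ = tmap _ _ (tmap (inclR Q R) (inclR Q R) (R.comul a))
      rw [tmap_comp_comp]
      rfl

theorem freeProd₂_trivial_right_iso (Q : QPG) : (freeProd₂ Q trivialQPG).Iso Q :=
  (freeProd₂_comm_iso _ _).trans (freeProd₂_trivial_iso Q)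

theorem freeProd_one_iso (Q : Fin 1 → QPG) : (freeProd Q).Iso (Q 0) :=
  (freeProd_succ_iso Q).trans ((freeProd₂_congr (.refl _) (freeProd_iso_trivial _)).trans
    (freeProd₂_trivial_right_iso _))

theorem freeProd_two_iso (Q : Fin 2 → QPG) : (freeProd Q).Iso (freeProd₂ (Q 0) (Q 1)) :=
  (freeProd_succ_iso Q).trans (freeProd₂_congr (.refl _) (freeProd_one_iso _))

theorem freeWreath_congr {Q R : QPG} (d : ℕ) (h : Q.Iso R) :
    (freeWreath Q d).Iso (freeWreath R d) := by
  obtain ⟨f, g, hgf, hfg, hf, -⟩ := h.exists_inverse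
  let F : WreathAlg Q d →⋆ₐ[ℂ] WreathAlg R d :=
    wreathLift Q d (fun i => (wreathIncl R d i).comp f) (wreathPerm R d) (isMagic_wreathPerm R d)
      fun i j a => commute_wreath R d i j (f a)
  let F' : WreathAlg R d →⋆ₐ[ℂ] WreathAlg Q d :=
    wreathLift R d (fun i => (wreathIncl Q d i).comp g) (wreathPerm Q d) (isMagic_wreathPerm Q d)
      fun i j a => commute_wreath Q d i j (g a)
  have hF : ∀ i j, F (wreathPerm Q d i j) = wreathPerm R d i j := fun _ _ => rfl
  have hF1 : ∀ i, F.comp (wreathIncl Q d i) = (wreathIncl R d i).comp f := fun _ => rfl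
  refine QPG.iso_of_inverse (Q := freeWreath Q d) (R := freeWreath R d) F F' ?_ ?_ ?_
  · refine DFunLike.congr_fun (wreath_hom_ext Q d (f := F'.comp F) (g := StarAlgHom.id ℂ _)
      (fun i a => ?_) fun i j => rfl)
    exact congrArg (wreathIncl Q d i) (hgf a)
  · refine DFunLike.congr_fun (wreath_hom_ext R d (f := F.comp F') (g := StarAlgHom.id ℂ _)
      (fun i a => ?_) fun i j => rfl)
    exact congrArg (wreathIncl R d i) (hfg a)
  · refine DFunLike.congr_fun (wreath_hom_ext Q d (f := (wreathComul R d).comp F)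
      (g := (tmap F F).comp (wreathComul Q d)) (fun i a => ?_) fun i j => ?_)
    · change wreathComul R d (wreathIncl R d i (f a)) =
        tmap F F (wreathComul Q d (wreathIncl Q d i a))
      rw [wreathComul_incl, wreathComul_incl, map_sum]
      refine Finset.sum_congr rfl fun k _ => ?_
      rw [map_mul, tmap_tmul, map_one, hF, tmap_comp_comp, hF1, hF1, hf, tmap_comp_comp]
    · change wreathComul R d (wreathPerm R d i j) = tmap F F (wreathComul Q d (wreathPerm Q d i j))
      rw [wreathComul_perm, wreathComul_perm, tmap_coprod]
      rfl

theorem freeWreath_one_iso (Q : QPG) : (freeWreath Q 1).Iso Q := by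
  have h1 : IsMagic fun _ _ : Fin 1 => (1 : Q.carrier) := by
    refine ⟨?_, ?_, ?_, ?_, ?_, ?_⟩
    · simp
    · simp
    · exact fun i j k h => absurd (Subsingleton.elim j k) h
    · exact fun i j k h => absurd (Subsingleton.elim i k) h
    · simp
    · simp
  have hs : ∀ i j, wreathPerm Q 1 i j = 1 := by
    intro i j
    have := (isMagic_wreathPerm Q 1).row_sum i
    rwa [Fin.sum_univ_one, Subsingleton.elim 0 j] at this
  let F' : WreathAlg Q 1 →⋆ₐ[ℂ] Q.carrier :=
    wreathLift Q 1 (fun _ => StarAlgHom.id ℂ _) (fun _ _ => 1) h1 fun _ _ a => Commute.one_right a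
  refine (QPG.iso_of_inverse (Q := Q) (R := freeWreath Q 1) (wreathIncl Q 1 0) F' (fun _ => rfl)
    ?_ fun a => ?_).symm
  · refine DFunLike.congr_fun (wreath_hom_ext Q 1 (f := (wreathIncl Q 1 0).comp F')
      (g := StarAlgHom.id ℂ _) (fun i a => ?_) fun i j => ?_)
    · rw [Subsingleton.elim i 0]
      rfl
    · change wreathIncl Q 1 0 1 = wreathPerm Q 1 i j
      rw [hs, map_one]
  · change wreathComul Q 1 (wreathIncl Q 1 0 a) = _
    rw [wreathComul_incl, Fin.sum_univ_one, hs]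
    exact one_mul _

theorem isAdapted_bot {n : ℕ} {B : Type} [Ring B] [StarRing B] {s : Fin n → Fin n → B}
    (hs : IsMagic s) : IsAdapted (⊥ : SimpleGraph (Fin n)) ∅ s :=
  isAdapted_iff.2 ⟨hs, fun _ _ _ _ h => absurd Iff.rfl h, fun _ _ h => absurd Iff.rfl h⟩

theorem SPlus_iso_freeWreath (n : ℕ) : (SPlus n).Iso (freeWreath trivialQPG n) := by
  have hs := isMagic_wreathPerm trivialQPG n
  let F : Univ (stabRel (⊥ : SimpleGraph (Fin n)) ∅) →⋆ₐ[ℂ] WreathAlg trivialQPG n :=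
    adaptedLift (isAdapted_bot hs)
  let F' : WreathAlg trivialQPG n →⋆ₐ[ℂ] Univ (stabRel (⊥ : SimpleGraph (Fin n)) ∅) :=
    wreathLift trivialQPG n (fun _ => scalarHom _) (fun i j => Univ.of _ (i, j))
      (isAdapted_of _ _).magic fun _ _ c => Algebra.commutes (R := ℂ) c _
  refine QPG.iso_of_inverse (Q := SPlus n) (R := freeWreath trivialQPG n) F F' ?_ ?_ ?_
  · exact DFunLike.congr_fun (Univ.hom_ext (f := F'.comp F) (g := StarAlgHom.id ℂ _) fun _ => rfl)
  · exact DFunLike.congr_fun (wreath_hom_ext trivialQPG n (f := F.comp F')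
      (g := StarAlgHom.id ℂ _) (fun i => DFunLike.congr_fun (complex_hom_ext
        ((F.comp F').comp (wreathIncl trivialQPG n i)) (wreathIncl trivialQPG n i)))
      fun _ _ => rfl)
  · refine DFunLike.congr_fun (Univ.hom_ext (f := (wreathComul trivialQPG n).comp F)
      (g := (tmap F F).comp (SPlus n).comul) fun p => ?_)
    exact (tmap_coprod F (fun x y => Univ.of (stabRel (⊥ : SimpleGraph (Fin n)) ∅) (x, y))
      p.1 p.2).symm

theorem SPlus_zero_iso : (SPlus 0).Iso trivialQPG := by
  have hm : IsMagic fun i _ : Fin 0 => (i.elim0 : ℂ) :=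
    ⟨fun i => i.elim0, fun i => i.elim0, fun i => i.elim0, fun i => i.elim0, fun i => i.elim0,
      fun i => i.elim0⟩
  refine iso_trivialQPG (Q := SPlus 0) (adaptedLift (isAdapted_bot hm)) ?_
  exact DFunLike.congr_fun (Univ.hom_ext (P := stabRel (⊥ : SimpleGraph (Fin 0)) ∅)
    (f := (scalarHom _).comp (adaptedLift (isAdapted_bot hm)))
    (g := StarAlgHom.id ℂ _) fun p => p.1.elim0)

end Congruence

/-! ### Closure of `Jor⁺` under finite free products -/

section JorPlusClosure

variable {F : QPG → Prop}

theorem JorPlus.finiteFreeProd (h0 : JorPlus F trivialQPG) {k : ℕ} :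
    ∀ {Q : Fin k → QPG}, (∀ i, JorPlus F (Q i)) → JorPlus F (QBlock.freeProd Q) := by
  induction k with
  | zero => exact fun {Q} _ => .iso _ _ (freeProd_iso_trivial Q).symm h0
  | succ k ih =>
    exact fun {Q} h => .iso _ _ (freeProd_succ_iso Q).symm
      (.freeProd _ _ (h 0) (ih fun i => h i.succ))

theorem JorPlus.SPlus (h0 : JorPlus F trivialQPG) (n : ℕ) : JorPlus F (QBlock.SPlus n) := by
  rcases Nat.eq_zero_or_pos n with rfl | hn
  · exact .iso _ _ SPlus_zero_iso.symm h0
  · exact .iso _ _ (SPlus_iso_freeWreath n).symm (.freeWreath _ n hn h0)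

end JorPlusClosure

open IsLevel

/-! ### Quantum automorphism groups of block graphs belong to `Jor⁺` -/

section ToJorPlus

variable {M : MarkedGraph} {z k : ℕ} {a : Fin k → ℕ} {H : Fin k → RootedGraph}

/-- One copy of `H i` embeds with only its root marked. The number of unmarked vertices is the
measure of the induction below. -/
theorem IsDecomposition.card_le [Fintype M.V] (h : IsDecomposition M z a H) (i : Fin k) :
    Nat.card {x // x ≠ (H i).root} ≤ Nat.card {x // x ∉ M.marks} := by
  obtain ⟨φ, hφ⟩ := h.iso
  let m : Fin (a i) := ⟨0, h.pos i⟩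
  refine Nat.card_le_card_of_injective
    (fun x => ⟨φ.symm (sumVert z a H i m x.1), fun hx => x.2 ?_⟩) fun x y hxy => ?_
  · rw [← hφ, φ.apply_symm_apply] at hx
    exact sumVert_mem_marks.1 hx
  · have h1 := φ.symm.injective (congrArg Subtype.val hxy)
    exact Subtype.ext ((sumEmb z a H i m).injective h1)

/-- After a cut at the root, each copy of the root lies in at most one block; this is what allows
the edges between its neighbours to be erased in the induction. -/
theorem IsDecomposition.isClique_of_psiCut {V : Type} {G : SimpleGraph V} {r : V}
    (hG : IsRootedTree G r) (h : IsDecomposition (psiCut G r) z a H) (i : Fin k) {u v : (H i).V}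
    (hu : (H i).graph.Adj u (H i).root) (hv : (H i).graph.Adj v (H i).root) (huv : u ≠ v) :
    (H i).graph.Adj u v := by
  obtain ⟨φ, hφ⟩ := h.iso
  let m : Fin (a i) := ⟨0, h.pos i⟩
  have hinj : ∀ x y, φ.symm (sumVert z a H i m x) = φ.symm (sumVert z a H i m y) → x = y :=
    fun x y e => (sumEmb z a H i m).injective (φ.symm.injective e)
  have hadj : ∀ x y, (psiCut G r).graph.Adj (φ.symm (sumVert z a H i m x))
      (φ.symm (sumVert z a H i m y)) ↔ (H i).graph.Adj x y := fun x y => by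
    rw [φ.symm.map_adj_iff, rootedSum_adj_same]
    simp
  rw [← hadj]
  refine psiCut_adj_of_adj hG (ρ := φ.symm (sumVert z a H i m (H i).root)) ?_ ((hadj _ _).2 hu)
    ((hadj _ _).2 hv) fun e => huv (hinj _ _ e)
  rw [← hφ, φ.apply_symm_apply]
  exact sumVert_mem_marks.2 rfl

theorem card_psiCut_le {V : Type} [Fintype V] (G : SimpleGraph V) (r : V) :
    Nat.card {x // x ∉ (psiCut G r).marks} ≤ Nat.card {x // x ≠ r} := by
  refine Nat.card_le_card_of_injective (fun x => ⟨x.1.1.2, x.2⟩) fun x y hxy => ?_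
  have h1 : x.1.1.2 = y.1.1.2 := congrArg Subtype.val hxy
  refine Subtype.ext (Subtype.ext (Prod.ext ?_ h1))
  rw [← x.1.2 x.2, ← y.1.2 y.2]
  congr 2

theorem IsDecomposition.jorPlus [Fintype M.V] {F : QPG → Prop} (h0 : JorPlus F trivialQPG)
    (h : IsDecomposition M z a H) (hH : ∀ i, JorPlus F (quFix (H i).graph (H i).root)) :
    JorPlus F (quStab M.graph M.marks) :=
  .iso _ _ h.quStab_iso.symm (.freeProd _ _ (.SPlus h0 z)
    (.finiteFreeProd h0 fun i => .freeWreath _ _ (h.pos i) (hH i)))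

/-- Each round decomposes the forest into trees, cuts a tree at its root and decomposes again, so
that the neighbours of each root form a clique. Then the root is deleted, its neighbours are marked
and the edges between them are erased. The result is a forest again, and newly marked neighbours
make the number of unmarked vertices drop. -/
theorem jorPlus_quStab_of_card_lt {F : QPG → Prop} (h0 : JorPlus F trivialQPG) (n : ℕ) :
    ∀ (M : MarkedGraph) [Fintype M.V], IsRootedForest M → Nat.card {x // x ∉ M.marks} < n →
      JorPlus F (quStab M.graph M.marks) := by
  induction n with
  | zero => exact fun M _ _ h => absurd h (Nat.not_lt_zero _)
  | succ n ih =>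
    intro M _ hM hn
    obtain ⟨z, k, a, H, hD⟩ := exists_isDecomposition hM
    refine hD.jorPlus h0 fun i => ?_
    have hT := hD.isRootedTree i
    refine .iso _ _ (quFix_iso_psiCut hT.connected _).symm ?_
    obtain ⟨z', k', a', H', hD'⟩ := exists_isDecomposition (isRootedForest_psiCut hT)
    refine hD'.jorPlus h0 fun j => ?_
    obtain ⟨l, hl, hr⟩ := hD'.isRootedTree j
    obtain ⟨hl', hr'⟩ := isLevel_induce hl hr
    set N : Set ({(H' j).root}ᶜ : Set (H' j).V) := {x | (H' j).graph.Adj x (H' j).root} with hN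
    have hclique : ((H' j).graph.induce {(H' j).root}ᶜ).IsClique N := by
      intro x hx y hy hxy
      exact hD'.isClique_of_psiCut hT j hx hy fun e => hxy (Subtype.ext e)
    refine .iso _ _ (quFix_iso_quStab_induce (H' j).graph (H' j).root).symm
      (.iso _ _ (quStab_iso_psiBlock hclique).symm ?_)
    -- Decomposing and cutting do not increase the number of unmarked vertices. The strict decrease
    -- comes from a neighbour `b` of the root, which exists because `H' j` has a second vertex.
    have hlt : Nat.card {x : ({(H' j).root}ᶜ : Set (H' j).V) // x ∉ N} < n := by
      have h1 := hD'.card_le j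
      have h2 := card_psiCut_le (H i).graph (H i).root
      have h3 := hD.card_le i
      have h4 : Nat.card {x : ({(H' j).root}ᶜ : Set (H' j).V) // x ∉ N} <
          Nat.card {x // x ≠ (H' j).root} := by
        have := hD'.nontrivial j
        obtain ⟨y, hy⟩ := exists_ne (H' j).root
        obtain ⟨b, hb, hd⟩ := hl.exists_dsc 1 y (Nat.one_le_iff_ne_zero.2 (mt (hr y).1 hy))
        obtain ⟨p, hp, hpl⟩ := hl.exists_parent (v := b) (by omega)
        have hpr : p = (H' j).root := (hr p).1 (by omega)
        rw [hpr] at hp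
        refine Finite.card_subtype_lt (p := fun x : ({(H' j).root}ᶜ : Set (H' j).V) => x ∉ N)
          (x := ⟨b, hp.ne⟩) ?_
        exact fun h => h hp
      omega
    exact @ih (psiBlock ((H' j).graph.induce {(H' j).root}ᶜ) N) (fintypeComplSingleton _)
      (isRootedForest_psiBlock hl' hr') hlt

theorem IsRootedTree.jorPlus {V : Type} [Fintype V] {G : SimpleGraph V} {r : V} {F : QPG → Prop}
    (h0 : JorPlus F trivialQPG) (h : IsRootedTree G r) : JorPlus F (quFix G r) :=
  .iso _ _ (quFix_iso_psiCut h.connected r).symm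
    (jorPlus_quStab_of_card_lt h0 _ _ (isRootedForest_psiCut h) (Nat.lt_succ_self _))

/-- Coning over the centers of all components produces a single rooted tree with the same quantum
group, which also covers disconnected graphs. -/
theorem IsBlockGraph.jorPlus {V : Type} [Fintype V] {G : SimpleGraph V} {F : QPG → Prop}
    (h0 : JorPlus F trivialQPG) (h : IsBlockGraph G) : JorPlus F (qu G) := by
  obtain ⟨l, hl, hc⟩ := h.exists_isLevel_centers
  exact .iso _ _ ((qu_iso_quStab_centers G).trans (quStab_iso_cone G _)).symm
    ((isRootedTree_cone hl hc).jorPlus h0)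

end ToJorPlus

/-! ### Realising elements of `Jor⁺` -/

section Realise

theorem IsLevel.le_add_dist {V : Type} {G : SimpleGraph V} {l : V → ℕ} (h : IsLevel G l) {u v : V}
    (huv : G.Reachable u v) : l v ≤ l u + G.dist u v := by
  obtain ⟨w, hw⟩ := huv.exists_walk_length_eq_dist
  rw [← hw]
  clear hw huv
  induction w with
  | nil => simp
  | cons huv q ih =>
    have := h.le_succ huv.symm
    rw [SimpleGraph.Walk.length_cons]
    omega

/-- If there are vertices of maximal level on two sides of the root, then the root is the only
central vertex. -/
theorem centers_eq_singleton {V : Type} [Fintype V] {G : SimpleGraph V} {r : V} {l : V → ℕ}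
    (hl : IsLevel G l) (hr : ∀ x, l x = 0 ↔ x = r) (side : V → Prop)
    (hside : ∀ u v, G.Adj u v → l u ≠ 0 → l v ≠ 0 → (side u ↔ side v)) (n : ℕ)
    (hn : ∀ x, l x ≤ n) (hpos : ∃ y, side y ∧ l y = n) (hneg : ∃ y, ¬side y ∧ l y = n) :
    centers G = {r} := by
  have hG := hl.connected fun v => (hr v).1
  have hr0 := (hr r).2 rfl
  have hdsc : ∀ y, Dsc G l r y := fun y => by
    obtain ⟨b, hb, hd⟩ := hl.exists_dsc 0 y (Nat.zero_le _)
    rwa [(hr b).1 hb] at hd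
  have hecc : ecc G r ≤ n := ecc_le fun y _ => by
    have := dsc_dist (hdsc y)
    have := hn y
    omega
  have hdscside : ∀ {b y}, Dsc G l b y → l b ≠ 0 → (side b ↔ side y) := by
    intro b y hd hb
    induction hd with
    | refl => rfl
    | tail hd hc ih =>
      have := dsc_level hd
      exact ih.trans (hside _ _ hc.1.symm (by omega) hc.ne_zero)
  have hbr : ∀ {b y}, InBranch G l b y → l b ≠ 0 → (side b ↔ side y) := by
    rintro b y ⟨b', hb', hd⟩ hb
    have hb0 : l b' ≠ 0 := by rwa [← isSib_level hb']
    refine Iff.trans ?_ (hdscside hd hb0)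
    rcases hb' with rfl | h
    · rfl
    · exact hside _ _ h.1 hb hb0
  -- A vertex of level `n` on the side not containing `x` is reached from `x` only through `r`, at
  -- distance at least `n + 1`, whereas `r` has eccentricity at most `n`.
  have key : ∀ x, x ≠ r → n + 1 ≤ ecc G x := by
    intro x hx
    have hx0 : l x ≠ 0 := mt (hr x).1 hx
    obtain ⟨b, hb, hd⟩ := hl.exists_dsc 1 x (by omega)
    have hb0 : l b ≠ 0 := by omega
    have hp := hl.isChild_parent hb0
    rw [(hr (parent G l b)).1 (by have := hp.2; omega)] at hp
    obtain ⟨y, hy, hyn⟩ : ∃ y, ¬(side b ↔ side y) ∧ l y = n := by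
      by_cases hsb : side b
      · obtain ⟨y, hy, hyn⟩ := hneg
        exact ⟨y, fun h => hy (h.1 hsb), hyn⟩
      · obtain ⟨y, hy, hyn⟩ := hpos
        exact ⟨y, fun h => hsb (h.2 hy), hyn⟩
    have h1 := hl.dist_parent_lt hp ⟨b, isSib_refl b, hd⟩ (fun h => hy (hbr h hb0))
      (hG.preconnected x y)
    have h2 := hl.le_add_dist (hG.preconnected r y)
    have h3 := dist_le_ecc (G := G) x y
    omega
  ext x
  rw [Set.mem_singleton_iff]
  constructor
  · intro hx
    by_contra hne
    have := hx r (hG.preconnected x r)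
    have := key x hne
    omega
  · rintro rfl y _
    by_cases hy : y = x
    · rw [hy]
    · have := key y hy
      omega

/-- `Q` is the quantum stabiliser of a vertex of a connected block graph. -/
def IsTreeStabiliser (Q : QPG) : Prop :=
  ∃ H : RootedGraph, IsRootedTree H.graph H.root ∧ Q.Iso (quFix H.graph H.root)

theorem IsTreeStabiliser.of_iso {Q R : QPG} (h : IsTreeStabiliser Q) (hQR : R.Iso Q) :
    IsTreeStabiliser R :=
  let ⟨H, hH, hQ⟩ := h
  ⟨H, hH, hQR.trans hQ⟩

theorem isTreeStabiliser_of_forest {M : MarkedGraph} [Fintype M.V] (hM : IsRootedForest M) :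
    IsTreeStabiliser (quStab M.graph M.marks) :=
  ⟨⟨Option M.V, cone M.graph M.marks, none⟩, hM.isRootedTree_cone, quStab_iso_cone _ _⟩

/-- Lengthening the stem of a rooted graph. -/
theorem IsTreeStabiliser.exists_card {Q : QPG} (h : IsTreeStabiliser Q) (n : ℕ) :
    ∃ H : RootedGraph, IsRootedTree H.graph H.root ∧ Q.Iso (quFix H.graph H.root) ∧
      n < Fintype.card H.V := by
  induction n with
  | zero =>
    obtain ⟨H, hH, hQ⟩ := h
    exact ⟨H, hH, hQ, Fintype.card_pos_iff.2 ⟨H.root⟩⟩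
  | succ n ih =>
    obtain ⟨H, ⟨l, hl, hr⟩, hQ, hn⟩ := ih
    refine ⟨⟨Option H.V, cone H.graph {H.root}, none⟩, isRootedTree_cone hl hr,
      hQ.trans (quStab_iso_cone _ _), ?_⟩
    change n + 1 < Fintype.card (Option H.V)
    rw [Fintype.card_option]
    omega

/-- Rooted paths of every length, which have no quantum symmetries. -/
theorem exists_path (n : ℕ) : ∃ (P : RootedGraph) (l : P.V → ℕ), IsLevel P.graph l ∧
    (∀ x, l x = 0 ↔ x = P.root) ∧ (∀ x, l x ≤ n) ∧ (∃ x, l x = n) ∧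
      (quFix P.graph P.root).Iso trivialQPG := by
  induction n with
  | zero =>
    refine ⟨⟨Unit, ⊥, ()⟩, fun _ => 0, ⟨fun h => h.elim, fun h => absurd rfl h,
      fun h => h.elim, fun h => h.elim, fun h => h.elim⟩, fun _ => iff_of_true rfl rfl,
      fun _ => le_rfl, ⟨(), rfl⟩, ?_⟩
    have hm : IsMagic fun _ _ : Unit => (1 : ℂ) :=
      ⟨by simp, by simp, fun _ _ _ h => absurd rfl h, fun _ _ _ h => absurd rfl h, by simp, by simp⟩
    have hU : IsAdapted (⊥ : SimpleGraph Unit) {()} fun _ _ => (1 : ℂ) :=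
      isAdapted_iff.2 ⟨hm, fun _ _ _ _ h => absurd Iff.rfl h, fun _ _ h => absurd Iff.rfl h⟩
    refine iso_trivialQPG (Q := quFix (⊥ : SimpleGraph Unit) ()) (adaptedLift hU) ?_
    refine DFunLike.congr_fun (Univ.hom_ext (P := stabRel (⊥ : SimpleGraph Unit) {()})
      (f := (scalarHom _).comp (adaptedLift hU)) (g := StarAlgHom.id ℂ _) fun p => ?_)
    have h1 := (isAdapted_of (⊥ : SimpleGraph Unit) {()}).magic.row_sum ()
    rw [Fintype.sum_unique] at h1
    exact (map_one (scalarHom _)).trans h1.symm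
  | succ n ih =>
    obtain ⟨P, l, hl, hr, hn, ⟨y, hy⟩, hP⟩ := ih
    refine ⟨⟨Option P.V, cone P.graph {P.root}, none⟩, coneLevel l, isLevel_cone hl hr,
      fun _ => coneLevel_eq_zero, ?_, ⟨some y, congrArg (· + 1) hy⟩,
      (quStab_iso_cone P.graph {P.root}).symm.trans hP⟩
    rintro (_ | x)
    · exact Nat.zero_le _
    · exact Nat.succ_le_succ (hn x)

/-- The quantum stabiliser of the roots of two non-isomorphic rooted graphs. -/
theorem quStab_rootedSum_two {H : Fin 2 → RootedGraph}
    (hH : ∀ i, IsRootedTree (H i).graph (H i).root) (hn : ∀ i, Nontrivial (H i).V)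
    (hne : ¬∃ φ : (H 0).graph ≃g (H 1).graph, φ (H 0).root = (H 1).root) :
    (quStab (rootedSum 0 (fun _ => 1) H).graph (rootedSum 0 (fun _ => 1) H).marks).Iso
      (freeProd₂ (quFix (H 0).graph (H 0).root) (quFix (H 1).graph (H 1).root)) := by
  choose l hl hr using hH
  have hiso : ∀ i j, i ≠ j →
      ¬∃ φ : (H i).graph ≃g (H j).graph, φ (H i).root = (H j).root := by
    intro i j hij
    fin_cases i <;> fin_cases j
    · exact absurd rfl hij
    · exact hne
    · rintro ⟨φ, hφ⟩
      exact hne ⟨φ.symm, (congrArg φ.symm hφ).symm.trans (φ.symm_apply_apply _)⟩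
    · exact absurd rfl hij
  exact (quStab_iso_of_isLevel hl hr (fun i => (hl i).connected fun v => (hr i v).1) hn hiso).trans
    ((freeProd₂_congr SPlus_zero_iso (freeProd_two_iso _)).trans ((freeProd₂_trivial_iso _).trans
      (freeProd₂_congr (freeWreath_one_iso _) (freeWreath_one_iso _))))

theorem quStab_rootedSum_one {H : Fin 1 → RootedGraph} {d : ℕ}
    (hH : ∀ i, IsRootedTree (H i).graph (H i).root) (hn : ∀ i, Nontrivial (H i).V) :
    (quStab (rootedSum 0 (fun _ => d) H).graph (rootedSum 0 (fun _ => d) H).marks).Iso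
      (freeWreath (quFix (H 0).graph (H 0).root) d) := by
  choose l hl hr using hH
  exact (quStab_iso_of_isLevel hl hr (fun i => (hl i).connected fun v => (hr i v).1) hn
    fun i j hij => absurd (Subsingleton.elim i j) hij).trans
    ((freeProd₂_congr SPlus_zero_iso (freeProd_one_iso _)).trans (freeProd₂_trivial_iso _))

theorem JorPlus.isTreeStabiliser {Q : QPG} (h : JorPlus (fun R => R = trivialQPG) Q) :
    IsTreeStabiliser Q := by
  induction h with
  | base Q hQ =>
    obtain ⟨P, l, hl, hr, -, -, hP⟩ := exists_path 0
    exact ⟨P, ⟨l, hl, hr⟩, hQ ▸ hP.symm⟩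
  | iso Q R hQR _ ih => exact ih.of_iso hQR.symm
  | freeProd Q R _ _ ihQ ihR =>
    obtain ⟨H, hH, hQ, hn⟩ := ihQ.exists_card 1
    -- A long stem makes `K` larger than `H`, so the two rooted graphs are not isomorphic and their
    -- copies cannot be exchanged.
    obtain ⟨K, hK, hR, hn'⟩ := ihR.exists_card (Fintype.card H.V)
    have hT : ∀ i, IsRootedTree (![H, K] i).graph (![H, K] i).root := by
      intro i
      fin_cases i
      · exact hH
      · exact hK
    refine (isTreeStabiliser_of_forest
      (isRootedForest_rootedSum (z := 0) (a := fun _ => 1) hT)).of_iso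
      ((freeProd₂_congr hQ hR).trans (quStab_rootedSum_two hT (fun i => ?_) ?_).symm)
    · fin_cases i
      · exact Fintype.one_lt_card_iff_nontrivial.1 hn
      · exact Fintype.one_lt_card_iff_nontrivial.1 (show 1 < Fintype.card K.V by omega)
    · rintro ⟨φ, -⟩
      exact hn'.ne (Fintype.card_congr φ.toEquiv)
  | freeWreath Q d _ _ ih =>
    obtain ⟨H, hH, hQ, hn⟩ := ih.exists_card 1
    exact (isTreeStabiliser_of_forest
      (isRootedForest_rootedSum (z := 0) (a := fun _ => d) fun _ : Fin 1 => hH)).of_iso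
      ((freeWreath_congr d hQ).trans (quStab_rootedSum_one (fun _ => hH) fun _ =>
        Fintype.one_lt_card_iff_nontrivial.1 hn).symm)

/-- The stabiliser of a vertex of a connected block graph is the quantum automorphism group of a
block graph: a long path forces the vertex to be the center. -/
theorem IsTreeStabiliser.exists_qu {Q : QPG} (h : IsTreeStabiliser Q) :
    ∃ (V : Type) (_ : Fintype V) (G : SimpleGraph V), IsBlockGraph G ∧ Q.Iso (qu G) := by
  obtain ⟨H, ⟨l, hl, hr⟩, hQ, hn⟩ := h.exists_card 1
  have hnt := Fintype.one_lt_card_iff_nontrivial.1 hn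
  obtain ⟨x, -, hx⟩ := Finset.exists_max_image Finset.univ l ⟨H.root, Finset.mem_univ _⟩
  obtain ⟨P, l', hl', hr', hmax, ⟨y, hy⟩, hP⟩ := exists_path (l x)
  -- If `H` is itself the rooted path, the path cannot be attached as a second, different summand;
  -- but then `Q` is trivial and a single vertex realises it.
  by_cases hiso : ∃ φ : H.graph ≃g P.graph, φ H.root = P.root
  · obtain ⟨φ, hφ⟩ := hiso
    have h1 : Q.Iso trivialQPG := hQ.trans ((quStab_congr φ fun v => by
      rw [Set.mem_singleton_iff, Set.mem_singleton_iff, ← hφ, φ.injective.eq_iff]).trans hP)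
    exact ⟨Fin 1, inferInstance, ⊥, fun S _ u _ v _ huv => absurd (Subsingleton.elim u v) huv,
      h1.trans ((SPlus_iso_freeWreath 1).trans (freeWreath_one_iso _)).symm⟩
  · let K : Fin 2 → RootedGraph := ![H, P]
    let L : ∀ i, (K i).V → ℕ := Fin.cons l (Fin.cons l' fun i => i.elim0)
    have hL : ∀ i, IsLevel (K i).graph (L i) := by
      intro i
      fin_cases i
      · exact hl
      · exact hl'
    have hLr : ∀ i v, L i v = 0 ↔ v = (K i).root := by
      intro i
      fin_cases i
      · exact hr
      · exact hr'
    have hLmax : ∀ i v, L i v ≤ l x := by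
      intro i
      fin_cases i
      · exact fun v => hx v (Finset.mem_univ v)
      · exact hmax
    have hx0 : l x ≠ 0 := by
      obtain ⟨t, ht⟩ := exists_ne H.root
      have h1 := hx t (Finset.mem_univ t)
      have h2 := mt (hr t).1 ht
      omega
    have hKn : ∀ i, Nontrivial (K i).V := by
      intro i
      fin_cases i
      · exact hnt
      · exact ⟨y, P.root, fun e => hx0 (by rw [← hy]; exact (hr' y).2 e)⟩
    let M := rootedSum 0 (fun _ => 1) K
    let lM : M.V → ℕ := sumLevel 0 (fun _ => 1) K L
    have hlM : IsLevel M.graph lM := isLevel_sumLevel hL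
    have hMz : ∀ v, lM v = 0 ↔ v ∈ M.marks := fun v => by
      rw [show M.marks = {v | lM v = 0} from marks_eq_sumLevel hLr]
      rfl
    -- The new root has `H` on one side and `P` on the other, both of the same depth `l x`. The cone
    -- raises all levels by one.
    have hc : centers (cone M.graph M.marks) = {none} := by
      refine centers_eq_singleton (isLevel_cone hlM hMz) (fun _ => coneLevel_eq_zero)
        (fun v => ∃ m x, v = some (sumVert 0 (fun _ => 1) K 0 m x)) ?_ (l x + 1) ?_
        ⟨some (sumVert 0 (fun _ => 1) K 0 0 x), ⟨0, x, rfl⟩, rfl⟩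
        ⟨some (sumVert 0 (fun _ => 1) K 1 0 y), ?_, congrArg (· + 1) hy⟩
      · rintro (_ | u) (_ | v) huv hu hv
        · exact absurd rfl hu
        · exact absurd rfl hu
        · exact absurd rfl hv
        · obtain ⟨i, m, s, t, rfl, rfl, -⟩ := huv
          constructor
          · rintro ⟨m', s', e⟩
            cases e
            exact ⟨_, t, rfl⟩
          · rintro ⟨m', s', e⟩
            cases e
            exact ⟨_, s, rfl⟩
      · rintro (_ | (v | ⟨i, m, v⟩))
        · exact Nat.zero_le _
        · exact v.elim0
        · exact Nat.succ_le_succ (hLmax i v)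
      · rintro ⟨m, t, e⟩
        cases e
    refine ⟨Option M.V, inferInstance, cone M.graph M.marks,
      (isRootedTree_cone hlM hMz).isBlockGraph, ?_⟩
    have h1 := qu_iso_quStab_centers (cone M.graph M.marks)
    rw [hc] at h1
    refine QPG.Iso.trans ?_ h1.symm
    refine QPG.Iso.trans ?_ (quStab_iso_cone M.graph M.marks)
    refine QPG.Iso.trans ?_
      (quStab_rootedSum_two (fun i => ⟨L i, hL i, hLr i⟩) hKn hiso).symm
    exact hQ.trans ((freeProd₂_trivial_right_iso _).symm.trans
      (freeProd₂_congr (.refl _) hP.symm))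

end Realise

/-- The quantum automorphism groups of block graphs are the elements of `Jor⁺(ℂ)`. -/
theorem exists_blockGraph_iff_jorPlus (Q : QPG) :
    (∃ (V : Type) (_ : Fintype V) (G : SimpleGraph V), IsBlockGraph G ∧ Q.Iso (qu G)) ↔
      JorPlus (fun R => R = trivialQPG) Q := by
  constructor
  · rintro ⟨V, _, G, hG, hQ⟩
    exact .iso _ _ hQ.symm (hG.jorPlus (.base _ rfl))
  · exact fun h => h.isTreeStabiliser.exists_qu

/-! ### Groups of characters -/

section Characters

/-- The multiplication of scalars. -/
def mulHom : ℂ ⊗[ℂ] ℂ →⋆ₐ[ℂ] ℂ where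
  toAlgHom := Algebra.TensorProduct.lmul' ℂ
  map_star' x := by
    induction x using TensorProduct.induction_on with
    | zero => simp
    | tmul a b => simp
    | add x y hx hy =>
      simp only [star_add] at *
      simp_all

theorem mulHom_tmul (a b : ℂ) : mulHom (a ⊗ₜ[ℂ] b) = a * b := rfl

/-- The convolution product of two characters. -/
def QPG.conv (Q : QPG) (f g : Q.carrier →⋆ₐ[ℂ] ℂ) : Q.carrier →⋆ₐ[ℂ] ℂ :=
  (mulHom.comp (tmap f g)).comp Q.comul

theorem QPG.conv_apply (Q : QPG) (f g : Q.carrier →⋆ₐ[ℂ] ℂ) (a : Q.carrier) :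
    Q.conv f g a = mulHom (tmap f g (Q.comul a)) := rfl

/-- The characters of `Q` form the group `Γ`. -/
def IsClassical (Q : QPG) (Γ : Type) [Group Γ] : Prop :=
  ∃ e : Γ ≃ (Q.carrier →⋆ₐ[ℂ] ℂ), ∀ g h, e (g * h) = Q.conv (e g) (e h)

theorem isClassical_of {Q : QPG} {Γ : Type} [Group Γ] (e : Γ → Q.carrier →⋆ₐ[ℂ] ℂ)
    (he : Function.Bijective e) (h : ∀ g h, e (g * h) = Q.conv (e g) (e h)) : IsClassical Q Γ :=
  ⟨Equiv.ofBijective e he, h⟩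

/-- Both groups are the set of characters with the convolution product, so the quantum group
determines its classical group. -/
theorem IsClassical.mulEquiv {Q : QPG} {Γ Λ : Type} [Group Γ] [Group Λ] (h : IsClassical Q Γ)
    (h' : IsClassical Q Λ) : Nonempty (Γ ≃* Λ) := by
  obtain ⟨e, he⟩ := h
  obtain ⟨e', he'⟩ := h'
  refine ⟨⟨e.trans e'.symm, fun g h => ?_⟩⟩
  simp only [Equiv.toFun_as_coe, Equiv.trans_apply]
  rw [Equiv.symm_apply_eq, he, he']
  simp

theorem IsClassical.congr {Q : QPG} {Γ Λ : Type} [Group Γ] [Group Λ] (h : IsClassical Q Γ)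
    (φ : Γ ≃* Λ) : IsClassical Q Λ := by
  obtain ⟨e, he⟩ := h
  exact ⟨φ.symm.toEquiv.trans e, fun g h => by
    change e (φ.symm (g * h)) = _
    rw [map_mul, he]
    rfl⟩

theorem IsClassical.of_iso {Q R : QPG} {Γ : Type} [Group Γ] (h : IsClassical Q Γ)
    (hQR : Q.Iso R) : IsClassical R Γ := by
  obtain ⟨e, he⟩ := h
  obtain ⟨f, g, hgf, hfg, -, hg⟩ := hQR.exists_inverse
  refine isClassical_of (fun x => (e x).comp g) ⟨fun x y hxy => ?_, fun χ => ?_⟩ fun x y => ?_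
  · refine e.injective (StarAlgHom.ext fun a => ?_)
    have := DFunLike.congr_fun hxy (f a)
    simp only [StarAlgHom.comp_apply, hgf] at this
    exact this
  · obtain ⟨x, hx⟩ := e.surjective (χ.comp f)
    refine ⟨x, StarAlgHom.ext fun a => ?_⟩
    simp only [hx, StarAlgHom.comp_apply, hfg]
  · refine StarAlgHom.ext fun a => ?_
    rw [StarAlgHom.comp_apply, he, QPG.conv_apply, QPG.conv_apply, hg, tmap_comp_comp]

theorem isClassical_trivialQPG (Γ : Type) [Group Γ] [Subsingleton Γ] :
    IsClassical trivialQPG Γ := by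
  refine isClassical_of (fun _ => StarAlgHom.id ℂ ℂ) ⟨fun x y _ => Subsingleton.elim x y,
    fun χ => ⟨1, complex_hom_ext _ _⟩⟩ fun _ _ => complex_hom_ext _ _

theorem isClassical_freeProd {ι : Type} [Fintype ι] {Q : ι → QPG} {Γ : ι → Type}
    [∀ i, Group (Γ i)] (h : ∀ i, IsClassical (Q i) (Γ i)) :
    IsClassical (freeProd Q) (∀ i, Γ i) := by
  choose e he using h
  refine isClassical_of (Q := freeProd Q) (fun x => freeLift Q fun i => e i (x i))
    ⟨fun x y hxy => funext fun i => (e i).injective (StarAlgHom.ext fun a => ?_), fun χ => ?_⟩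
    fun x y => freeProd_hom_ext Q fun i a => ?_
  · exact DFunLike.congr_fun hxy (freeIncl Q i a)
  · refine ⟨fun i => (e i).symm (χ.comp (freeIncl Q i)), freeProd_hom_ext Q fun i a => ?_⟩
    rw [freeLift_incl, Equiv.apply_symm_apply]
    rfl
  · rw [freeLift_incl, Pi.mul_apply, he]
    change _ = mulHom (tmap _ _ (freeComul Q (freeIncl Q i a)))
    rw [freeComul_incl, tmap_comp_comp]
    rfl

theorem isClassical_freeProd₂ {Q R : QPG} {Γ Λ : Type} [Group Γ] [Group Λ]
    (h : IsClassical Q Γ) (h' : IsClassical R Λ) : IsClassical (freeProd₂ Q R) (Γ × Λ) := by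
  obtain ⟨e, he⟩ := h
  obtain ⟨e', he'⟩ := h'
  refine isClassical_of (fun x => freeLift₂ (e x.1) (e' x.2))
    ⟨fun x y hxy => Prod.ext (e.injective (StarAlgHom.ext fun a => ?_))
      (e'.injective (StarAlgHom.ext fun a => ?_)), fun χ => ?_⟩
    fun x y => freeProd₂_hom_ext (fun a => ?_) fun a => ?_
  · exact DFunLike.congr_fun hxy (inclL Q R a)
  · exact DFunLike.congr_fun hxy (inclR Q R a)
  · refine ⟨(e.symm (χ.comp (inclL Q R)), e'.symm (χ.comp (inclR Q R))),
      freeProd₂_hom_ext (fun a => ?_) fun a => ?_⟩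
    · rw [freeLift₂_inclL, Equiv.apply_symm_apply]
      rfl
    · rw [freeLift₂_inclR, Equiv.apply_symm_apply]
      rfl
  · rw [freeLift₂_inclL, Prod.fst_mul, he]
    change _ = mulHom (tmap _ _ (tmap (inclL Q R) (inclL Q R) (Q.comul a)))
    rw [tmap_comp_comp]
    rfl
  · rw [freeLift₂_inclR, Prod.snd_mul, he']
    change _ = mulHom (tmap _ _ (tmap (inclR Q R) (inclR Q R) (R.comul a)))
    rw [tmap_comp_comp]
    rfl

/-- The matrix of a permutation. -/
def permMatrix {V : Type} (σ : Equiv.Perm V) : V → V → ℂ :=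
  open Classical in fun x y => if σ y = x then 1 else 0

theorem isMagic_permMatrix {V : Type} [Fintype V] (σ : Equiv.Perm V) : IsMagic (permMatrix σ) := by
  classical
  refine ⟨fun x y => ?_, fun x y => ?_, fun x y z h => ?_, fun x y z h => ?_, fun x => ?_,
    fun y => ?_⟩
  · unfold permMatrix; split_ifs <;> simp
  · unfold permMatrix; split_ifs <;> simp
  · unfold permMatrix
    split_ifs with h1 h2
    · exact absurd (σ.injective (h1.trans h2.symm)) h
    all_goals simp
  · unfold permMatrix
    split_ifs with h1 h2
    · exact absurd (h1.symm.trans h2) h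
    all_goals simp
  · unfold permMatrix
    rw [Finset.sum_eq_single (σ.symm x)]
    · simp
    · intro y _ hy
      rw [if_neg]
      rintro rfl
      simp at hy
    · simp
  · unfold permMatrix
    simp

/-- Idempotents of ℂ are 0 and 1. Every column contains a 1, and no row contains two. -/
theorem exists_permMatrix {V : Type} [Fintype V] {U : V → V → ℂ} (hU : IsMagic U) :
    ∃ σ : Equiv.Perm V, U = permMatrix σ := by
  classical
  have h01 : ∀ x y, U x y = 0 ∨ U x y = 1 := fun x y => by
    have := hU.idem x y
    by_cases h : U x y = 0
    · exact Or.inl h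
    · exact Or.inr (mul_left_cancel₀ h (by rw [this, mul_one]))
  have hex : ∀ y, ∃ x, U x y = 1 := fun y => by
    obtain ⟨x, hx⟩ := hU.exists_mul_col (one_ne_zero (α := ℂ)) y
    rw [one_mul] at hx
    exact ⟨x, (h01 x y).resolve_left hx⟩
  choose f hf using hex
  have hinj : Function.Injective f := by
    intro y z hyz
    by_contra hne
    have := hU.row_orth (f y) y z hne
    rw [hf, hyz, hf, one_mul] at this
    exact one_ne_zero this
  refine ⟨Equiv.ofBijective f (Finite.injective_iff_bijective.1 hinj), funext fun x => funext
    fun y => ?_⟩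
  simp only [permMatrix, Equiv.ofBijective_apply]
  split_ifs with h
  · rw [← h, hf]
  · refine (h01 x y).resolve_right fun h1 => one_ne_zero (α := ℂ) ?_
    rw [← hU.col_orth x y (f y) (Ne.symm h), h1, hf, one_mul]

theorem permMatrix_injective {V : Type} : Function.Injective (permMatrix (V := V)) := by
  intro σ τ h
  ext y
  have h1 := congrFun (congrFun h (τ y)) y
  simp only [permMatrix, if_true] at h1
  by_contra hne
  rw [if_neg hne] at h1
  exact zero_ne_one h1

theorem permMatrix_mul {V : Type} [Fintype V] (σ τ : Equiv.Perm V) (x y : V) :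
    ∑ z, permMatrix σ x z * permMatrix τ z y = permMatrix (σ * τ) x y := by
  classical
  rw [Finset.sum_eq_single (τ y)]
  · have h1 : permMatrix τ (τ y) y = 1 := if_pos rfl
    rw [h1, mul_one]
    rfl
  · intro z _ hz
    simp [permMatrix, hz.symm]
  · simp

theorem permMatrix_mul_ne_zero {V : Type} {σ : Equiv.Perm V} {x y x' y' : V} :
    permMatrix σ x y * permMatrix σ x' y' ≠ 0 ↔ σ y = x ∧ σ y' = x' := by
  classical
  simp [permMatrix, and_comm]

theorem isAdapted_permMatrix_iff {V : Type} [Fintype V] {G : SimpleGraph V} {R : Set V}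
    {σ : Equiv.Perm V} : IsAdapted G R (permMatrix σ) ↔
      (∀ x y, G.Adj (σ x) (σ y) ↔ G.Adj x y) ∧ ∀ x, σ x ∈ R ↔ x ∈ R := by
  classical
  constructor
  · intro h
    refine ⟨fun x y => h.adj_iff (permMatrix_mul_ne_zero.2 ⟨rfl, rfl⟩), fun x => h.mem_iff ?_⟩
    simp [permMatrix]
  · rintro ⟨h, h'⟩
    refine isAdapted_iff.2 ⟨isMagic_permMatrix σ, fun x x' y y' hn => ?_, fun x y hn => ?_⟩
    · by_contra h0
      obtain ⟨rfl, rfl⟩ := permMatrix_mul_ne_zero.1 h0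
      exact hn (h y y')
    · unfold permMatrix
      rw [if_neg]
      rintro rfl
      exact hn (h' y)

theorem IsAdapted.map {V A B : Type} [Fintype V] [Ring A] [StarRing A] [Algebra ℂ A]
    [StarModule ℂ A] [Ring B] [StarRing B] [Algebra ℂ B] [StarModule ℂ B] {G : SimpleGraph V}
    {R : Set V} {U : V → V → A} (h : IsAdapted G R U) (f : A →⋆ₐ[ℂ] B) :
    IsAdapted G R fun x y => f (U x y) := by
  have h0 := isAdapted_iff.1 h
  refine isAdapted_iff.2 ⟨h0.1.map f, fun x x' y y' hn => ?_, fun x y hn => ?_⟩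
  · rw [← map_mul, h0.2.1 x x' y y' hn, map_zero]
  · rw [h0.2.2 x y hn, map_zero]

/-- The characters of a quantum stabiliser are the automorphisms that preserve the set. -/
theorem isClassical_quStab {V : Type} [Fintype V] {G : SimpleGraph V} {R : Set V} {Γ : Type}
    [Group Γ] (φ : Γ →* Equiv.Perm V) (hφ : Function.Injective φ)
    (hr : ∀ σ : Equiv.Perm V, σ ∈ φ.range ↔
      (∀ x y, G.Adj (σ x) (σ y) ↔ G.Adj x y) ∧ ∀ x, σ x ∈ R ↔ x ∈ R) :
    IsClassical (quStab G R) Γ := by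
  have hA : ∀ g, IsAdapted G R (permMatrix (φ g)) := fun g =>
    isAdapted_permMatrix_iff.2 ((hr _).1 ⟨g, rfl⟩)
  refine isClassical_of (Q := quStab G R) (fun g => adaptedLift (hA g))
    ⟨fun g h hgh => hφ (permMatrix_injective (funext fun x => funext fun y => ?_)), fun χ => ?_⟩
    fun g h => Univ.hom_ext fun p => ?_
  · exact DFunLike.congr_fun hgh (Univ.of (stabRel G R) (x, y))
  · let χ' : Univ (stabRel G R) →⋆ₐ[ℂ] ℂ := χ
    have hχ := (isAdapted_of G R).map χ'
    obtain ⟨σ, hσ⟩ := exists_permMatrix hχ.magic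
    rw [hσ] at hχ
    obtain ⟨g, hg⟩ := (hr σ).2 (isAdapted_permMatrix_iff.1 hχ)
    refine ⟨g, Univ.hom_ext fun p => ?_⟩
    change permMatrix (φ g) p.1 p.2 = _
    rw [hg]
    exact (congrFun (congrFun hσ p.1) p.2).symm
  · change permMatrix (φ (g * h)) p.1 p.2 = mulHom (tmap (adaptedLift (hA g)) (adaptedLift (hA h))
      (coprod (fun x y => Univ.of (stabRel G R) (x, y)) p.1 p.2))
    rw [map_mul, ← permMatrix_mul, coprod_apply, map_sum, map_sum]
    rfl

theorem isClassical_qu {V : Type} [Fintype V] (G : SimpleGraph V) :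
    IsClassical (qu G) (GraphAut G) := by
  refine isClassical_quStab (R := ∅)
    { toFun := fun φ => φ.toEquiv, map_one' := rfl, map_mul' := fun _ _ => rfl }
    (fun φ ψ h => RelIso.toEquiv_injective h) fun σ => ⟨?_, fun h => ?_⟩
  · rintro ⟨φ, rfl⟩
    exact ⟨fun x y => φ.map_adj_iff, fun x => Iff.rfl⟩
  · exact ⟨⟨σ, fun {x y} => h.1 x y⟩, rfl⟩

theorem isClassical_quFix {V : Type} [Fintype V] (G : SimpleGraph V) (r : V) :
    IsClassical (quFix G r) (autFix G r) := by
  refine isClassical_quStab (R := {r})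
    { toFun := fun φ => φ.1.toEquiv, map_one' := rfl, map_mul' := fun _ _ => rfl }
    (fun φ ψ h => Subtype.ext (RelIso.toEquiv_injective h)) fun σ => ⟨?_, fun h => ?_⟩
  · rintro ⟨⟨φ, hφ⟩, rfl⟩
    have hφ' : φ r = r := hφ
    refine ⟨fun x y => φ.map_adj_iff, fun x => ?_⟩
    change φ x = r ↔ x = r
    rw [← φ.injective.eq_iff (a := x), hφ']
  · exact ⟨⟨⟨σ, fun {x y} => h.1 x y⟩, (h.2 r).2 rfl⟩, rfl⟩

theorem isClassical_SPlus (n : ℕ) : IsClassical (SPlus n) (Equiv.Perm (Fin n)) := by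
  refine isClassical_quStab (R := ∅) (MonoidHom.id _) Function.injective_id fun σ =>
    iff_of_true ⟨σ, rfl⟩ ⟨fun x y => Iff.rfl, fun x => Iff.rfl⟩

/-- A character of the free wreath product consists of a character on each copy and a complex magic
unitary, that is, a permutation. The commutation relations are void in ℂ. -/
theorem isClassical_freeWreath {Q : QPG} {Γ : Type} [Group Γ] (d : ℕ) (h : IsClassical Q Γ) :
    IsClassical (freeWreath Q d) (PermWreath Γ d) := by
  classical
  obtain ⟨e, he⟩ := h
  let E : PermWreath Γ d → WreathAlg Q d →⋆ₐ[ℂ] ℂ := fun x =>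
    wreathLift Q d (fun i => e (x.left i)) (permMatrix x.right) (isMagic_permMatrix _)
      fun _ _ _ => Commute.all _ _
  have hE1 : ∀ x i a, E x (wreathIncl Q d i a) = e (x.left i) a := fun _ _ _ => rfl
  have hE2 : ∀ x i j, E x (wreathPerm Q d i j) = permMatrix x.right i j := fun _ _ _ => rfl
  refine isClassical_of (Q := freeWreath Q d) E ⟨fun x y hxy => ?_, fun χ => ?_⟩
    fun x y => wreath_hom_ext Q d (fun i a => ?_) fun i j => ?_
  · refine SemidirectProduct.ext (funext fun i => e.injective (StarAlgHom.ext fun a => ?_))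
      (permMatrix_injective (funext fun i => funext fun j => ?_))
    · exact DFunLike.congr_fun hxy (wreathIncl Q d i a)
    · exact DFunLike.congr_fun hxy (wreathPerm Q d i j)
  · let χ' : WreathAlg Q d →⋆ₐ[ℂ] ℂ := χ
    obtain ⟨σ, hσ⟩ := exists_permMatrix ((isMagic_wreathPerm Q d).map χ')
    refine ⟨⟨fun i => e.symm (χ'.comp (wreathIncl Q d i)), σ⟩,
      wreath_hom_ext Q d (fun i a => ?_) fun i j => ?_⟩
    · rw [hE1]
      simp only [Equiv.apply_symm_apply]
      rfl
    · rw [hE2]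
      exact (congrFun (congrFun hσ i) j).symm
  · rw [hE1]
    change _ = mulHom (tmap (E x) (E y) (wreathComul Q d (wreathIncl Q d i a)))
    -- With the convention `σ k = i` for the entry 1 of `permMatrix σ i k`, only this `k` survives.
    -- It is the index through which the permutation acts on the coordinates in the semidirect
    -- product.
    rw [wreathComul_incl, map_sum, map_sum, Finset.sum_eq_single (x.right⁻¹ i)]
    · rw [map_mul, map_mul, tmap_tmul, tmap_comp_comp, map_one, mulHom_tmul, mul_one, hE2]
      have h1 : permMatrix x.right i (x.right⁻¹ i) = 1 := by simp [permMatrix]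
      rw [h1, one_mul, SemidirectProduct.mul_left, Pi.mul_apply, he, QPG.conv_apply]
      rfl
    · intro k _ hk
      rw [map_mul, map_mul, tmap_tmul, map_one, mulHom_tmul, mul_one, hE2]
      have h1 : permMatrix x.right i k = 0 := by
        unfold permMatrix
        rw [if_neg]
        rintro rfl
        simp at hk
      rw [h1, zero_mul]
    · simp
  · rw [hE2]
    change _ = mulHom (tmap (E x) (E y) (wreathComul Q d (wreathPerm Q d i j)))
    rw [wreathComul_perm, coprod_apply, map_sum, map_sum, SemidirectProduct.mul_right,
      ← permMatrix_mul]
    rfl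

end Characters

/-! ### Automorphism groups of block graphs -/

/-- Taking characters turns each closure operation on quantum groups into the corresponding
operation on groups. -/
theorem JorPlus.exists_jor {Q : QPG} (h : JorPlus (fun R => R = trivialQPG) Q) :
    ∃ (Γ : Type) (_ : Group Γ), Jor (fun Λ _ => Subsingleton Λ) Γ ∧ IsClassical Q Γ := by
  induction h with
  | base Q hQ =>
    exact ⟨Unit, inferInstance, .base _ (inferInstanceAs (Subsingleton Unit)),
      hQ ▸ isClassical_trivialQPG Unit⟩
  | iso Q R hQR _ ih =>
    obtain ⟨Γ, _, hΓ, hc⟩ := ih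
    exact ⟨Γ, _, hΓ, hc.of_iso hQR⟩
  | freeProd Q R _ _ ihQ ihR =>
    obtain ⟨Γ, _, hΓ, hc⟩ := ihQ
    obtain ⟨Λ, _, hΛ, hc'⟩ := ihR
    exact ⟨Γ × Λ, _, .prod _ _ hΓ hΛ, isClassical_freeProd₂ hc hc'⟩
  | freeWreath Q d hd _ ih =>
    obtain ⟨Γ, _, hΓ, hc⟩ := ih
    exact ⟨PermWreath Γ d, _, .wreath _ d hd hΓ, isClassical_freeWreath d hc⟩

theorem Jor.exists_jorPlus {Γ : Type} [Group Γ] (h : Jor (fun Λ _ => Subsingleton Λ) Γ) :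
    ∃ Q, JorPlus (fun R => R = trivialQPG) Q ∧ IsClassical Q Γ := by
  induction h with
  | base Γ hΓ => exact ⟨trivialQPG, .base _ rfl, isClassical_trivialQPG Γ⟩
  | iso Γ Λ φ _ ih =>
    obtain ⟨Q, hQ, hc⟩ := ih
    exact ⟨Q, hQ, hc.congr φ⟩
  | prod Γ Λ _ _ ihΓ ihΛ =>
    obtain ⟨Q, hQ, hc⟩ := ihΓ
    obtain ⟨R, hR, hc'⟩ := ihΛ
    exact ⟨freeProd₂ Q R, .freeProd _ _ hQ hR, isClassical_freeProd₂ hc hc'⟩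
  | wreath Γ d hd _ ih =>
    obtain ⟨Q, hQ, hc⟩ := ih
    exact ⟨freeWreath Q d, .freeWreath _ d hd hQ, isClassical_freeWreath d hc⟩

theorem exists_blockGraph_iff_jor (Γ : Type) [Group Γ] :
    (∃ (V : Type) (_ : Fintype V) (G : SimpleGraph V), IsBlockGraph G ∧
      Nonempty (Γ ≃* GraphAut G)) ↔ Jor (fun Λ _ => Subsingleton Λ) Γ := by
  constructor
  · rintro ⟨V, _, G, hG, ⟨φ⟩⟩
    obtain ⟨Λ, _, hΛ, hc⟩ := ((exists_blockGraph_iff_jorPlus _).1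
      ⟨V, _, G, hG, QPG.Iso.refl _⟩).exists_jor
    obtain ⟨ψ⟩ := hc.mulEquiv (isClassical_qu G)
    exact .iso _ _ (ψ.trans φ.symm) hΛ
  · intro h
    obtain ⟨Q, hQ, hc⟩ := h.exists_jorPlus
    obtain ⟨V, hV, G, hG, hiso⟩ := (exists_blockGraph_iff_jorPlus _).2 hQ
    exact ⟨V, hV, G, hG, (hc.of_iso hiso).mulEquiv (isClassical_qu G)⟩

/-! ### Decomposition of a connected block graph at its center -/

section Center

variable {V : Type} [hV : Fintype V] {G : SimpleGraph V}

theorem psi_cases (hB : IsBlockGraph G) (hG : G.Connected) :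
    (∃ r, G.center = {r} ∧ psi G G.center = psiCut G r) ∨
      (G.IsClique G.center ∧ psi G G.center = psiBlock G G.center) := by
  by_cases h : ∃ r, IsCutVertex G r ∧ G.center = {r}
  · exact Or.inl ⟨h.choose, h.choose_spec.2, dif_pos h⟩
  · exact Or.inr ⟨hB _ ((hB.center_cases hG).resolve_left h), dif_neg h⟩

theorem qu_iso_quStab_center (hG : G.Connected) : (qu G).Iso (quStab G G.center) := by
  rw [center_eq_centers hG]
  exact qu_iso_quStab_centers G

theorem exists_isDecomposition_psi (hB : IsBlockGraph G) (hG : G.Connected) :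
    ∃ (z k : ℕ) (a : Fin k → ℕ) (H : Fin k → RootedGraph),
      IsDecomposition (psi G G.center) z a H := by
  rcases psi_cases hB hG with ⟨r, -, h⟩ | ⟨-, h⟩
  · rw [h]
    exact exists_isDecomposition (isRootedForest_psiCut (hB.isRootedTree hG r))
  · obtain ⟨l, hl, hc⟩ := hB.exists_isLevel_centers
    rw [← center_eq_centers hG] at hc
    rw [h]
    exact @exists_isDecomposition (psiBlock G G.center) hV (isRootedForest_psiBlock hl hc)

theorem qu_iso_of_isDecomposition (hB : IsBlockGraph G) (hG : G.Connected) {z k : ℕ}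
    {a : Fin k → ℕ} {H : Fin k → RootedGraph} (h : IsDecomposition (psi G G.center) z a H) :
    (qu G).Iso (freeProd₂ (SPlus z)
      (freeProd fun i => freeWreath (quFix (H i).graph (H i).root) (a i))) := by
  refine (qu_iso_quStab_center hG).trans ?_
  rcases psi_cases hB hG with ⟨r, hr, hp⟩ | ⟨hc, hp⟩
  · rw [hp] at h
    rw [hr]
    exact (quFix_iso_psiCut hG r).trans h.quStab_iso
  · rw [hp] at h
    exact (quStab_iso_psiBlock hc).trans
      (@IsDecomposition.quStab_iso (psiBlock G G.center) _ _ _ _ hV h)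

/-- The characters of the two sides of the quantum isomorphism are compared; no separate argument
for automorphisms is needed. -/
theorem graphAut_mulEquiv_of_isDecomposition (hB : IsBlockGraph G) (hG : G.Connected) {z k : ℕ}
    {a : Fin k → ℕ} {H : Fin k → RootedGraph} (h : IsDecomposition (psi G G.center) z a H) :
    Nonempty (GraphAut G ≃* Equiv.Perm (Fin z) ×
      ∀ i, PermWreath (autFix (H i).graph (H i).root) (a i)) :=
  ((isClassical_qu G).of_iso (qu_iso_of_isDecomposition hB hG h)).mulEquiv
    (isClassical_freeProd₂ (isClassical_SPlus z) (isClassical_freeProd fun i =>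
      isClassical_freeWreath (a i) (isClassical_quFix (H i).graph (H i).root)))

end Center

end QBlock
end

theorem mainTheorem3 :
    (∀ (V : Type) [Fintype V] (G : SimpleGraph V), G.Connected → IsBlockGraph G →
      ((∃ r, IsCutVertex G r ∧ G.center = {r}) ∨ IsBlock G G.center) ∧
      (∃ (z k : ℕ) (a : Fin k → ℕ) (H : Fin k → RootedGraph),
        IsDecomposition (psi G G.center) z a H) ∧
      (∀ (z k : ℕ) (a : Fin k → ℕ) (H : Fin k → RootedGraph),
        IsDecomposition (psi G G.center) z a H →
          (qu G).Iso (freeProd₂ (SPlus z)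
            (freeProd fun i => freeWreath (quFix (H i).graph (H i).root) (a i))) ∧
          Nonempty (GraphAut G ≃* Equiv.Perm (Fin z) ×
            ∀ i, PermWreath (autFix (H i).graph (H i).root) (a i)))) ∧
    (∀ (Γ : Type) [Group Γ],
      (∃ (V : Type) (_ : Fintype V) (G : SimpleGraph V), IsBlockGraph G ∧
        Nonempty (Γ ≃* GraphAut G)) ↔
      Jor (fun Λ _ => Subsingleton Λ) Γ) ∧
    (∀ Q : QPG,
      (∃ (V : Type) (_ : Fintype V) (G : SimpleGraph V), IsBlockGraph G ∧ Q.Iso (qu G)) ↔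
      JorPlus (fun R => R = trivialQPG) Q) := by
  refine ⟨fun V _ G hG hB => ⟨hB.center_cases hG, exists_isDecomposition_psi hB hG,
    fun z k a H h => ⟨qu_iso_of_isDecomposition hB hG h,
      graphAut_mulEquiv_of_isDecomposition hB hG h⟩⟩,
    fun Γ _ => exists_blockGraph_iff_jor Γ, exists_blockGraph_iff_jorPlus⟩
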